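/- **Setting.** A kernel has read-only input arrays, index, boolean and real inputs, and one real output array $B$ on $\mathbb Z^d$. A *loop* has a counter (initial value an index expression in the enclosing counters and the index inputs, fixed stride), a fixed number $N$ of iterations, and a body: a finite list of statements in single-assignment form, each guarded by a condition on counters, index inputs and boolean inputs. A statement computes a local scalar (assignment, arithmetic operation, read of an array element), writes an element of $B$, or calls an inner loop with scalar arguments; inner and outer loops share $B$. A $1$-level loop calls no loop; a $K$-level nested loop calls only loops of nesting depth less than $K$, and at least one $(K-1)$-level nested loop. Fix a real $\kappa>1$ and $s\in\mathbb N$, and read $a\ll b$ as $\kappa a\le b$. Let a loop of the kernel with $N$ iterations be invoked $M$ times, and let $ST^{(m,n)}$ be the set of statements executed in the $n$-th iteration of its $m$-th invocation. The loop is *regular* with typical set $ST^*$ (a subset of the statements of its body) if for every input of the kernel the number $r$ of pairs $(m,n)$ with $ST^{(m,n)}\ne ST^*$ satisfies $r\ll M$ and $r\ll N$, and each of these pairs satisfies $|ST^{(m,n)}\setminus ST^*|\le s$ or $|ST^{(m,n)}\setminus ST^*|\ll|ST^*|$. The *SSA-based multilevel graph* (SMG) of an execution has one vertex for each variable instance (loop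 invocation, iteration, variable) with data, operation, level and loop attributes, and edges for data dependencies; the data of a vertex is its operation applied to the data of its predecessors. An *invariant subgraph* of a loop is a graph $G^*$ such that for each typical iteration $(m,n)$ forgetting $(m,n)$ maps the vertices of that iteration bijectively onto those of $G^*$ and preserves edges and operations (the operation of the vertex $\varphi$ for the output array being replaced by an extended $\varphi$ function), edges between different typical iterations of one invocation are mapped to edges of $G^*$, and $G^*$ has a vertex with an extended $\varphi$ function that yields the output array after each iteration, typical or not. An *invariant graph* consists of an invariant subgraph for each loop, together with the images of the SMG edges between different loops. A *summary* is a finite list of branches (condition $\to$ expression). A condition is a boolean combination of boolean inputs and of comparisons of index expressions in the index inputs and the coordinates of an array position (inside the loops also in the iteration number $t$ and the enclosing counters). An expression is built by real operations from constants, real inputs, elements of the input arrays and elements of the initial output array. It describes the array whose element at a position is the value of the branch whose condition holds there, and the initial value if there is none. The *hierarchical recursive lifting algorithm* on the invariant subgraph of a loop processes the strongly connected components (SCCs) in a topological order, and lifts the loops called in a component recursively before it. A single vertex on no cycle gets its summary by the summary rule of its operation. In any other SCC the start vertex is a $\varphi$ vertex, initialized with the initial array. After a sweep that applies the rules of the other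 vertices along the edges and that of the start vertex last, it repeats: *generalize* the summary of the start vertex (at $(\mathbf x,t)$, $0\le t\le N$, the generalized summary has the value given by the update of position $\mathbf x$ in an iteration $1\le t_1\le t$ that no update in an iteration $t_1<t_2\le t$ overwrites, and no branch applies if there is no such update), replace $t$ by $t-1$, sweep again; it stops when the new summary of the start vertex equals the generalized one for all $1\le t\le N$. The postcondition of the loop is the summary of its $\varphi$ vertex at $t=N$; at a call its formal inputs are replaced by the summaries of the actual ones. The generalized summaries, the topological order and the sweep orders may be chosen freely subject to these requirements. **Theorem (algorithm completeness).** Let $L$ be a $K$-level nested loop each of whose loops is regular. Then typical sets exist for all its loops, and for every choice of typical sets with which the loops are regular: 1. for every input, the SMG of $L$ with $K$ levels can be constructed and has the stated properties; 2. the invariant graph of $L$ for these typical sets can be constructed and has the stated properties; 3. admissible choices for the algorithm exist, and for all admissible choices the hierarchical recursive lifting algorithm terminates after finitely many rounds and returns a sound summary of $L$: its conditions are mutually exclusive, and for every input it describes the output array after the execution of $L$. -/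

import Mathlib

/-!
Nested-loop stencil kernels, their SSA-based multilevel graphs and invariant graphs, symbolic
summaries, and the hierarchical recursive lifting algorithm.
-/

namespace StencilLifting

/-! ### Index expressions and conditions -/

/-- Numbers of the declared inputs of a kernel, and the dimension of its output array. -/
structure Signature where
  dim : ℕ
  arrays : ℕ
  nums : ℕ
  indices : ℕ
  conds : ℕ

/-- Index expressions over variables `X`. -/
inductive IndexExpr (X : Type) where
  | lit (z : ℤ)
  | var (x : X)
  | add (a b : IndexExpr X)
  | sub (a b : IndexExpr X)
  | mul (a b : IndexExpr X)
  | div (a b : IndexExpr X)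
  | mod (a b : IndexExpr X)
  | neg (a : IndexExpr X)

namespace IndexExpr

variable {X Y : Type}

def eval (ρ : X → ℤ) : IndexExpr X → ℤ
  | lit z => z
  | var x => ρ x
  | add a b => a.eval ρ + b.eval ρ
  | sub a b => a.eval ρ - b.eval ρ
  | mul a b => a.eval ρ * b.eval ρ
  | div a b => a.eval ρ / b.eval ρ
  | mod a b => a.eval ρ % b.eval ρ
  | neg a => - a.eval ρ

def subst (θ : X → IndexExpr Y) : IndexExpr X → IndexExpr Y
  | lit z => lit z
  | var x => θ x
  | add a b => add (a.subst θ) (b.subst θ)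
  | sub a b => sub (a.subst θ) (b.subst θ)
  | mul a b => mul (a.subst θ) (b.subst θ)
  | div a b => div (a.subst θ) (b.subst θ)
  | mod a b => mod (a.subst θ) (b.subst θ)
  | neg a => neg (a.subst θ)

/-- The variables that occur in an index expression. -/
def vars : IndexExpr X → Set X
  | lit _ => ∅
  | var x => {x}
  | add a b => a.vars ∪ b.vars
  | sub a b => a.vars ∪ b.vars
  | mul a b => a.vars ∪ b.vars
  | div a b => a.vars ∪ b.vars
  | mod a b => a.vars ∪ b.vars
  | neg a => a.vars

end IndexExpr

/-- The six comparisons of indices. -/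
inductive Cmp where
  | eq | ne | lt | le | gt | ge

def Cmp.eval : Cmp → ℤ → ℤ → Bool
  | eq, a, b => decide (a = b)
  | ne, a, b => decide (a ≠ b)
  | lt, a, b => decide (a < b)
  | le, a, b => decide (a ≤ b)
  | gt, a, b => decide (a > b)
  | ge, a, b => decide (a ≥ b)

/-- Conditions: comparisons of indices, boolean inputs, and boolean combinations. -/
inductive CondExpr (nc : ℕ) (X : Type) where
  | cmp (o : Cmp) (a b : IndexExpr X)
  | input (b : Fin nc)
  | and (a b : CondExpr nc X)
  | or (a b : CondExpr nc X)
  | not (a : CondExpr nc X)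

namespace CondExpr

variable {nc : ℕ} {X Y : Type}

def eval (κ : Fin nc → Bool) (ρ : X → ℤ) : CondExpr nc X → Bool
  | cmp o a b => o.eval (a.eval ρ) (b.eval ρ)
  | input b => κ b
  | and a b => a.eval κ ρ && b.eval κ ρ
  | or a b => a.eval κ ρ || b.eval κ ρ
  | not a => !(a.eval κ ρ)

def subst (κ : Fin nc → CondExpr nc Y) (θ : X → IndexExpr Y) : CondExpr nc X → CondExpr nc Y
  | cmp o a b => cmp o (a.subst θ) (b.subst θ)
  | input b => κ b
  | and a b => and (a.subst κ θ) (b.subst κ θ)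
  | or a b => or (a.subst κ θ) (b.subst κ θ)
  | not a => not (a.subst κ θ)

/-- The index variables that occur in a condition. -/
def vars : CondExpr nc X → Set X
  | cmp _ a b => a.vars ∪ b.vars
  | input _ => ∅
  | and a b => a.vars ∪ b.vars
  | or a b => a.vars ∪ b.vars
  | not a => a.vars

/-- The boolean inputs that occur in a condition. -/
def inputs : CondExpr nc X → Set (Fin nc)
  | cmp _ _ _ => ∅
  | input b => {b}
  | and a b => a.inputs ∪ b.inputs
  | or a b => a.inputs ∪ b.inputs
  | not a => a.inputs

def tt : CondExpr nc X := cmp .eq (.lit 0) (.lit 0)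

/-- Disjunction of a list. -/
def any (l : List (CondExpr nc X)) : CondExpr nc X := l.foldr or (not tt)

/-- Conjunction of a list. -/
def all (l : List (CondExpr nc X)) : CondExpr nc X := l.foldr and tt

end CondExpr

inductive UnOp where
  | neg | abs | sqrt

inductive BinOp where
  | add | sub | mul | div | min | max

noncomputable def UnOp.eval : UnOp → ℝ → ℝ
  | neg, x => -x
  | abs, x => |x|
  | sqrt, x => Real.sqrt x

noncomputable def BinOp.eval : BinOp → ℝ → ℝ → ℝ
  | add, x, y => x + y
  | sub, x, y => x - y
  | mul, x, y => x * y
  | div, x, y => x / y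
  | min, x, y => Min.min x y
  | max, x, y => Max.max x y

/-! ### Programs -/

/-- Index variables of the source: the loop counters, numbered from the innermost one outwards,
and the index inputs of the kernel. -/
inductive SrcVar (sg : Signature) where
  | counter (j : ℕ)
  | input (p : Fin sg.indices)

/-- Scalar operands: a constant, a scalar parameter of the enclosing loop (of the kernel for the
outermost loop), or the scalar computed by the `j`-th statement of the same body. -/
inductive Operand where
  | lit (r : ℝ)
  | param (s : ℕ)
  | temp (j : ℕ)

/-- The statements. `C` is the type of the loops that may be called from the body.
Each statement defines its own variable: a scalar, or a new version of the output array. -/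
inductive Op (sg : Signature) (C : Type) where
  | assign (x : Operand)
  | un (o : UnOp) (x : Operand)
  | bin (o : BinOp) (x y : Operand)
  | getIn (a : Fin sg.arrays) (i : List (IndexExpr (SrcVar sg)))
  | getOut (i : Fin sg.dim → IndexExpr (SrcVar sg))
  | set (i : Fin sg.dim → IndexExpr (SrcVar sg)) (x : Operand)
  | call (c : C) (args : List Operand)

/-- A statement with the condition of the (possibly nested) branch it stands in. -/
structure Stmt (sg : Signature) (C : Type) where
  guard : CondExpr sg.conds (SrcVar sg)
  op : Op sg C

/-- A loop: the initial value of its counter (an expression in the counters of the enclosing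
loops and the index inputs), its stride, its number of iterations, and its body. -/
structure LoopOver (sg : Signature) (C : Type) where
  start : IndexExpr (SrcVar sg)
  step : ℤ
  iters : ℕ
  body : List (Stmt sg C)

/-- Loops of nesting depth at most `k`. -/
def Nest (sg : Signature) : ℕ → Type
  | 0 => Empty
  | k + 1 => LoopOver sg (Nest sg k)

/-- `K`-level nested loops: a `1`-level loop has no loop in its body, and a `K`-level one has at
least one `(K - 1)`-level loop in its body. -/
def IsNestedLoop (sg : Signature) : (K : ℕ) → Nest sg K → Prop
  | 0, _ => False
  | 1, _ => True
  | k + 2, L => ∃ s ∈ LoopOver.body L, ∃ (c : Nest sg (k + 1)) (args : List Operand),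
      s.op = Op.call c args ∧ IsNestedLoop sg (k + 1) c

/-! ### Execution -/

/-- The output array. -/
abbrev Arr (sg : Signature) : Type := (Fin sg.dim → ℤ) → ℝ

/-- The read-only inputs that are visible in all loops. -/
structure Data (sg : Signature) where
  arr : Fin sg.arrays → List ℤ → ℝ
  idx : Fin sg.indices → ℤ
  cond : Fin sg.conds → Bool

/-- An input of a kernel: read-only data, scalar parameters, and the initial output array. -/
structure Input (sg : Signature) where
  data : Data sg
  num : Fin sg.nums → ℝ
  out : Arr sg

/-- The scalar parameters as a list. -/
def Input.nums {sg : Signature} (inp : Input sg) : List ℝ := List.ofFn inp.num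

/-- Values of the source index variables; `cs` lists the counters, innermost first. -/
def srcEnv {sg : Signature} (σ : Data sg) (cs : List ℤ) : SrcVar sg → ℤ
  | .counter j => cs.getD j 0
  | .input p => σ.idx p

/-- The state inside one iteration: the scalars computed so far (`0` if not computed), and the
output array. -/
structure BodyState (sg : Signature) where
  temps : ℕ → ℝ
  arr : Arr sg

def Operand.eval (ps : List ℝ) (temps : ℕ → ℝ) : Operand → ℝ
  | lit r => r
  | param s => ps.getD s 0
  | temp j => temps j

/-- The counter value in the `n`-th iteration (`n = 1, 2, …`); `cs` are the enclosing counters. -/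
def LoopOver.counter {sg : Signature} {C : Type} (L : LoopOver sg C) (σ : Data sg) (cs : List ℤ)
    (n : ℕ) : ℤ :=
  L.start.eval (srcEnv σ cs) + L.step * ((n : ℤ) - 1)

/-- The set of statements executed in an iteration with counters `cs` (own counter first). -/
def LoopOver.executed {sg : Signature} {C : Type} (L : LoopOver sg C) (σ : Data sg)
    (cs : List ℤ) : Finset ℕ :=
  (Finset.range L.body.length).filter fun i =>
    ∃ s ∈ L.body[i]?, s.guard.eval σ.cond (srcEnv σ cs) = true

section Execution

variable {sg : Signature} {C : Type} (run : C → List ℤ → List ℝ → Arr sg → Arr sg)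
  (σ : Data sg)

open Classical in
/-- Effect of the statement with number `i`; `run` is the meaning of the callable loops. -/
noncomputable def execOp (cs : List ℤ) (ps : List ℝ) (i : ℕ) (st : BodyState sg) :
    Op sg C → BodyState sg
  | .assign x => { st with temps := Function.update st.temps i (x.eval ps st.temps) }
  | .un o x => { st with temps := Function.update st.temps i (o.eval (x.eval ps st.temps)) }
  | .bin o x y =>
      { st with
        temps := Function.update st.temps i (o.eval (x.eval ps st.temps) (y.eval ps st.temps)) }
  | .getIn a ix =>
      { st with
        temps := Function.update st.temps i (σ.arr a (ix.map fun e => e.eval (srcEnv σ cs))) }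
  | .getOut ix =>
      { st with
        temps := Function.update st.temps i (st.arr fun d => (ix d).eval (srcEnv σ cs)) }
  | .set ix x =>
      { st with
        arr := Function.update st.arr (fun d => (ix d).eval (srcEnv σ cs)) (x.eval ps st.temps) }
  | .call c args =>
      { st with arr := run c cs (args.map fun x => x.eval ps st.temps) st.arr }

/-- The state after the first `i` statements of an iteration (the branch conditions decide which
of them are executed); `cs` lists the counters, own counter first, and `B` is the array at the
beginning of the iteration. -/
noncomputable def bodyState (L : LoopOver sg C) (cs : List ℤ) (ps : List ℝ) (B : Arr sg) :
    ℕ → BodyState sg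
  | 0 => ⟨fun _ => 0, B⟩
  | i + 1 =>
    match L.body[i]? with
    | none => bodyState L cs ps B i
    | some s =>
      if s.guard.eval σ.cond (srcEnv σ cs) = true then
        execOp run σ cs ps i (bodyState L cs ps B i) s.op
      else bodyState L cs ps B i

/-- The output array after `n` iterations; `cs` are the enclosing counters. -/
noncomputable def loopState (L : LoopOver sg C) (cs : List ℤ) (ps : List ℝ) (B : Arr sg) :
    ℕ → Arr sg
  | 0 => B
  | n + 1 =>
    (bodyState run σ L (L.counter σ cs (n + 1) :: cs) ps (loopState L cs ps B n)
      L.body.length).arr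

end Execution

/-- The output array after a complete execution of a loop. -/
noncomputable def exec {sg : Signature} (σ : Data sg) :
    (k : ℕ) → Nest sg k → List ℤ → List ℝ → Arr sg → Arr sg
  | 0, L => Empty.elim L
  | k + 1, L => fun cs ps B => loopState (exec σ k) σ L cs ps B (LoopOver.iters L)

/-- The output array after the execution of a kernel. -/
noncomputable def runKernel {sg : Signature} {K : ℕ} (L : Nest sg K) (inp : Input sg) : Arr sg :=
  exec inp.data K L [] inp.nums inp.out

/-! ### Invocations and regular loops -/

/-- A loop occurring in a kernel, with its number of scalar parameters; its level is `k + 1`. -/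
structure LoopInfo (sg : Signature) where
  k : ℕ
  loop : LoopOver sg (Nest sg k)
  np : ℕ

/-- The loop that is reached through the call statements with the numbers in the list. -/
def loopAt {sg : Signature} : (k : ℕ) → Nest sg k → ℕ → List ℕ → Option (LoopInfo sg)
  | 0, _, _, _ => none
  | k + 1, L, np, [] => some ⟨k, L, np⟩
  | k + 1, L, _, i :: p =>
    match (LoopOver.body L)[i]? with
    | some ⟨_, .call c args⟩ => loopAt k c args.length p
    | _ => none

/-- The loop of the kernel `L` at the position `p`. -/
def loopOf {sg : Signature} {K : ℕ} (L : Nest sg K) (p : List ℕ) : Option (LoopInfo sg) :=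
  loopAt K L sg.nums p

/-- An invocation of a loop during the execution of a kernel: the loop, the enclosing counters,
the actual scalar parameters and the output array at the call. -/
structure Frame (sg : Signature) where
  k : ℕ
  loop : LoopOver sg (Nest sg k)
  cs : List ℤ
  ps : List ℝ
  arr : Arr sg

/-- An invocation is located by the list of pairs (iteration, number of the executed call
statement) from the outermost loop inwards; `none` if there is no such invocation. -/
noncomputable def frameAt {sg : Signature} (σ : Data sg) :
    (k : ℕ) → Nest sg k → List ℤ → List ℝ → Arr sg → List (ℕ × ℕ) → Option (Frame sg)
  | 0, _, _, _, _, _ => none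
  | k + 1, L, cs, ps, B, [] => some ⟨k, L, cs, ps, B⟩
  | k + 1, L, cs, ps, B, (n, i) :: l =>
    let ctr := LoopOver.counter L σ cs n :: cs
    let st := bodyState (exec σ k) σ L ctr ps (loopState (exec σ k) σ L cs ps B (n - 1)) i
    match (LoopOver.body L)[i]? with
    | some ⟨g, .call c args⟩ =>
      if 1 ≤ n ∧ n ≤ LoopOver.iters L ∧ g.eval σ.cond (srcEnv σ ctr) = true then
        frameAt σ k c ctr (args.map fun x => x.eval ps st.temps) st.arr l
      else none
    | _ => none

section Kernel

variable {sg : Signature} {K : ℕ} (L : Nest sg K)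

noncomputable def frame (inp : Input sg) (loc : List (ℕ × ℕ)) : Option (Frame sg) :=
  frameAt inp.data K L [] inp.nums inp.out loc

/-- The invocations of the loop at the position `p`. -/
def invocations (inp : Input sg) (p : List ℕ) : Set (List (ℕ × ℕ)) :=
  {loc | loc.map Prod.snd = p ∧ (frame L inp loc).isSome = true}

/-- The set `ST^(m,n)` of the statements executed in the `n`-th iteration of an invocation. -/
noncomputable def executedAt (inp : Input sg) (loc : List (ℕ × ℕ)) (n : ℕ) : Finset ℕ :=
  match frame L inp loc with
  | none => ∅
  | some F => F.loop.executed inp.data (F.loop.counter inp.data F.cs n :: F.cs)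

/-- The atypical iterations `(m, n)` with respect to the statement set `T`. -/
def atypical (inp : Input sg) (p : List ℕ) (N : ℕ) (T : Finset ℕ) :
    Set (List (ℕ × ℕ) × ℕ) :=
  {a | a.1 ∈ invocations L inp p ∧ 1 ≤ a.2 ∧ a.2 ≤ N ∧ executedAt L inp a.1 a.2 ≠ T}

/-- `a ≪ b`: `a` is smaller than `b` at least by the factor `c`. -/
def MuchLess (c : ℝ) (a b : ℕ) : Prop := c * a ≤ b

/-- The loop at the position `p` is regular with `ST* = T`, where `≪` is read with the factor `c`
and a small positive integer is one that does not exceed `s`. -/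
def RegularWith (c : ℝ) (s : ℕ) (p : List ℕ) (T : Finset ℕ) : Prop :=
  ∃ Q, loopOf L p = some Q ∧ T ⊆ Finset.range Q.loop.body.length ∧ ∀ inp : Input sg,
    MuchLess c (atypical L inp p Q.loop.iters T).ncard (invocations L inp p).ncard ∧
    MuchLess c (atypical L inp p Q.loop.iters T).ncard Q.loop.iters ∧
    ∀ a ∈ atypical L inp p Q.loop.iters T,
      (executedAt L inp a.1 a.2 \ T).card ≤ s ∨
        MuchLess c (executedAt L inp a.1 a.2 \ T).card T.card

/-- The loop at the position `p` is regular. -/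
def IsRegular (c : ℝ) (s : ℕ) (p : List ℕ) : Prop := ∃ T, RegularWith L c s p T

end Kernel

/-! ### Vertices, predecessors and operations -/

/-- The variables of one iteration of a loop. -/
inductive Node (sg : Signature) where
  /-- an input array -/
  | arrayIn (a : Fin sg.arrays)
  /-- an index input -/
  | indexIn (p : Fin sg.indices)
  /-- a boolean input -/
  | condIn (b : Fin sg.conds)
  /-- a scalar parameter of the loop -/
  | param (s : ℕ)
  /-- the counter of an enclosing loop (`0` for the nearest one) -/
  | outer (j : ℕ)
  /-- the output array at the invocation of the loop -/
  | outIn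
  /-- the loop counter -/
  | bound
  /-- the variable defined by a statement -/
  | stmt (i : ℕ)
  /-- the output array after the iteration -/
  | phi

/-- The kinds of operations. -/
inductive OpKind where
  | input | bound | scalar | get | set | loopcall | phi

/-- Values of variables. -/
inductive Value (sg : Signature) where
  | idx (z : ℤ)
  | num (r : ℝ)
  | bool (b : Bool)
  | arr (B : Arr sg)
  | inArr (A : List ℤ → ℝ)

namespace Value

variable {sg : Signature}

def toIdx : Value sg → ℤ
  | idx z => z
  | _ => 0

def toNum : Value sg → ℝ
  | num r => r
  | _ => 0

def toBool : Value sg → Bool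
  | bool b => b
  | _ => false

def toArr : Value sg → Arr sg
  | arr B => B
  | _ => fun _ => 0

def toInArr : Value sg → List ℤ → ℝ
  | inArr A => A
  | _ => fun _ => 0

end Value

def Op.kind {sg : Signature} {C : Type} : Op sg C → OpKind
  | .assign _ => .scalar
  | .un _ _ => .scalar
  | .bin _ _ _ => .scalar
  | .getIn _ _ => .get
  | .getOut _ => .get
  | .set _ _ => .set
  | .call _ _ => .loopcall

/-- Whether the statement defines a new version of the output array. -/
def Op.writes {sg : Signature} {C : Type} : Op sg C → Bool
  | .set _ _ => true
  | .call _ _ => true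
  | _ => false

section LoopGraph

variable {sg : Signature} {C : Type} (L : LoopOver sg C)

/-- The kind of the operation that produces a variable. -/
def nodeKind : Node sg → OpKind
  | .bound => .bound
  | .phi => .phi
  | .stmt i => match L.body[i]? with
    | some s => s.op.kind
    | none => .input
  | _ => .input

/-- The version of the output array that statement `i` sees if the statements in `T` are executed:
the last version written before in the same iteration, or else the one left by the iteration
before. -/
def reach (T : Finset ℕ) : ℕ → Node sg
  | 0 => .phi
  | i + 1 =>
    match L.body[i]? with
    | some s => if i ∈ T ∧ s.op.writes = true then .stmt i else reach T i
    | none => reach T i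

/-- The vertex of a source index variable in a loop with `e` enclosing loops. -/
def srcNodes (e : ℕ) : SrcVar sg → Set (Node sg)
  | .counter 0 => {.bound}
  | .counter (j + 1) => {v | j < e ∧ v = .outer j}
  | .input p => {.indexIn p}

def indexNodes (e : ℕ) (a : IndexExpr (SrcVar sg)) : Set (Node sg) :=
  ⋃ x ∈ a.vars, srcNodes e x

def condNodes (e : ℕ) (c : CondExpr sg.conds (SrcVar sg)) : Set (Node sg) :=
  (⋃ x ∈ c.vars, srcNodes e x) ∪ {v | ∃ b ∈ c.inputs, v = .condIn b}

/-- The same for the initial value of the counter, which sees only the enclosing counters. -/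
def startNodes (e : ℕ) (a : IndexExpr (SrcVar sg)) : Set (Node sg) :=
  {v | (∃ j, SrcVar.counter j ∈ a.vars ∧ j < e ∧ v = .outer j) ∨
    ∃ p, SrcVar.input p ∈ a.vars ∧ v = .indexIn p}

/-- Whether the `j`-th variable is a scalar that statement `i` can read if the statements in `T` are
executed. (Other temporaries are never computed and have the value `0`.) -/
def readable (T : Finset ℕ) (i j : ℕ) : Bool :=
  decide (j < i ∧ j ∈ T) && match L.body[j]? with
    | some s => !s.op.writes
    | none => false

/-- The vertex of an operand of statement `i` if the statements in `T` are executed. -/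
def operandNodes (np : ℕ) (T : Finset ℕ) (i : ℕ) : Operand → Set (Node sg)
  | .lit _ => ∅
  | .param s => {v | s < np ∧ v = .param s}
  | .temp j => {v | readable L T i j = true ∧ v = .stmt j}

/-- All input vertices of a loop with `e` enclosing loops and `np` scalar parameters. -/
def inputNodes (e np : ℕ) : Set (Node sg) :=
  {v | (∃ a, v = .arrayIn a) ∨ (∃ p, v = .indexIn p) ∨ (∃ b, v = .condIn b) ∨
    (∃ s < np, v = .param s) ∨ (∃ j < e, v = .outer j) ∨ v = .outIn}

/-- The vertices of an iteration in which the statements in `T` are executed. -/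
def iterNodes (e np : ℕ) (T : Finset ℕ) : Set (Node sg) :=
  inputNodes e np ∪ {.bound, .phi} ∪ {v | ∃ i ∈ T, v = .stmt i}

/-- The variables a variable is computed from in an iteration in which the statements in `T` are
executed. The vertex `phi` stands here for the array left by the iteration before. -/
def nodePreds (e np : ℕ) (T : Finset ℕ) : Node sg → Set (Node sg)
  | .bound => startNodes e L.start
  | .phi => {.outIn, reach L T L.body.length} ∪ ⋃ s ∈ L.body, condNodes e s.guard
  | .stmt i => match L.body[i]? with
    | none => ∅
    | some s => match s.op with
      | .assign x => operandNodes L np T i x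
      | .un _ x => operandNodes L np T i x
      | .bin _ x y => operandNodes L np T i x ∪ operandNodes L np T i y
      | .getIn a ix => {.arrayIn a} ∪ ⋃ z ∈ ix, indexNodes e z
      | .getOut ix => {reach L T i} ∪ ⋃ d, indexNodes e (ix d)
      | .set ix x => {reach L T i} ∪ (⋃ d, indexNodes e (ix d)) ∪ operandNodes L np T i x
      | .call _ args => {reach L T i, .bound} ∪ (⋃ x ∈ args, operandNodes L np T i x) ∪
          {v | (∃ a, v = .arrayIn a) ∨ (∃ p, v = .indexIn p) ∨ (∃ b, v = .condIn b) ∨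
            ∃ j < e, v = .outer j}
  | _ => ∅

/-- The read-only data, the enclosing counters and the scalar parameters as given by values. -/
def dataOf (vals : Node sg → Value sg) : Data sg where
  arr a := (vals (.arrayIn a)).toInArr
  idx p := (vals (.indexIn p)).toIdx
  cond b := (vals (.condIn b)).toBool

def outersOf (e : ℕ) (vals : Node sg → Value sg) : List ℤ :=
  List.ofFn fun j : Fin e => (vals (.outer j)).toIdx

def paramsOf (np : ℕ) (vals : Node sg → Value sg) : List ℝ :=
  List.ofFn fun s : Fin np => (vals (.param s)).toNum

/-- The value of an operand of statement `i` if the statements in `T` are executed. -/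
def operandVal (np : ℕ) (T : Finset ℕ) (i : ℕ) (vals : Node sg → Value sg) : Operand → ℝ
  | .lit r => r
  | .param s => if s < np then (vals (.param s)).toNum else 0
  | .temp j => if readable L T i j = true then (vals (.stmt j)).toNum else 0

end LoopGraph

section NodeVal

variable {sg : Signature} {k : ℕ} (L : LoopOver sg (Nest sg k))

open Classical in
/-- The operation that produces a variable from the values of its predecessors, in the `n`-th
iteration, in which the statements in `T` are executed (`n = 0` is the entry of the loop). -/
noncomputable def nodeVal (e np : ℕ) (T : Finset ℕ) (n : ℕ) (v : Node sg)
    (vals : Node sg → Value sg) : Value sg :=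
  let cs := outersOf e vals
  let ctr := (vals .bound).toIdx :: cs
  let ρ := srcEnv (dataOf vals) ctr
  match v with
  | .bound => .idx (L.counter (dataOf vals) cs n)
  | .phi => if n = 0 then vals .outIn else vals (reach L T L.body.length)
  | .stmt i => match L.body[i]? with
    | none => .num 0
    | some s => match s.op with
      | .assign x => .num (operandVal L np T i vals x)
      | .un o x => .num (o.eval (operandVal L np T i vals x))
      | .bin o x y => .num (o.eval (operandVal L np T i vals x) (operandVal L np T i vals y))
      | .getIn a ix => .num ((vals (.arrayIn a)).toInArr (ix.map fun z => z.eval ρ))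
      | .getOut ix => .num ((vals (reach L T i)).toArr fun d => (ix d).eval ρ)
      | .set ix x => .arr (Function.update (vals (reach L T i)).toArr
          (fun d => (ix d).eval ρ) (operandVal L np T i vals x))
      | .call c args => .arr (exec (dataOf vals) k c ctr
          (args.map fun x => operandVal L np T i vals x) (vals (reach L T i)).toArr)
  | v => vals v

open Classical in
/-- The extended `φ` function with typical statement set `T`: at the entry of the loop it takes
the initial array, in a typical iteration the array computed by the typical statements, and in an
atypical iteration the array computed along the deviating execution path from the array left by
the iteration before. -/
noncomputable def extPhiVal (e np : ℕ) (T : Finset ℕ) (n : ℕ) (vals : Node sg → Value sg) :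
    Value sg :=
  let ctr := (vals .bound).toIdx :: outersOf e vals
  if n = 0 then vals .outIn
  else if L.executed (dataOf vals) ctr = T then vals (reach L T L.body.length)
  else .arr (bodyState (exec (dataOf vals) k) (dataOf vals) L ctr (paramsOf np vals)
    (vals .phi).toArr L.body.length).arr

end NodeVal

/-! ### SSA-based multilevel graphs -/

/-- A variable instance: the invocation of the loop, the iteration, and the variable. -/
structure Vertex (sg : Signature) where
  loc : List (ℕ × ℕ)
  iter : ℕ
  node : Node sg

/-- The position of the loop of a vertex. -/
def Vertex.path {sg : Signature} (v : Vertex sg) : List ℕ := v.loc.map Prod.snd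

structure SMG (sg : Signature) where
  V : Set (Vertex sg)
  E : Vertex sg → Vertex sg → Prop
  /-- data attribute -/
  data : Vertex sg → Value sg
  /-- operation attribute: kind and function -/
  kind : Vertex sg → OpKind
  op : Vertex sg → (Vertex sg → Value sg) → Value sg
  /-- level attribute -/
  level : Vertex sg → ℕ
  /-- loop attribute: call index and iteration index -/
  call : Vertex sg → ℕ
  iter : Vertex sg → ℕ

/-- The laws of an SSA-based multilevel graph with `K` levels: edges join vertices, the operation
of a vertex is a function of the data of its predecessors that yields its data, an input vertex
carries the data of the outer vertex it is dual to, the levels are `1, …, K`, and the invocations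
of a loop are told apart by their call indices. -/
structure SMG.IsValid {sg : Signature} (G : SMG sg) (K : ℕ) : Prop where
  finite : G.V.Finite
  edges : ∀ u v, G.E u v → u ∈ G.V ∧ v ∈ G.V
  op_congr : ∀ v ∈ G.V, G.kind v ≠ .input → ∀ D D' : Vertex sg → Value sg,
    (∀ u, G.E u v → D u = D' u) → G.op v D = G.op v D'
  data_eq : ∀ v ∈ G.V, G.kind v ≠ .input → G.data v = G.op v G.data
  input_eq : ∀ v ∈ G.V, G.kind v = .input → ∀ u, G.E u v → G.data v = G.data u
  level_mem : ∀ v ∈ G.V, 1 ≤ G.level v ∧ G.level v ≤ K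
  call_pos : ∀ v ∈ G.V, 1 ≤ G.call v
  call_inj : ∀ u ∈ G.V, ∀ v ∈ G.V, u.path = v.path → (G.call u = G.call v ↔ u.loc = v.loc)

/-- The iteration in which the variable `u`, used in iteration `n`, was defined. -/
def srcIter {sg : Signature} (u : Node sg) (n : ℕ) : ℕ :=
  match u with
  | .phi => n - 1
  | _ => n

/-- The edges from the actual arguments of the call statement `i` to the formal inputs of the
called loop; `T` is the set of statements executed in the calling iteration. -/
def dualEdge {sg : Signature} {C : Type} (L : LoopOver sg C) (np : ℕ) (T : Finset ℕ) (i : ℕ)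
    (args : List Operand) (u : Node sg) : Node sg → Prop
  | .arrayIn a => u = .arrayIn a
  | .indexIn p => u = .indexIn p
  | .condIn b => u = .condIn b
  | .param s => ∃ x ∈ args[s]?, u ∈ operandNodes L np T i x
  | .outer 0 => u = .bound
  | .outer (j + 1) => u = .outer j
  | .outIn => u = reach L T i
  | _ => False

section Kernel

variable {sg : Signature} {K : ℕ} (L : Nest sg K)

/-- The variable instances of an execution. Iteration `0` is the entry of the loop, where only the
inputs and the initial version of the output array exist. -/
def vertexSet (inp : Input sg) : Set (Vertex sg) :=
  {v | ∃ F, frame L inp v.loc = some F ∧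
    ((v.iter = 0 ∧ v.node ∈ inputNodes F.cs.length F.ps.length ∪ {Node.phi}) ∨
      (1 ≤ v.iter ∧ v.iter ≤ F.loop.iters ∧
        v.node ∈ iterNodes F.cs.length F.ps.length (executedAt L inp v.loc v.iter)))}

/-- Dependencies inside an invocation of a loop. -/
def intraEdge (inp : Input sg) (u v : Vertex sg) : Prop :=
  ∃ F, frame L inp v.loc = some F ∧ u.loc = v.loc ∧
    u.node ∈ nodePreds F.loop F.cs.length F.ps.length (executedAt L inp v.loc v.iter) v.node ∧
    (v.iter = 0 → u.node = .outIn) ∧ u.iter = srcIter u.node v.iter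

/-- Dependencies of the inputs of a called loop on the actual arguments of the call. -/
def downEdge (inp : Input sg) (u v : Vertex sg) : Prop :=
  ∃ F n i g c args, frame L inp u.loc = some F ∧ v.loc = u.loc ++ [(n, i)] ∧
    F.loop.body[i]? = some ⟨g, .call c args⟩ ∧
    dualEdge F.loop F.ps.length (executedAt L inp u.loc n) i args u.node v.node ∧
    u.iter = srcIter u.node n

/-- Dependency of the variable defined by a call on the final array of the called loop. -/
def upEdge (inp : Input sg) (u v : Vertex sg) : Prop :=
  ∃ F i, frame L inp u.loc = some F ∧ u.loc = v.loc ++ [(v.iter, i)] ∧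
    v.node = .stmt i ∧ u.node = .phi ∧ u.iter = F.loop.iters

/-- The value of a variable instance in the execution. -/
noncomputable def vertexData (inp : Input sg) (v : Vertex sg) : Value sg :=
  match frame L inp v.loc with
  | none => .num 0
  | some F => match v.node with
    | .arrayIn a => .inArr (inp.data.arr a)
    | .indexIn p => .idx (inp.data.idx p)
    | .condIn b => .bool (inp.data.cond b)
    | .param s => .num (F.ps.getD s 0)
    | .outer j => .idx (F.cs.getD j 0)
    | .outIn => .arr F.arr
    | .bound => .idx (F.loop.counter inp.data F.cs v.iter)
    | .stmt i =>
      let st := bodyState (exec inp.data F.k) inp.data F.loop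
        (F.loop.counter inp.data F.cs v.iter :: F.cs) F.ps
        (loopState (exec inp.data F.k) inp.data F.loop F.cs F.ps F.arr (v.iter - 1)) (i + 1)
      match F.loop.body[i]? with
      | some s => if s.op.writes = true then .arr st.arr else .num (st.temps i)
      | none => .num 0
    | .phi => .arr (loopState (exec inp.data F.k) inp.data F.loop F.cs F.ps F.arr v.iter)

/-- The values seen in iteration `n` of the invocation `loc`. -/
def sliceVals (D : Vertex sg → Value sg) (loc : List (ℕ × ℕ)) (n : ℕ) (u : Node sg) : Value sg :=
  D ⟨loc, srcIter u n, u⟩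

/-- The SSA-based multilevel graph of the execution of a kernel on an input. -/
noncomputable def smg (inp : Input sg) : SMG sg where
  V := vertexSet L inp
  E u v := u ∈ vertexSet L inp ∧ v ∈ vertexSet L inp ∧
    (intraEdge L inp u v ∨ downEdge L inp u v ∨ upEdge L inp u v)
  data := vertexData L inp
  kind v := match frame L inp v.loc with
    | some F => nodeKind F.loop v.node
    | none => .input
  op v D := match frame L inp v.loc with
    | some F => nodeVal F.loop F.cs.length F.ps.length (executedAt L inp v.loc v.iter) v.iter v.node
        (sliceVals D v.loc v.iter)
    | none => .num 0
  level v := K - v.loc.length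
  call v := {loc ∈ invocations L inp v.path | loc.map Prod.fst ≤ v.loc.map Prod.fst}.ncard
  iter v := v.iter

/-- The vertex set of the loop slice of iteration `n` of the invocation `loc`. -/
def SMG.slice (G : SMG sg) (loc : List (ℕ × ℕ)) (n : ℕ) : Set (Vertex sg) :=
  {v ∈ G.V | v.loc = loc ∧ G.iter v = n}

end Kernel

/-! ### Invariant graphs -/

/-- A candidate for the invariant subgraph of a loop. The operations depend on the iteration. -/
structure InvSubgraph (sg : Signature) where
  V : Set (Node sg)
  E : Node sg → Node sg → Prop
  kind : Node sg → OpKind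
  op : ℕ → Node sg → (Node sg → Value sg) → Value sg

open Classical in
/-- The invariant subgraph for the typical statements `T` of a loop with `e` enclosing loops and
`np` scalar parameters. Its vertex `phi` carries the extended `φ` function; as this covers the
deviating execution paths, it depends on the array left by the iteration before, on the loop
counter and on all inputs. -/
noncomputable def invSubgraph {sg : Signature} {k : ℕ} (L : LoopOver sg (Nest sg k)) (e np : ℕ)
    (T : Finset ℕ) : InvSubgraph sg where
  V := iterNodes e np T
  E u v := u ∈ iterNodes e np T ∧ v ∈ iterNodes e np T ∧
    (u ∈ nodePreds L e np T v ∨ (v = .phi ∧ (u = .phi ∨ u = .bound ∨ u ∈ inputNodes e np)))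
  kind := nodeKind L
  op n v vals := if v = .phi then extPhiVal L e np T n vals else nodeVal L e np T n v vals

section Kernel

variable {sg : Signature} {K : ℕ} (L : Nest sg K)

/-- `H` is an invariant subgraph of the loop at the position `p` (with `N` iterations) with typical
statements `T`; the bijections from the loop slices forget the invocation and the iteration. -/
structure IsInvSubgraph (p : List ℕ) (N : ℕ) (T : Finset ℕ) (H : InvSubgraph sg) : Prop where
  bij : ∀ inp, ∀ loc ∈ invocations L inp p, ∀ n, 1 ≤ n → n ≤ N → executedAt L inp loc n = T →
    Set.BijOn Vertex.node ((smg L inp).slice loc n) H.V ∧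
    (∀ u ∈ (smg L inp).slice loc n, ∀ v ∈ (smg L inp).slice loc n,
      (smg L inp).E u v → H.E u.node v.node) ∧
    ∀ v ∈ (smg L inp).slice loc n, (smg L inp).kind v = H.kind v.node ∧
      (H.kind v.node ≠ .input → (smg L inp).data v =
        H.op n v.node (sliceVals (smg L inp).data loc n))
  cross : ∀ inp, ∀ loc ∈ invocations L inp p, ∀ i j, i ≠ j → 1 ≤ i → i ≤ N → 1 ≤ j → j ≤ N →
    executedAt L inp loc i = T → executedAt L inp loc j = T →
    ∀ u ∈ (smg L inp).slice loc i, ∀ v ∈ (smg L inp).slice loc j,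
      (smg L inp).E u v → H.E u.node v.node
  /-- The extended `φ` function yields the right array in every iteration, typical or not. -/
  ext_phi : Node.phi ∈ H.V ∧ H.kind .phi = .phi ∧
    ∀ inp, ∀ loc ∈ invocations L inp p, ∀ n ≤ N,
      (smg L inp).data ⟨loc, n, .phi⟩ = H.op n .phi (sliceVals (smg L inp).data loc n)

/-- A family of subgraphs, one for each loop, joined by edges between loops. -/
structure InvGraph (sg : Signature) where
  sub : List ℕ → InvSubgraph sg
  V : Set (List ℕ × Node sg)
  E : List ℕ × Node sg → List ℕ × Node sg → Prop

/-- Invariant graphs of a kernel: the subgraphs are invariant subgraphs, and the edges between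
different loops are the images of those in the multilevel graphs. -/
structure IsInvGraph (T : List ℕ → Finset ℕ) (H : InvGraph sg) : Prop where
  sub : ∀ p Q, loopOf L p = some Q → IsInvSubgraph L p Q.loop.iters (T p) (H.sub p)
  vertices : ∀ p v, (p, v) ∈ H.V ↔ (loopOf L p).isSome = true ∧ v ∈ (H.sub p).V
  intra : ∀ p u v, H.E (p, u) (p, v) ↔ (loopOf L p).isSome = true ∧ (H.sub p).E u v
  inter : ∀ p q u v, p ≠ q → (H.E (p, u) (q, v) ↔ (p, u) ∈ H.V ∧ (q, v) ∈ H.V ∧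
    ∃ inp, ∃ a b : Vertex sg, (smg L inp).E a b ∧ a.path = p ∧ a.node = u ∧
      b.path = q ∧ b.node = v)

/-- The invariant subgraph of the loop at the position `p`. -/
noncomputable def invSub (T : List ℕ → Finset ℕ) (p : List ℕ) : InvSubgraph sg :=
  match loopOf L p with
  | some Q => invSubgraph Q.loop p.length Q.np (T p)
  | none => ⟨∅, fun _ _ => False, fun _ => .input, fun _ _ _ => .num 0⟩

/-- The invariant graph of a kernel whose loops have the typical statements `T`. -/
noncomputable def invGraph (T : List ℕ → Finset ℕ) : InvGraph sg where
  sub := invSub L T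
  V := {a | a.2 ∈ (invSub L T a.1).V}
  E a b := a.2 ∈ (invSub L T a.1).V ∧ b.2 ∈ (invSub L T b.1).V ∧
    ((a.1 = b.1 ∧ (invSub L T a.1).E a.2 b.2) ∨
      (a.1 ≠ b.1 ∧ ∃ inp, ∃ u v : Vertex sg, (smg L inp).E u v ∧ u.path = a.1 ∧ u.node = a.2 ∧
        v.path = b.1 ∧ v.node = b.2))

end Kernel

/-! ### Summaries -/

/-- The symbols of index type in the summaries of a loop: its iteration number, the enclosing
counters, the coordinates of an array position, and the index inputs. -/
inductive SymVar (sg : Signature) where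
  | t
  | outer (j : ℕ)
  | pos (d : Fin sg.dim)
  | input (p : Fin sg.indices)

abbrev SymIdx (sg : Signature) : Type := IndexExpr (SymVar sg)

abbrev SymCond (sg : Signature) : Type := CondExpr sg.conds (SymVar sg)

/-- Numerical element expressions: they read only input arrays and the initial output array. -/
inductive NumExpr (sg : Signature) where
  | lit (r : ℝ)
  | param (s : ℕ)
  | un (o : UnOp) (a : NumExpr sg)
  | bin (o : BinOp) (a b : NumExpr sg)
  | getIn (a : Fin sg.arrays) (i : List (SymIdx sg))
  | getOut (i : Fin sg.dim → SymIdx sg)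

/-- Branches `condition → element expression`. -/
abbrev Branches (sg : Signature) : Type := List (SymCond sg × NumExpr sg)

/-- An interpretation of the symbols. -/
structure Env (sg : Signature) where
  data : Data sg
  outer : List ℤ
  params : List ℝ
  out : Arr sg
  t : ℤ
  pos : Fin sg.dim → ℤ

def Env.idx {sg : Signature} (η : Env sg) : SymVar sg → ℤ
  | .t => η.t
  | .outer j => η.outer.getD j 0
  | .pos d => η.pos d
  | .input p => η.data.idx p

noncomputable def NumExpr.eval {sg : Signature} (η : Env sg) : NumExpr sg → ℝ
  | lit r => r
  | param s => η.params.getD s 0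
  | un o a => o.eval (a.eval η)
  | bin o a b => o.eval (a.eval η) (b.eval η)
  | getIn a i => η.data.arr a (i.map fun z => z.eval η.idx)
  | getOut i => η.out fun d => (i d).eval η.idx

namespace Branches

variable {sg : Signature}

/-- The value of the branch whose condition holds; `none` if there is no such branch. -/
noncomputable def val (bs : Branches sg) (η : Env sg) : Option ℝ :=
  (bs.find? fun b => b.1.eval η.data.cond η.idx).map fun b => b.2.eval η

/-- The element at the position `η.pos` of an array described by branches: the positions at which
no condition holds keep the initial value. -/
noncomputable def elem (bs : Branches sg) (η : Env sg) : ℝ := (bs.val η).getD (η.out η.pos)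

/-- The conditions are mutually exclusive. -/
def Exclusive (bs : Branches sg) : Prop :=
  ∀ η : Env sg, bs.Pairwise fun a b =>
    ¬ (a.1.eval η.data.cond η.idx = true ∧ b.1.eval η.data.cond η.idx = true)

end Branches

/-- Vertex summaries: index, condition, input array, scalar, or state of the output array. -/
inductive Summary (sg : Signature) where
  | unset
  | index (a : SymIdx sg)
  | cond (c : SymCond sg)
  | input (a : Fin sg.arrays)
  | num (bs : Branches sg)
  | array (bs : Branches sg)

section Rules

variable {sg : Signature}

def pureNum (a : NumExpr sg) : Branches sg := [(.tt, a)]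

def Summary.toIndex : Summary sg → SymIdx sg
  | index a => a
  | _ => .lit 0

def Summary.toCond : Summary sg → SymCond sg
  | cond c => c
  | _ => .not .tt

def Summary.toNum : Summary sg → Branches sg
  | num bs => bs
  | _ => pureNum (.lit 0)

def Summary.toArray : Summary sg → Branches sg
  | array bs => bs
  | _ => []

/-- Reading the input array described by a summary. -/
def Summary.read (S : Summary sg) (i : List (SymIdx sg)) : NumExpr sg :=
  match S with
  | input a => .getIn a i
  | _ => .lit 0

def NumExpr.subst (θ : SymVar sg → SymIdx sg) : NumExpr sg → NumExpr sg
  | lit r => lit r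
  | param s => param s
  | un o a => un o (a.subst θ)
  | bin o a b => bin o (a.subst θ) (b.subst θ)
  | getIn a i => getIn a (i.map fun z => z.subst θ)
  | getOut i => getOut fun d => (i d).subst θ

namespace Branches

/-- Substitution of index symbols. -/
def subst (θ : SymVar sg → SymIdx sg) (bs : Branches sg) : Branches sg :=
  bs.map fun b => (b.1.subst .input θ, b.2.subst θ)

/-- Substitution of the iteration number. -/
def substT (a : SymIdx sg) (bs : Branches sg) : Branches sg :=
  bs.subst fun x => match x with
    | .t => a
    | x => .var x

/-- Substitution of the array position. -/
def substPos (i : Fin sg.dim → SymIdx sg) (bs : Branches sg) : Branches sg :=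
  bs.subst fun x => match x with
    | .pos d => i d
    | x => .var x

/-- No branch applies. -/
def otherwise (bs : Branches sg) : SymCond sg := .not (.any (bs.map Prod.fst))

def restrict (c : SymCond sg) (bs : Branches sg) : Branches sg :=
  bs.map fun b => (c.and b.1, b.2)

def map1 (f : NumExpr sg → NumExpr sg) (bs : Branches sg) : Branches sg :=
  bs.map fun b => (b.1, f b.2)

def map2 (f : NumExpr sg → NumExpr sg → NumExpr sg) (bs cs : Branches sg) : Branches sg :=
  bs.flatMap fun b => cs.map fun c => (b.1.and c.1, f b.2 c.2)

/-- Reading an element of the output array. -/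
def get (bs : Branches sg) (i : Fin sg.dim → SymIdx sg) : Branches sg :=
  bs.substPos i ++ [((bs.substPos i).otherwise, .getOut i)]

/-- The condition that the array position is `i`. -/
def atPos (i : Fin sg.dim → SymIdx sg) : SymCond sg :=
  .all (List.ofFn fun d => .cmp .eq (.var (.pos d)) (i d))

/-- Writing an element of the output array. -/
def set (bs : Branches sg) (i : Fin sg.dim → SymIdx sg) (x : Branches sg) : Branches sg :=
  x.restrict (atPos i) ++ bs.restrict (.not (atPos i))

end Branches

/-- A source index expression, with the counters and inputs replaced by their summaries. -/
def symIndex (S : Node sg → Summary sg) : SrcVar sg → SymIdx sg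
  | .counter 0 => (S .bound).toIndex
  | .counter (j + 1) => (S (.outer j)).toIndex
  | .input p => (S (.indexIn p)).toIndex

def symGuard (S : Node sg → Summary sg) (c : CondExpr sg.conds (SrcVar sg)) : SymCond sg :=
  c.subst (fun b => (S (.condIn b)).toCond) (symIndex S)

/-- The index symbols of a called loop, replaced by the summaries of the vertices of the calling
loop to which they are dual. -/
def dualIndex (S : Node sg → Summary sg) : SymVar sg → SymIdx sg
  | .t => .lit 0
  | .outer 0 => (S .bound).toIndex
  | .outer (j + 1) => (S (.outer j)).toIndex
  | .pos d => .var (.pos d)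
  | .input p => (S (.indexIn p)).toIndex

/-- The same for element expressions; `arg` and `A` are the summaries of the actual scalar
parameters and of the actual output array. -/
def dualNum (S : Node sg → Summary sg) (arg : ℕ → Branches sg) (A : Branches sg) :
    NumExpr sg → Branches sg
  | .lit r => pureNum (.lit r)
  | .param s => arg s
  | .un o a => (dualNum S arg A a).map1 (.un o)
  | .bin o a b => (dualNum S arg A a).map2 (.bin o) (dualNum S arg A b)
  | .getIn a i => pureNum ((S (.arrayIn a)).read (i.map fun z => z.subst (dualIndex S)))
  | .getOut i => A.get fun d => (i d).subst (dualIndex S)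

/-- The summary of a call: the postcondition of the called loop with all formal inputs replaced. -/
def callSummary (S : Node sg → Summary sg) (arg : ℕ → Branches sg) (A post : Branches sg) :
    Branches sg :=
  let cnd := fun c : SymCond sg => c.subst (fun b => (S (.condIn b)).toCond) (dualIndex S)
  (post.flatMap fun b => (dualNum S arg A b.2).restrict (cnd b.1)) ++
    A.restrict (.not (.any (post.map fun b => cnd b.1)))

variable {C : Type} (L : LoopOver sg C)

def symOperand (S : Node sg → Summary sg) (T : Finset ℕ) (i : ℕ) : Operand → Branches sg
  | .lit r => pureNum (.lit r)
  | .param s => (S (.param s)).toNum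
  | .temp j => if readable L T i j = true then (S (.stmt j)).toNum else pureNum (.lit 0)

/-- The summary rule of statement `i` if the statements in `T` are executed; `post` holds the
postconditions of the called loops. -/
def stmtRule (post : ℕ → Branches sg) (T : Finset ℕ) (S : Node sg → Summary sg) (i : ℕ) :
    Summary sg :=
  match L.body[i]? with
  | none => .unset
  | some s => match s.op with
    | .assign x => .num (symOperand L S T i x)
    | .un o x => .num ((symOperand L S T i x).map1 (.un o))
    | .bin o x y => .num ((symOperand L S T i x).map2 (.bin o) (symOperand L S T i y))
    | .getIn a ix => .num (pureNum ((S (.arrayIn a)).read (ix.map fun z => z.subst (symIndex S))))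
    | .getOut ix => .num ((S (reach L T i)).toArray.get fun d => (ix d).subst (symIndex S))
    | .set ix x => .array ((S (reach L T i)).toArray.set (fun d => (ix d).subst (symIndex S))
        (symOperand L S T i x))
    | .call _ args => .array (callSummary S
        (fun s => ((args[s]?).map (symOperand L S T i)).getD (pureNum (.lit 0)))
        (S (reach L T i)).toArray (post i))

open Classical in
/-- The summaries along the execution path `T`, after its statements with numbers below the given
one. -/
noncomputable def pathSummary (post : ℕ → Branches sg) (T : Finset ℕ) (S : Node sg → Summary sg) :
    ℕ → Node sg → Summary sg
  | 0 => S
  | i + 1 =>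
    if i ∈ T then
      Function.update (pathSummary post T S i) (.stmt i)
        (stmtRule L post T (pathSummary post T S i) i)
    else pathSummary post T S i

/-- The condition under which exactly the statements in `T` are executed. -/
def pathCond (S : Node sg → Summary sg) (T : Finset ℕ) : SymCond sg :=
  .all (L.body.zipIdx.map fun si =>
    if si.2 ∈ T then symGuard S si.1.guard else .not (symGuard S si.1.guard))

/-- The summary rule of the extended `φ` function with typical statements `T`. -/
noncomputable def phiRule (post : ℕ → Branches sg) (T : Finset ℕ) (S : Node sg → Summary sg) :
    Branches sg :=
  let len := L.body.length
  let started : SymCond sg := .cmp .ge (.var .t) (.lit 1)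
  (S .outIn).toArray.restrict (.not started) ++
  (((List.range len).sublists.map List.toFinset).flatMap fun P =>
    Branches.restrict (started.and (pathCond L S P))
      (if P = T then (S (reach L T len)).toArray
      else (pathSummary L post P S len (reach L P len)).toArray))

/-- The symbol of an input vertex. -/
def inputSummary : Node sg → Summary sg
  | .arrayIn a => .input a
  | .indexIn p => .index (.var (.input p))
  | .condIn b => .cond (.input b)
  | .param s => .num (pureNum (.param s))
  | .outer j => .index (.var (.outer j))
  | .outIn => .array []
  | _ => .unset

/-- The summary rules. -/
noncomputable def rule (post : ℕ → Branches sg) (T : Finset ℕ) (v : Node sg)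
    (S : Node sg → Summary sg) : Summary sg :=
  match v with
  | .bound => .index (.add
      (L.start.subst fun x => match x with
        | .counter j => (S (.outer j)).toIndex
        | .input p => (S (.indexIn p)).toIndex)
      (.mul (.lit L.step) (.sub (.var .t) (.lit 1))))
  | .stmt i => stmtRule L post T S i
  | .phi => .array (phiRule L post T S)
  | v => inputSummary v

end Rules

/-! ### The lifting algorithm -/

section Algorithm

variable {sg : Signature}

/-- The environment with iteration number `t`. -/
def Env.setT (η : Env sg) (t : ℤ) : Env sg := { η with t := t }

/-- `G` generalizes the point-wise updates described by `S` over the iterations of a loop with `N`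
iterations: after iteration `t`, an element has the value `v` given by an update in some iteration
`t₁ ≤ t` that no update in an iteration `t₂` with `t₁ < t₂ ≤ t` overwrites. -/
def IsGeneralization (N : ℕ) (S G : Branches sg) : Prop :=
  (S.Exclusive → G.Exclusive) ∧
  ∀ (η : Env sg) (t : ℤ), 0 ≤ t → t ≤ N → ∀ v : ℝ,
    G.val (η.setT t) = some v ↔
      ∃ t₁, 1 ≤ t₁ ∧ t₁ ≤ t ∧ S.val (η.setT t₁) = some v ∧
        ¬ ∃ t₂, t₁ < t₂ ∧ t₂ ≤ t ∧ (S.val (η.setT t₂)).isSome = true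

/-- Equality of two summaries of the output array in all iterations. -/
def SameSummary (N : ℕ) (S G : Branches sg) : Prop :=
  ∀ (η : Env sg), 1 ≤ η.t → η.t ≤ N → S.elem η = G.elem η

/-- The SCC is not a single vertex outside all cycles. -/
def Nontrivial (H : InvSubgraph sg) (c : List (Node sg)) : Prop :=
  ∃ v ∈ c, (∃ u ∈ c, u ≠ v) ∨ H.E v v

/-- `Ω` lists the strongly connected components of `H` in a topological order. A nontrivial one is
listed beginning with a start vertex, which is a `φ` vertex with a predecessor outside, and then in
an order in which, apart from the start vertex, predecessors inside the component come first. -/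
structure IsSchedule (H : InvSubgraph sg) (Ω : List (List (Node sg))) : Prop where
  nodup : Ω.flatten.Nodup
  nonempty : ∀ c ∈ Ω, c ≠ []
  cover : ∀ v, v ∈ Ω.flatten ↔ v ∈ H.V
  scc : ∀ c ∈ Ω, ∀ u ∈ c, ∀ v ∈ H.V,
    v ∈ c ↔ Relation.ReflTransGen H.E u v ∧ Relation.ReflTransGen H.E v u
  topological : Ω.Pairwise fun c d => ∀ u ∈ c, ∀ v ∈ d, ¬ H.E v u
  sweep : ∀ v r, v :: r ∈ Ω → Nontrivial H (v :: r) →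
    H.kind v = .phi ∧ (∃ u, u ∉ v :: r ∧ H.E u v) ∧
    r.Pairwise (fun a b => ¬ H.E b a) ∧ ∀ a ∈ r, ¬ H.E a a

/-- The choices the algorithm leaves open: the generalization of summaries (for a loop with a given
number of iterations), and the processing order of the vertices for each loop. -/
structure Strategy (sg : Signature) where
  gen : ℕ → Branches sg → Branches sg
  order : List ℕ → List (List (Node sg))

open Classical in
/-- Applying the summary rules to the vertices of a list in this order. -/
noncomputable def sweep (R : Node sg → (Node sg → Summary sg) → Summary sg)
    (l : List (Node sg)) (S : Node sg → Summary sg) : Node sg → Summary sg :=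
  l.foldl (fun S v => Function.update S v (R v S)) S

open Classical in
/-- The rounds of the iterative semantic extraction, at most as many as the first argument says:
generalize the summary of the start vertex `v`, shift it to the iteration before, sweep, and stop
if the summary of `v` is the generalized one. -/
noncomputable def rounds (gen : Branches sg → Branches sg) (N : ℕ)
    (R : Node sg → (Node sg → Summary sg) → Summary sg) (v : Node sg) (r : List (Node sg)) :
    ℕ → (Node sg → Summary sg) → Option (Node sg → Summary sg)
  | 0, _ => none
  | f + 1, S =>
    let G := gen (S v).toArray
    let S' := sweep R (r ++ [v])
      (Function.update S v (.array (G.substT (.sub (.var .t) (.lit 1)))))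
    if SameSummary N (S' v).toArray G then some S' else rounds gen N R v r f S'

open Classical in
/-- Processing one SCC: a trivial one by its rule, a nontrivial one by iterative semantic
extraction, starting from the known summary of the initial output array. -/
noncomputable def extract (gen : Branches sg → Branches sg) (N : ℕ) (H : InvSubgraph sg)
    (R : Node sg → (Node sg → Summary sg) → Summary sg) (fuel : ℕ) (S : Node sg → Summary sg) :
    List (Node sg) → Option (Node sg → Summary sg)
  | [] => some S
  | v :: r =>
    if Nontrivial H (v :: r) then
      rounds gen N R v r fuel (sweep R (r ++ [v]) (Function.update S v (S .outIn)))
    else some (sweep R [v] S)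

/-- The call statements to be lifted before a vertex is processed: its own one, and for the
extended `φ` function those among the deviating statements. -/
def callees {C : Type} (L : LoopOver sg C) (T : Finset ℕ) : Node sg → List ℕ
  | .stmt i => [i]
  | .phi => (List.range L.body.length).filter fun i => i ∉ T
  | _ => []

/-- Hierarchical recursive lifting of the loop at the position `p`, with typical statements `T q`
for the loop at each position `q`, where at most `fuel` rounds are allowed for each SCC. It returns
the postcondition of the loop, i.e. the summary of its `φ` vertex after the last iteration, or
`none` if the rounds do not suffice. -/
noncomputable def lift (st : Strategy sg) (T : List ℕ → Finset ℕ) (fuel : ℕ) :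
    (k : ℕ) → Nest sg k → ℕ → List ℕ → Option (Branches sg)
  | 0, _, _, _ => none
  | k + 1, L', np, p =>
    let L : LoopOver sg (Nest sg k) := L'
    let H := invSubgraph L p.length np (T p)
    let lower : (ℕ → Branches sg) → ℕ → Option (ℕ → Branches sg) := fun post i =>
      match L.body[i]? with
      | some ⟨_, .call c args⟩ =>
        (lift st T fuel k c args.length (p ++ [i])).map fun b => Function.update post i b
      | _ => some post
    let process : (Node sg → Summary sg) × (ℕ → Branches sg) → List (Node sg) →
        Option ((Node sg → Summary sg) × (ℕ → Branches sg)) := fun Sp c =>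
      ((c.flatMap (callees L (T p))).foldlM lower Sp.2).bind fun post =>
        (extract (st.gen L.iters) L.iters H (rule L post (T p)) fuel Sp.1 c).map fun S => (S, post)
    ((st.order p).foldlM process (inputSummary, fun _ => [])).map fun Sp =>
      (Sp.1 .phi).toArray.substT (.lit L.iters)

/-- Hierarchical recursive lifting of a kernel. -/
noncomputable def liftKernel {K : ℕ} (L : Nest sg K) (st : Strategy sg) (T : List ℕ → Finset ℕ)
    (fuel : ℕ) : Option (Branches sg) :=
  lift st T fuel K L sg.nums []

/-- The choices are admissible for the invariant graph of the kernel. -/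
def Strategy.IsValid {K : ℕ} (st : Strategy sg) (L : Nest sg K) (T : List ℕ → Finset ℕ) : Prop :=
  (∀ N S, IsGeneralization N S (st.gen N S)) ∧
  ∀ p, (loopOf L p).isSome = true → IsSchedule ((invGraph L T).sub p) (st.order p)

/-- A sound summary of a kernel: its conditions are mutually exclusive, and on every input it
describes each element of the output array after the execution. -/
def IsSoundSummary {K : ℕ} (L : Nest sg K) (S : Branches sg) : Prop :=
  S.Exclusive ∧ ∀ (inp : Input sg) (t : ℤ) (x : Fin sg.dim → ℤ),
    S.elem ⟨inp.data, [], inp.nums, inp.out, t, x⟩ = runKernel L inp x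

end Algorithm

end StencilLifting

namespace StencilLifting

/-! ### Evaluation and substitution -/

/-! Control flow is independent of real data: guards, counters and array indices depend only on
enclosing counters, index inputs and boolean inputs. Hence the set of executed statements of an
iteration is fixed before any real value is computed, and so are the positions that it writes.
`bodyState_eq_pathState` trades the guards for this set, and `reach_cases` identifies the array
version a statement sees with its last writer, or with the array left by the iteration before.

Graphs. A vertex carries the value its variable has in the execution. Its operation reproduces this
value (`nodeVal_frameSlice`) and reads nothing but predecessors (`nodeVal_congr`). The predecessors
inside an invocation are a function of the executed set, so iterations with the same set have the
same slice, and this slice is the invariant subgraph (`invSubgraph_edge_of_smg`). The extended `φ`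
function recomputes a deviating iteration from the array before it, so it is right on every path,
whichever set counts as typical (`extPhiVal_frameSlice`).

Lifting. The rules are sound relative to an arbitrary array before the iteration (`isVal_stmtRule`,
`arrIs_phiRule`), so a sweep is a symbolic execution of one iteration from whatever array the start
summary describes (`isUpdate_sweep`). Suppose that the summary of `φ` is right in the first `m`
iterations (`IsApprox`). Its generalization covers the right positions in all iterations and has the
right values in the first `m`; shifted by one and swept, it is right in the first `m + 1`
(`IsApprox.succ`). At the latest when `m` reaches the number of iterations, the stopping test
succeeds. If it succeeds earlier, the generalized summary satisfies the recursion that defines the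
loop, and is right by induction over the iterations (`IsApprox.of_same`).

Components. Edges that avoid `φ` increase `Node.rank`, so every cycle passes through `φ`, which has
a loop. There is thus exactly one nontrivial component. The summaries before it do not depend on the
array and stay fixed during the rounds; those after it do not change the summary of `φ`. Typical
calls lie in this component (`writer_cycle`) and the other calls are lifted with `φ`, so all
postconditions are available when the rounds begin (`Posts.process`). Induction on the nesting depth
finishes the proof (`lift_sound`). Admissible choices exist: a generalization is a finite case
distinction, as the number of iterations is fixed, and the order comes from reachability to and from
`φ` (`exists_isSchedule`). -/

theorem IndexExpr.eval_congr {X : Type} {ρ ρ' : X → ℤ} (a : IndexExpr X)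
    (h : ∀ x ∈ a.vars, ρ x = ρ' x) : a.eval ρ = a.eval ρ' := by
  induction a with
  | lit => rfl
  | var x => exact h x rfl
  | neg a ih => simp only [eval, ih h]
  | _ a b iha ihb =>
    simp only [eval, iha fun x hx => h x (Or.inl hx), ihb fun x hx => h x (Or.inr hx)]

theorem IndexExpr.eval_subst {X Y : Type} (θ : X → IndexExpr Y) (ρ : Y → ℤ) (a : IndexExpr X) :
    (a.subst θ).eval ρ = a.eval fun x => (θ x).eval ρ := by
  induction a <;> simp_all [subst, eval]

namespace CondExpr

variable {nc : ℕ} {X Y : Type}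

theorem eval_subst (κ' : Fin nc → CondExpr nc Y) (θ : X → IndexExpr Y) (κ : Fin nc → Bool)
    (ρ : Y → ℤ) (c : CondExpr nc X) :
    (c.subst κ' θ).eval κ ρ = c.eval (fun b => (κ' b).eval κ ρ) fun x => (θ x).eval ρ := by
  induction c <;> simp_all [subst, eval, IndexExpr.eval_subst]

@[simp] theorem eval_tt (κ : Fin nc → Bool) (ρ : X → ℤ) :
    (tt : CondExpr nc X).eval κ ρ = true := by simp [tt, eval, Cmp.eval]

theorem eval_any (κ : Fin nc → Bool) (ρ : X → ℤ) (l : List (CondExpr nc X)) :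
    (any l).eval κ ρ = true ↔ ∃ c ∈ l, c.eval κ ρ = true := by
  induction l with
  | nil => simp [any, eval]
  | cons a l ih => simp only [any, List.foldr_cons, eval, Bool.or_eq_true] at ih ⊢; simp [ih]

theorem eval_all (κ : Fin nc → Bool) (ρ : X → ℤ) (l : List (CondExpr nc X)) :
    (all l).eval κ ρ = true ↔ ∀ c ∈ l, c.eval κ ρ = true := by
  induction l with
  | nil => simp [all]
  | cons a l ih => simp only [all, List.foldr_cons, eval, Bool.and_eq_true] at ih ⊢; simp [ih]

end CondExpr

variable {sg : Signature}

/-- The environment with array position `x`. -/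
def Env.setPos (η : Env sg) (x : Fin sg.dim → ℤ) : Env sg := { η with pos := x }

theorem NumExpr.eval_subst {θ : SymVar sg → SymIdx sg} {η η' : Env sg} (hd : η'.data = η.data)
    (hp : η'.params = η.params) (ho : η'.out = η.out)
    (hi : η'.idx = fun x => (θ x).eval η.idx) (a : NumExpr sg) :
    (a.subst θ).eval η = a.eval η' := by
  induction a with
  | lit | param => simp [subst, eval, hp]
  | un o a ih => simp [subst, eval, ih]
  | bin o a b iha ihb => simp [subst, eval, iha, ihb]
  | getIn a i => simp [subst, eval, hd, hi, Function.comp_def, IndexExpr.eval_subst]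
  | getOut i => simp [subst, eval, ho, hi, IndexExpr.eval_subst]

/-! ### Relational semantics of branch lists. -/

namespace Branches

/-- Some branch with a true condition has the value `r`. -/
def Has (bs : Branches sg) (η : Env sg) (r : ℝ) : Prop :=
  ∃ b ∈ bs, b.1.eval η.data.cond η.idx = true ∧ b.2.eval η = r

/-- Some branch applies. -/
def Cov (bs : Branches sg) (η : Env sg) : Prop := ∃ b ∈ bs, b.1.eval η.data.cond η.idx = true

variable {bs cs : Branches sg} {η η' : Env sg} {r : ℝ}

theorem cov_iff_has : bs.Cov η ↔ ∃ r, bs.Has η r := by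
  constructor
  · rintro ⟨b, hb, h⟩
    exact ⟨_, b, hb, h, rfl⟩
  · rintro ⟨r, b, hb, h, -⟩
    exact ⟨b, hb, h⟩

theorem cov_congr (hd : η.data.cond = η'.data.cond) (hi : η.idx = η'.idx) :
    bs.Cov η ↔ bs.Cov η' := by simp [Cov, hd, hi]

theorem isSome_val : (bs.val η).isSome = true ↔ bs.Cov η := by
  simp [val, Cov]

theorem val_eq_none : bs.val η = none ↔ ¬ bs.Cov η := by
  rw [← isSome_val, Bool.not_eq_true, Option.isSome_eq_false_iff, Option.isNone_iff_eq_none]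

theorem has_of_val (h : bs.val η = some r) : bs.Has η r := by
  simp only [val, Option.map_eq_some_iff] at h
  obtain ⟨b, hb, rfl⟩ := h
  exact ⟨b, List.mem_of_find?_eq_some hb, List.find?_some (p := fun b : SymCond sg × NumExpr sg =>
    b.1.eval η.data.cond η.idx) hb, rfl⟩

theorem Exclusive.eq_of_holds (h : bs.Exclusive) {b c : SymCond sg × NumExpr sg} (hb : b ∈ bs)
    (hc : c ∈ bs) (hb' : b.1.eval η.data.cond η.idx = true)
    (hc' : c.1.eval η.data.cond η.idx = true) : b = c := by
  by_contra hne
  have : Std.Symm fun a b : SymCond sg × NumExpr sg =>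
      ¬ (a.1.eval η.data.cond η.idx = true ∧ b.1.eval η.data.cond η.idx = true) :=
    ⟨fun a b h h' => h ⟨h'.2, h'.1⟩⟩
  exact (h η).forall hb hc hne ⟨hb', hc'⟩

/-- `val` depends on the order of the branches, `Has` does not, and `Has` commutes with the list
operations without any exclusivity. So the rules are verified for `Has`, exclusivity is tracked
separately, and this equivalence joins the two. -/
theorem Exclusive.val_eq_some (h : bs.Exclusive) : bs.val η = some r ↔ bs.Has η r := by
  refine ⟨has_of_val, ?_⟩
  rintro ⟨b, hb, h1, rfl⟩
  obtain ⟨v, hv⟩ := Option.isSome_iff_exists.mp (isSome_val.mpr ⟨b, hb, h1⟩)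
  obtain ⟨c, hc, h2, rfl⟩ := has_of_val hv
  rw [hv, h.eq_of_holds hb hc h1 h2]

theorem elem_of_not_cov (h : ¬ bs.Cov η) : bs.elem η = η.out η.pos := by
  rw [elem, val_eq_none.mpr h, Option.getD_none]

theorem elem_of_has (h : bs.Exclusive) (h' : bs.Has η r) : bs.elem η = r := by
  rw [elem, h.val_eq_some.mpr h', Option.getD_some]

theorem has_elem (h : bs.Cov η) : bs.Has η (bs.elem η) := by
  obtain ⟨v, hv⟩ := Option.isSome_iff_exists.mp (isSome_val.mpr h)
  rw [elem, hv, Option.getD_some]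
  exact has_of_val hv

theorem Exclusive.has_iff (h : bs.Exclusive) : bs.Has η r ↔ bs.Cov η ∧ r = bs.elem η :=
  ⟨fun h' => ⟨cov_iff_has.mpr ⟨r, h'⟩, (elem_of_has h h').symm⟩, fun h' => h'.2 ▸ has_elem h'.1⟩

@[simp] theorem not_has_nil : ¬ Has ([] : Branches sg) η r := by simp [Has]

@[simp] theorem not_cov_nil : ¬ Cov ([] : Branches sg) η := by simp [Cov]

theorem has_append : Has (bs ++ cs) η r ↔ bs.Has η r ∨ cs.Has η r := by
  simp [Has, or_and_right, exists_or]

theorem cov_append : Cov (bs ++ cs) η ↔ bs.Cov η ∨ cs.Cov η := by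
  simp only [cov_iff_has, has_append, exists_or]

theorem has_flatMap {α : Type*} (l : List α) (f : α → Branches sg) :
    Has (l.flatMap f) η r ↔ ∃ a ∈ l, (f a).Has η r := by
  simp only [Has, List.mem_flatMap]
  constructor
  · rintro ⟨b, ⟨a, ha, hb⟩, h⟩
    exact ⟨a, ha, b, hb, h⟩
  · rintro ⟨a, ha, b, hb, h⟩
    exact ⟨b, ⟨a, ha, hb⟩, h⟩

theorem cov_flatMap {α : Type*} (l : List α) (f : α → Branches sg) :
    Cov (l.flatMap f) η ↔ ∃ a ∈ l, (f a).Cov η := by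
  simp only [cov_iff_has, has_flatMap]
  exact ⟨fun ⟨r, a, h, h'⟩ => ⟨a, h, r, h'⟩, fun ⟨a, h, r, h'⟩ => ⟨r, a, h, h'⟩⟩

theorem has_restrict {c : SymCond sg} :
    (bs.restrict c).Has η r ↔ c.eval η.data.cond η.idx = true ∧ bs.Has η r := by
  simp only [Has, restrict, List.mem_map]
  constructor
  · rintro ⟨b, ⟨a, ha, rfl⟩, h, rfl⟩
    simp only [CondExpr.eval, Bool.and_eq_true] at h
    exact ⟨h.1, a, ha, h.2, rfl⟩
  · rintro ⟨h, a, ha, h', rfl⟩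
    exact ⟨_, ⟨a, ha, rfl⟩, by simp [CondExpr.eval, h, h'], rfl⟩

theorem cov_restrict {c : SymCond sg} :
    (bs.restrict c).Cov η ↔ c.eval η.data.cond η.idx = true ∧ bs.Cov η := by
  simp only [cov_iff_has, has_restrict, exists_and_left]

theorem has_map1 {o : UnOp} : (bs.map1 (.un o)).Has η r ↔ ∃ x, bs.Has η x ∧ r = o.eval x := by
  simp only [Has, map1, List.mem_map]
  constructor
  · rintro ⟨b, ⟨a, ha, rfl⟩, h, rfl⟩
    exact ⟨_, ⟨a, ha, h, rfl⟩, rfl⟩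
  · rintro ⟨_, ⟨a, ha, h, rfl⟩, rfl⟩
    exact ⟨_, ⟨a, ha, rfl⟩, h, rfl⟩

theorem has_map2 {o : BinOp} :
    (bs.map2 (.bin o) cs).Has η r ↔ ∃ x y, bs.Has η x ∧ cs.Has η y ∧ r = o.eval x y := by
  simp only [Has, map2, List.mem_flatMap, List.mem_map]
  constructor
  · rintro ⟨_, ⟨a, ha, b, hb, rfl⟩, h, rfl⟩
    simp only [CondExpr.eval, Bool.and_eq_true] at h
    exact ⟨_, _, ⟨a, ha, h.1, rfl⟩, ⟨b, hb, h.2, rfl⟩, rfl⟩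
  · rintro ⟨_, _, ⟨a, ha, h, rfl⟩, ⟨b, hb, h', rfl⟩, rfl⟩
    exact ⟨_, ⟨a, ha, b, hb, rfl⟩, by simp [CondExpr.eval, h, h'], rfl⟩

theorem has_subst {θ : SymVar sg → SymIdx sg} (hd : η'.data = η.data)
    (hp : η'.params = η.params) (ho : η'.out = η.out)
    (hi : η'.idx = fun x => (θ x).eval η.idx) : (bs.subst θ).Has η r ↔ bs.Has η' r := by
  simp only [Has, subst, List.mem_map]
  have key : ∀ c : SymCond sg, (c.subst .input θ).eval η.data.cond η.idx =
      c.eval η'.data.cond η'.idx := fun c => by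
    rw [CondExpr.eval_subst, hd, hi]
    rfl
  constructor
  · rintro ⟨_, ⟨a, ha, rfl⟩, h, rfl⟩
    exact ⟨a, ha, by rw [← key]; exact h, by rw [NumExpr.eval_subst hd hp ho hi]⟩
  · rintro ⟨a, ha, h, rfl⟩
    exact ⟨_, ⟨a, ha, rfl⟩, by rw [key]; exact h, by rw [NumExpr.eval_subst hd hp ho hi]⟩

theorem has_substT {a : SymIdx sg} :
    (bs.substT a).Has η r ↔ bs.Has (η.setT (a.eval η.idx)) r := by
  refine has_subst rfl rfl rfl ?_
  funext x
  cases x <;> rfl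

theorem cov_substT {a : SymIdx sg} : (bs.substT a).Cov η ↔ bs.Cov (η.setT (a.eval η.idx)) := by
  simp only [cov_iff_has, has_substT]

theorem has_substPos {i : Fin sg.dim → SymIdx sg} :
    (bs.substPos i).Has η r ↔ bs.Has (η.setPos fun d => (i d).eval η.idx) r := by
  refine has_subst rfl rfl rfl ?_
  funext x
  cases x <;> rfl

theorem eval_otherwise :
    bs.otherwise.eval η.data.cond η.idx = true ↔ ¬ bs.Cov η := by
  rw [otherwise, CondExpr.eval, Bool.not_eq_true', ← Bool.not_eq_true, CondExpr.eval_any]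
  simp [Cov]

theorem eval_atPos {i : Fin sg.dim → SymIdx sg} :
    (atPos i).eval η.data.cond η.idx = true ↔ η.pos = fun d => (i d).eval η.idx := by
  rw [atPos, CondExpr.eval_all]
  simp only [List.forall_mem_ofFn_iff, CondExpr.eval, Cmp.eval, decide_eq_true_eq, funext_iff]
  rfl

@[simp] theorem has_pureNum {a : NumExpr sg} : Has (pureNum a) η r ↔ a.eval η = r := by
  simp [Has, pureNum]

/-! ### Exclusive conditions -/

theorem exclusive_nil : Exclusive ([] : Branches sg) := fun _ => List.Pairwise.nil

theorem exclusive_pureNum (a : NumExpr sg) : Exclusive (pureNum a) := fun _ =>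
  List.pairwise_singleton _ _

theorem Exclusive.append (hb : bs.Exclusive) (hc : cs.Exclusive)
    (h : ∀ η, ¬ (bs.Cov η ∧ cs.Cov η)) : Exclusive (bs ++ cs) := fun η =>
  List.pairwise_append.mpr ⟨hb η, hc η, fun b hb' c hc' h' =>
    h η ⟨⟨b, hb', h'.1⟩, c, hc', h'.2⟩⟩

theorem exclusive_flatMap {α : Type*} {l : List α} {f : α → Branches sg}
    (h : ∀ a ∈ l, (f a).Exclusive)
    (h' : ∀ η, l.Pairwise fun a b => ¬ ((f a).Cov η ∧ (f b).Cov η)) :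
    Exclusive (l.flatMap f) := fun η =>
  List.pairwise_flatMap.mpr ⟨fun a ha => h a ha η, (h' η).imp fun hab b hb c hc h'' =>
    hab ⟨⟨b, hb, h''.1⟩, c, hc, h''.2⟩⟩

theorem Exclusive.restrict (h : bs.Exclusive) (c : SymCond sg) : (bs.restrict c).Exclusive :=
  fun η => List.pairwise_map.mpr <| (h η).imp fun hab h' => hab <| by
    simp only [CondExpr.eval, Bool.and_eq_true] at h'
    exact ⟨h'.1.2, h'.2.2⟩

theorem Exclusive.map1 (h : bs.Exclusive) (f : NumExpr sg → NumExpr sg) :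
    (bs.map1 f).Exclusive := fun η => List.pairwise_map.mpr (h η)

theorem Exclusive.map2 (hb : bs.Exclusive) (hc : cs.Exclusive)
    (f : NumExpr sg → NumExpr sg → NumExpr sg) : (bs.map2 f cs).Exclusive := fun η => by
  refine List.pairwise_flatMap.mpr ⟨fun a _ => List.pairwise_map.mpr <| (hc η).imp ?_,
    (hb η).imp ?_⟩
  · intro x y hxy h
    simp only [CondExpr.eval, Bool.and_eq_true] at h
    exact hxy ⟨h.1.2, h.2.2⟩
  · intro x y hxy u hu v hv h
    obtain ⟨u', -, rfl⟩ := List.mem_map.mp hu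
    obtain ⟨v', -, rfl⟩ := List.mem_map.mp hv
    simp only [CondExpr.eval, Bool.and_eq_true] at h
    exact hxy ⟨h.1.1, h.2.1⟩

/-- Exclusivity quantifies over all environments, so it suffices that the substituted index symbols
are the symbols of some other environment. Its scalars and its array are irrelevant, as conditions
do not read them. -/
theorem Exclusive.subst (h : bs.Exclusive) {θ : SymVar sg → SymIdx sg}
    (hθ : ∀ η : Env sg, ∃ η' : Env sg, η'.data = η.data ∧
      η'.idx = fun x => (θ x).eval η.idx) : (bs.subst θ).Exclusive := fun η => by
  obtain ⟨η', hd, hi⟩ := hθ η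
  refine List.pairwise_map.mpr ((h η').imp fun hab h' => hab ?_)
  simp only [CondExpr.eval_subst] at h'
  rw [hd, hi]
  exact h'

theorem Exclusive.substT (h : bs.Exclusive) (a : SymIdx sg) : (bs.substT a).Exclusive :=
  h.subst fun η => ⟨η.setT (a.eval η.idx), rfl, by funext x; cases x <;> rfl⟩

theorem Exclusive.substPos (h : bs.Exclusive) (i : Fin sg.dim → SymIdx sg) :
    (bs.substPos i).Exclusive :=
  h.subst fun η => ⟨η.setPos fun d => (i d).eval η.idx, rfl, by funext x; cases x <;> rfl⟩

theorem Exclusive.get (h : bs.Exclusive) (i : Fin sg.dim → SymIdx sg) : (bs.get i).Exclusive := by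
  refine (h.substPos i).append (fun _ => List.pairwise_singleton _ _) ?_
  rintro η ⟨h1, b, hb, h2⟩
  obtain rfl := List.mem_singleton.mp hb
  exact eval_otherwise.mp h2 h1

theorem Exclusive.set (h : bs.Exclusive) (hc : cs.Exclusive) (i : Fin sg.dim → SymIdx sg) :
    (bs.set i cs).Exclusive := by
  refine (hc.restrict _).append (h.restrict _) ?_
  rintro η ⟨h1, h2⟩
  have h2' := (cov_restrict.mp h2).1
  rw [CondExpr.eval, (cov_restrict.mp h1).1] at h2'
  exact Bool.noConfusion h2'

theorem elem_substT (h : bs.Exclusive) {a : SymIdx sg} :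
    (bs.substT a).elem η = bs.elem (η.setT (a.eval η.idx)) := by
  by_cases hc : (bs.substT a).Cov η
  · exact elem_of_has (h.substT a) (has_substT.mpr (has_elem (cov_substT.mp hc)))
  · rw [elem_of_not_cov hc, elem_of_not_cov (mt cov_substT.mpr hc)]
    rfl

/-! ### Generalization by unrolling -/

/-- The branches made exclusive by giving precedence to the earlier ones. -/
def firstMatch : Branches sg → Branches sg
  | [] => []
  | b :: bs => b :: (firstMatch bs).restrict (.not b.1)

theorem exclusive_firstMatch : ∀ bs : Branches sg, bs.firstMatch.Exclusive
  | [] => exclusive_nil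
  | b :: bs => Exclusive.append (bs := [b]) (fun _ => List.pairwise_singleton _ _)
      ((exclusive_firstMatch bs).restrict _) <| by
    rintro η ⟨⟨c, hc, h1⟩, h2⟩
    obtain rfl := List.mem_singleton.mp hc
    have h2' := (cov_restrict.mp h2).1
    rw [CondExpr.eval, h1] at h2'
    exact Bool.noConfusion h2'

theorem has_firstMatch : ∀ bs : Branches sg, bs.firstMatch.Has η r ↔ bs.val η = some r
  | [] => by simp [firstMatch, val]
  | b :: bs => by
    have : Has (b :: (firstMatch bs).restrict (.not b.1)) η r ↔ _ :=
      has_append (bs := [b]) (cs := (firstMatch bs).restrict (.not b.1))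
    rw [firstMatch, this, has_restrict, has_firstMatch bs, val, val, List.find?_cons]
    by_cases hb : b.1.eval η.data.cond η.idx = true <;> simp [Has, hb, CondExpr.eval]

/-- A generalization has to match `val` for every list, even with overlapping conditions, while
`unroll` is analysed through `Has`. Passing to `firstMatch` makes the two agree. -/
theorem val_firstMatch (bs : Branches sg) : bs.firstMatch.val η = bs.val η :=
  Option.ext fun _ => (exclusive_firstMatch bs).val_eq_some.trans (has_firstMatch bs)

/-- The condition that no branch applies in the iterations `a`, …, `b`. -/
def unchanged (bs : Branches sg) (a b : ℕ) : SymCond sg :=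
  .all ((List.range' a (b + 1 - a)).map fun t : ℕ => (bs.substT (.lit (t : ℤ))).otherwise)

theorem eval_unchanged {a b : ℕ} : (unchanged bs a b).eval η.data.cond η.idx = true ↔
    ∀ t : ℕ, a ≤ t → t ≤ b → ¬ bs.Cov (η.setT t) := by
  rw [unchanged, CondExpr.eval_all]
  simp only [List.forall_mem_map, List.mem_range'_1, eval_otherwise, cov_substT, IndexExpr.eval]
  exact ⟨fun h t h1 h2 => h t ⟨h1, by omega⟩, fun h t h1 => h t h1.1 (by omega)⟩

/-- The generalization of `bs` over `N` iterations, by a case distinction on the iteration and the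
last update. -/
def unroll (N : ℕ) (bs : Branches sg) : Branches sg :=
  (List.range (N + 1)).flatMap fun n => (List.range n).flatMap fun m =>
    Branches.restrict (.and (.cmp .eq (.var .t) (.lit n)) (unchanged bs (m + 2) n))
      (bs.substT (.lit ((m : ℤ) + 1)))

theorem eval_unroll_cond {n m : ℕ} :
    (CondExpr.and (.cmp .eq (.var .t) (.lit n)) (unchanged bs (m + 2) n)).eval η.data.cond η.idx =
      true ↔ η.t = n ∧ ∀ t : ℕ, m + 2 ≤ t → t ≤ n → ¬ bs.Cov (η.setT t) := by
  rw [CondExpr.eval, Bool.and_eq_true, eval_unchanged]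
  exact and_congr_left' decide_eq_true_iff

/-- Branches for different `n` contradict `t = n`. For the same `n`, let `m < m'` be the indices of
two update iterations `m + 1` and `m' + 1`: the branch of `m` demands that nothing is updated in the
iterations `m + 2, …, n`, and `m' + 1` is one of them. -/
theorem exclusive_unroll (N : ℕ) (h : bs.Exclusive) : (unroll N bs).Exclusive := by
  refine exclusive_flatMap (fun n _ => exclusive_flatMap (fun m _ => (h.substT _).restrict _) ?_) ?_
  · refine fun η => (List.pairwise_lt_range).imp_of_mem ?_
    rintro m m' - hm' hlt ⟨h1, h2⟩
    rw [cov_restrict, eval_unroll_cond, cov_substT] at h1 h2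
    refine h1.1.2 (m' + 1) (by omega) (by have := List.mem_range.mp hm'; omega) ?_
    simpa [IndexExpr.eval] using h2.2
  · refine fun η => (List.pairwise_lt_range).imp ?_
    rintro n n' hlt ⟨h1, h2⟩
    obtain ⟨m, -, h1⟩ := (cov_flatMap _ _).mp h1
    obtain ⟨m', -, h2⟩ := (cov_flatMap _ _).mp h2
    rw [cov_restrict, eval_unroll_cond] at h1 h2
    have := h1.1.1.symm.trans h2.1.1
    omega

theorem has_unroll {N : ℕ} : (unroll N bs).Has η r ↔ ∃ n ≤ N, ∃ m < n, η.t = n ∧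
    (∀ t : ℕ, m + 2 ≤ t → t ≤ n → ¬ bs.Cov (η.setT t)) ∧ bs.Has (η.setT ((m : ℤ) + 1)) r := by
  simp only [unroll, has_flatMap, has_restrict, eval_unroll_cond, has_substT, IndexExpr.eval,
    List.mem_range, Nat.lt_succ_iff, and_assoc]

end Branches

theorem exists_isGeneralization :
    ∃ gen : ℕ → Branches sg → Branches sg, ∀ N S, IsGeneralization N S (gen N S) := by
  refine ⟨fun N S => (S.firstMatch).unroll N, fun N S =>
    ⟨fun _ => Branches.exclusive_unroll N S.exclusive_firstMatch, fun η t h0 hN v => ?_⟩⟩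
  have hcov : ∀ η : Env sg, S.firstMatch.Cov η ↔ (S.val η).isSome = true := fun η => by
    rw [← Branches.isSome_val, Branches.val_firstMatch]
  rw [(Branches.exclusive_unroll N S.exclusive_firstMatch).val_eq_some, Branches.has_unroll]
  simp only [hcov, Branches.has_firstMatch]
  constructor
  · rintro ⟨n, -, m, hm, ht, h1, h2⟩
    obtain rfl : t = n := ht
    refine ⟨(m : ℤ) + 1, by omega, by omega, h2, ?_⟩
    rintro ⟨t₂, h3, h4, h5⟩
    lift t₂ to ℕ using by omega
    exact h1 t₂ (by omega) (by omega) h5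
  · rintro ⟨t₁, h1, h2, h3, h4⟩
    lift t to ℕ using h0
    lift t₁ to ℕ using by omega
    -- The index `m` in `unroll` stands for an update in iteration `m + 1`, since iterations start
    -- from `1`.
    obtain ⟨m, rfl⟩ : ∃ m, t₁ = m + 1 := ⟨t₁ - 1, by omega⟩
    exact ⟨t, by omega, m, by omega, rfl,
      fun s hs hs' h5 => h4 ⟨s, by omega, by omega, h5⟩, by push_cast at h3; exact h3⟩

/-! ### Iterative semantic extraction -/

/-- The summary `bs` of the start vertex after a sweep that began with the summary `A`: `seq` gives
the arrays after the iterations of the loop, and `W` holds if the iteration `η.t` writes at the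
position `η.pos`. -/
structure IsUpdate (seq : Data sg → List ℤ → List ℝ → Arr sg → ℕ → Arr sg) (W : Env sg → Prop)
    (A bs : Branches sg) : Prop where
  exclusive : bs.Exclusive
  zero : ∀ η : Env sg, η.t = 0 → ¬ bs.Cov η
  cov : ∀ (η : Env sg) (n : ℕ), 1 ≤ n → η.t = n → (bs.Cov η ↔ A.Cov η ∨ W η)
  elem : ∀ (η : Env sg) (n : ℕ), 1 ≤ n → η.t = n →
    (∀ y, A.elem (η.setPos y) = seq η.data η.outer η.params η.out (n - 1) y) →
    bs.elem η = seq η.data η.outer η.params η.out n η.pos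

/-- Some iteration up to the `n`-th writes at the position `η.pos`. -/
def WrittenBy (W : Env sg → Prop) (η : Env sg) (n : ℕ) : Prop :=
  ∃ t : ℕ, 1 ≤ t ∧ t ≤ n ∧ W (η.setT t)

/-- The summary `bs` of the start vertex is right in the first `m` iterations. -/
structure IsApprox (N : ℕ) (seq : Data sg → List ℤ → List ℝ → Arr sg → ℕ → Arr sg)
    (W : Env sg → Prop) (m : ℕ) (bs : Branches sg) : Prop where
  exclusive : bs.Exclusive
  zero : ∀ η : Env sg, η.t = 0 → ¬ bs.Cov η
  lower : ∀ (η : Env sg) (n : ℕ), 1 ≤ n → n ≤ N → η.t = n → W η → bs.Cov η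
  upper : ∀ (η : Env sg) (n : ℕ), 1 ≤ n → n ≤ N → η.t = n → bs.Cov η → WrittenBy W η n
  cov : ∀ (η : Env sg) (n : ℕ), 1 ≤ n → n ≤ N → n ≤ m → η.t = n → WrittenBy W η n → bs.Cov η
  elem : ∀ (η : Env sg) (n : ℕ), 1 ≤ n → n ≤ N → n ≤ m → η.t = n →
    bs.elem η = seq η.data η.outer η.params η.out n η.pos

section Rounds

variable {seq : Data sg → List ℤ → List ℝ → Arr sg → ℕ → Arr sg} {W : Env sg → Prop}
  {N m : ℕ} {bs bs' A G : Branches sg}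

/-- The empty list describes the initial array, which is the array before iteration `1`. In later
iterations the values may be wrong, but the covered positions are already those written by the
iteration itself. -/
theorem isApprox_one (h0 : ∀ σ cs ps B, seq σ cs ps B 0 = B) (h : IsUpdate seq W [] bs) :
    IsApprox N seq W 1 bs where
  exclusive := h.exclusive
  zero := h.zero
  lower η n h1 _ ht hW := (h.cov η n h1 ht).mpr (Or.inr hW)
  upper η n h1 _ ht hc := by
    refine ⟨n, h1, le_rfl, ?_⟩
    rw [← ht]
    exact ((h.cov η n h1 ht).mp hc).resolve_left Branches.not_cov_nil
  cov η n h1 _ hm ht := by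
    obtain rfl : n = 1 := by omega
    rintro ⟨t, h2, h3, hW⟩
    obtain rfl : t = 1 := by omega
    rw [← ht] at hW
    exact (h.cov η 1 h1 ht).mpr (Or.inr hW)
  elem η n h1 _ hm ht := by
    obtain rfl : n = 1 := by omega
    refine h.elem η 1 h1 ht fun y => ?_
    rw [Branches.elem_of_not_cov Branches.not_cov_nil, Nat.sub_self, h0]
    rfl

/-- This needs no bound by `m`: writing is a matter of counters and inputs, so coverage is right
even where values are not. By `upper` nothing unwritten is covered; by `lower` every writing
iteration is noticed, and generalization keeps it or a later one. -/
theorem IsGeneralization.cov_iff (hG : IsGeneralization N bs G) (h : IsApprox N seq W m bs)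
    (η : Env sg) {n : ℕ} (hn : n ≤ N) : G.Cov (η.setT n) ↔ WrittenBy W η n := by
  constructor
  · intro hc
    obtain ⟨v, hv⟩ := Option.isSome_iff_exists.mp (Branches.isSome_val.mpr hc)
    obtain ⟨t, h1, h2, h3, -⟩ := (hG.2 η n (by omega) (by omega) v).mp hv
    lift t to ℕ using by omega
    obtain ⟨s, hs, hs', hW⟩ := h.upper (η.setT t) t (by omega) (by omega) rfl
      (Branches.isSome_val.mp (by rw [h3]; rfl))
    exact ⟨s, hs, by omega, hW⟩
  · rintro ⟨t, h1, h2, hW⟩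
    classical
    -- The greatest such `s` is the last update up to `n`, hence one that nothing overwrites.
    let p : ℕ → Prop := fun s => 1 ≤ s ∧ bs.Cov (η.setT s)
    have hp : p t := ⟨h1, h.lower _ t h1 (by omega) rfl hW⟩
    have hs := Nat.findGreatest_spec (P := p) h2 hp
    have hle := Nat.findGreatest_le (P := p) n
    have hmax : ∀ k, Nat.findGreatest p n < k → k ≤ n → ¬ p k := fun k hk hk' =>
      Nat.findGreatest_is_greatest hk hk'
    generalize Nat.findGreatest p n = s at hs hle hmax
    obtain ⟨v, hv⟩ := Option.isSome_iff_exists.mp (Branches.isSome_val.mpr hs.2)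
    refine Branches.isSome_val.mp ?_
    rw [(hG.2 η n (by omega) (by omega) v).mpr ⟨s, by have := hs.1; omega, by omega, hv, ?_⟩]
    · rfl
    · rintro ⟨t₂, h3, h4, h5⟩
      lift t₂ to ℕ using by omega
      exact hmax t₂ (by omega) (by omega) ⟨by omega, Branches.isSome_val.mp h5⟩

/-- For `1 ≤ n ≤ m` the summary `bs` covers every position written up to `n` already at iteration
`n`. So the last update is found at `n` itself and `G` takes the right value from there. Elsewhere
both keep the initial value. -/
theorem IsGeneralization.elem_eq (h0 : ∀ σ cs ps B, seq σ cs ps B 0 = B)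
    (hG : IsGeneralization N bs G) (h : IsApprox N seq W m bs)
    (η : Env sg) {n : ℕ} (hn : n ≤ N) (hm : n ≤ m) :
    G.elem (η.setT n) = seq η.data η.outer η.params η.out n η.pos := by
  by_cases hc : G.Cov (η.setT n)
  · have hw := (hG.cov_iff h η hn).mp hc
    have h1 : 1 ≤ n := by
      obtain ⟨t, h1, h2, -⟩ := hw
      omega
    have hb := h.cov (η.setT n) n h1 hn hm rfl hw
    refine Eq.trans ?_ (h.elem (η.setT n) n h1 hn hm rfl)
    obtain ⟨v, hv⟩ := Option.isSome_iff_exists.mp (Branches.isSome_val.mpr hb)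
    rw [Branches.elem, Branches.elem, hv, (hG.2 η n (by omega) (by omega) v).mpr
      ⟨n, by omega, le_rfl, hv, by rintro ⟨t, h2, h3, -⟩; omega⟩]
  · rw [Branches.elem_of_not_cov hc]
    rcases Nat.eq_zero_or_pos n with rfl | h1
    · rw [h0]; rfl
    · refine Eq.trans (Eq.symm (Branches.elem_of_not_cov ?_)) (h.elem (η.setT n) n h1 hn hm rfl)
      exact fun hb => hc ((hG.cov_iff h η hn).mpr (h.upper (η.setT n) n h1 hn rfl hb))

theorem elem_shift (hG : G.Exclusive) (η : Env sg) {n : ℕ} (h1 : 1 ≤ n) (ht : η.t = n) :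
    (G.substT (.sub (.var .t) (.lit 1))).elem η = G.elem (η.setT ((n - 1 : ℕ) : ℤ)) := by
  rw [Branches.elem_substT hG]
  simp [IndexExpr.eval, Env.idx, ht, h1]

theorem cov_shift (η : Env sg) {n : ℕ} (h1 : 1 ≤ n) (ht : η.t = n) :
    (G.substT (.sub (.var .t) (.lit 1))).Cov η ↔ G.Cov (η.setT ((n - 1 : ℕ) : ℤ)) := by
  rw [Branches.cov_substT]
  simp [IndexExpr.eval, Env.idx, ht, h1]

/-- `G` is right up to `m`, so its shift describes the array before iteration `n` for all `n ≤ m +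
1`, and the sweep executes iteration `n` on it. -/
theorem IsApprox.succ (h0 : ∀ σ cs ps B, seq σ cs ps B 0 = B) (h : IsApprox N seq W m bs)
    (hG : IsGeneralization N bs G)
    (hu : IsUpdate seq W (G.substT (.sub (.var .t) (.lit 1))) bs') :
    IsApprox N seq W (m + 1) bs' := by
  have hGe : G.Exclusive := hG.1 h.exclusive
  have hcov : ∀ (η : Env sg) (n : ℕ), 1 ≤ n → n ≤ N → η.t = n →
      (bs'.Cov η ↔ WrittenBy W η n) := by
    intro η n h1 hn ht
    rw [hu.cov η n h1 ht, cov_shift η h1 ht, hG.cov_iff h η (by omega)]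
    constructor
    · rintro (⟨t, h2, h3, hW⟩ | hW)
      · exact ⟨t, h2, by omega, hW⟩
      · exact ⟨n, h1, le_rfl, ht ▸ hW⟩
    · rintro ⟨t, h2, h3, hW⟩
      rcases Nat.lt_or_ge t n with h4 | h4
      · exact Or.inl ⟨t, h2, by omega, hW⟩
      · obtain rfl : t = n := by omega
        exact Or.inr (by rw [← ht] at hW; exact hW)
  refine ⟨hu.exclusive, hu.zero, fun η n h1 hn ht hW => ?_,
    fun η n h1 hn ht => (hcov η n h1 hn ht).mp, fun η n h1 hn _ ht => (hcov η n h1 hn ht).mpr,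
    fun η n h1 hn hm ht => hu.elem η n h1 ht fun y => ?_⟩
  · exact (hu.cov η n h1 ht).mpr (Or.inr hW)
  · rw [elem_shift hGe (η.setPos y) h1 ht]
    exact hG.elem_eq h0 h (η.setPos y) (by omega) (by omega)

/-- An early stop is safe. The passed test makes `G` at `n + 1` equal to `bs'` at `n + 1`, which is
one iteration applied to `G` at `n`; and `G` at `0` is the initial array. So `G` satisfies the
recursion of the loop in all iterations. -/
theorem IsApprox.of_same (h0 : ∀ σ cs ps B, seq σ cs ps B 0 = B) (hm : 1 ≤ m)
    (h : IsApprox N seq W m bs) (hG : IsGeneralization N bs G)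
    (hu : IsUpdate seq W (G.substT (.sub (.var .t) (.lit 1))) bs') (hs : SameSummary N bs' G) :
    IsApprox N seq W N bs' := by
  have hGe : G.Exclusive := hG.1 h.exclusive
  have h' := h.succ h0 hG hu
  have key : ∀ (n : ℕ), n ≤ N → ∀ η : Env sg,
      G.elem (η.setT n) = seq η.data η.outer η.params η.out n η.pos := by
    intro n
    induction n with
    | zero => exact fun hn η => hG.elem_eq h0 h η hn (by omega)
    | succ n ih =>
      intro hn η
      rw [← hs (η.setT (n + 1 : ℕ)) (by simp [Env.setT]) (by simp only [Env.setT]; omega)]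
      refine hu.elem (η.setT (n + 1 : ℕ)) (n + 1) (by omega) rfl fun y => ?_
      rw [elem_shift hGe _ (by omega : 1 ≤ n + 1) rfl]
      exact ih (by omega) (η.setPos y)
  refine ⟨h'.exclusive, h'.zero, h'.lower, h'.upper, fun η n h1 hn _ ht hw => ?_,
    fun η n h1 hn _ ht => ?_⟩
  · rw [hu.cov η n h1 ht, cov_shift η h1 ht, hG.cov_iff h η (by omega)]
    obtain ⟨t, h2, h3, hW⟩ := hw
    rcases Nat.lt_or_ge t n with h4 | h4
    · exact Or.inl ⟨t, h2, by omega, hW⟩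
    · obtain rfl : t = n := by omega
      exact Or.inr (by rw [← ht] at hW; exact hW)
  · rw [hs η (by omega) (by omega)]
    have := key n hn η
    rwa [← ht] at this

open Classical in
-- Each failed test gains one right iteration, and `d` bounds the number still missing. All that is
-- needed of the summary rules is isolated in `hsweep`, with `Ready` as the invariant that survives
-- from round to round. The bound `n` is chosen before `fuel`, so any larger fuel gives the same
-- result.
theorem rounds_terminates (h0 : ∀ σ cs ps B, seq σ cs ps B 0 = B)
    {gen : Branches sg → Branches sg} (hgen : ∀ S, IsGeneralization N S (gen S))
    {R : Node sg → (Node sg → Summary sg) → Summary sg} {v : Node sg} {r : List (Node sg)}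
    {Ready : (Node sg → Summary sg) → Prop}
    (hsweep : ∀ S A, Ready S → A.Exclusive →
      Ready (sweep R (r ++ [v]) (Function.update S v (.array A))) ∧
      IsUpdate seq W A (sweep R (r ++ [v]) (Function.update S v (.array A)) v).toArray)
    (d : ℕ) : ∀ (m : ℕ) (S : Node sg → Summary sg), N ≤ m + d → 1 ≤ m → Ready S →
      IsApprox N seq W m (S v).toArray →
      ∃ n S', (∀ fuel, n ≤ fuel → rounds gen N R v r fuel S = some S') ∧ Ready S' ∧
        IsApprox N seq W N (S' v).toArray := by
  induction d with
  | zero =>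
    intro m S hm h1 hS h
    have hG := hgen (S v).toArray
    obtain ⟨hr, hu⟩ := hsweep S _ hS ((hG.1 h.exclusive).substT (.sub (.var .t) (.lit 1)))
    have h' := h.succ h0 hG hu
    -- Here `N ≤ m`, so both sides are the true array in all iterations and the test cannot fail.
    have hs : SameSummary N (sweep R (r ++ [v]) (Function.update S v
        (.array ((gen (S v).toArray).substT (.sub (.var .t) (.lit 1))))) v).toArray
        (gen (S v).toArray) := by
      intro η ht ht'
      obtain ⟨n, hn⟩ : ∃ n : ℕ, η.t = n := ⟨η.t.toNat, by omega⟩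
      have h2 := hG.elem_eq h0 h η (n := n) (by omega) (by omega)
      rw [← hn] at h2
      exact (h'.elem η n (by omega) (by omega) (by omega) hn).trans h2.symm
    refine ⟨1, _, fun fuel hf => ?_, hr, h.of_same h0 h1 hG hu hs⟩
    obtain ⟨f, rfl⟩ : ∃ f, fuel = f + 1 := ⟨fuel - 1, by omega⟩
    rw [rounds]
    exact if_pos hs
  | succ d ih =>
    intro m S hm h1 hS h
    have hG := hgen (S v).toArray
    obtain ⟨hr, hu⟩ := hsweep S _ hS ((hG.1 h.exclusive).substT (.sub (.var .t) (.lit 1)))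
    by_cases hs : SameSummary N (sweep R (r ++ [v]) (Function.update S v
        (.array ((gen (S v).toArray).substT (.sub (.var .t) (.lit 1))))) v).toArray
        (gen (S v).toArray)
    · refine ⟨1, _, fun fuel hf => ?_, hr, h.of_same h0 h1 hG hu hs⟩
      obtain ⟨f, rfl⟩ : ∃ f, fuel = f + 1 := ⟨fuel - 1, by omega⟩
      rw [rounds]
      exact if_pos hs
    · obtain ⟨n, S', hn, hS'⟩ := ih (m + 1) _ (by omega) (by omega) hr (h.succ h0 hG hu)
      refine ⟨n + 1, S', fun fuel hf => ?_, hS'⟩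
      obtain ⟨f, rfl⟩ : ∃ f, fuel = f + 1 := ⟨fuel - 1, by omega⟩
      rw [rounds]
      exact (if_neg hs).trans (hn f (by omega))

end Rounds
/-! ### Execution along a given path -/

section Path

variable {C : Type} (run : C → List ℤ → List ℝ → Arr sg → Arr sg) (σ : Data sg)
  (L : LoopOver sg C)

/-- The state after the first `i` statements if exactly the statements in `T` are executed. -/
noncomputable def pathState (cs : List ℤ) (ps : List ℝ) (B : Arr sg) (T : Finset ℕ) :
    ℕ → BodyState sg
  | 0 => ⟨fun _ => 0, B⟩
  | i + 1 =>
    match L.body[i]? with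
    | none => pathState cs ps B T i
    | some s =>
      if i ∈ T then execOp run σ cs ps i (pathState cs ps B T i) s.op
      else pathState cs ps B T i

variable {L}

theorem LoopOver.mem_executed {cs : List ℤ} {i : ℕ} : i ∈ L.executed σ cs ↔
    ∃ s, L.body[i]? = some s ∧ s.guard.eval σ.cond (srcEnv σ cs) = true := by
  simp only [LoopOver.executed, Finset.mem_filter, Finset.mem_range, Option.mem_def,
    and_iff_right_iff_imp]
  rintro ⟨s, hs, -⟩
  exact (List.getElem?_eq_some_iff.mp hs).1

variable {run σ} {cs : List ℤ} {ps : List ℝ} {B : Arr sg} {T : Finset ℕ} {i j : ℕ}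
  {s : Stmt sg C}

theorem pathState_succ (hs : L.body[i]? = some s) (hi : i ∈ T) :
    pathState run σ L cs ps B T (i + 1) =
      execOp run σ cs ps i (pathState run σ L cs ps B T i) s.op := by
  rw [pathState, hs]
  exact if_pos hi

theorem pathState_succ_of_notMem (hi : i ∉ T) :
    pathState run σ L cs ps B T (i + 1) = pathState run σ L cs ps B T i := by
  rw [pathState]
  cases L.body[i]? with
  | none => rfl
  | some s => exact if_neg hi

theorem pathState_succ_of_none (hs : L.body[i]? = none) :
    pathState run σ L cs ps B T (i + 1) = pathState run σ L cs ps B T i := by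
  rw [pathState, hs]

/-- Guards read counters and inputs only, which do not change during an iteration, so the executed
set can be determined in advance. -/
theorem bodyState_eq_pathState (i : ℕ) : bodyState run σ L cs ps B i =
    pathState run σ L cs ps B (L.executed σ cs) i := by
  induction i with
  | zero => rfl
  | succ i ih =>
    rw [bodyState]
    rcases hs : L.body[i]? with _ | s
    · rw [pathState_succ_of_none hs]
      exact ih
    · by_cases hg : s.guard.eval σ.cond (srcEnv σ cs) = true
      · rw [pathState_succ hs ((LoopOver.mem_executed σ).mpr ⟨s, hs, hg⟩), ← ih]
        exact if_pos hg
      · rw [pathState_succ_of_notMem, ← ih]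
        · exact if_neg hg
        · rintro hi
          obtain ⟨s', hs', hg'⟩ := (LoopOver.mem_executed σ).mp hi
          rw [hs, Option.some_inj] at hs'
          exact hg (hs' ▸ hg')

theorem execOp_arr {st : BodyState sg} {op : Op sg C} (h : op.writes = false) :
    (execOp run σ cs ps i st op).arr = st.arr := by
  cases op <;> first | rfl | exact Bool.noConfusion h

theorem execOp_temps_of_writes {st : BodyState sg} {op : Op sg C} (h : op.writes = true) :
    (execOp run σ cs ps i st op).temps = st.temps := by
  cases op <;> first | rfl | exact Bool.noConfusion h

theorem execOp_temps_of_ne {st : BodyState sg} {op : Op sg C} (h : j ≠ i) :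
    (execOp run σ cs ps i st op).temps j = st.temps j := by
  cases op <;> simp [execOp, Function.update_of_ne h]

theorem pathState_temps_of_ne (h : j ≠ i) : (pathState run σ L cs ps B T (i + 1)).temps j =
    (pathState run σ L cs ps B T i).temps j := by
  rw [pathState]
  cases L.body[i]? with
  | none => rfl
  | some s =>
    by_cases hi : i ∈ T
    · simp only [hi, if_true]
      exact execOp_temps_of_ne h
    · simp only [hi, if_false]

theorem pathState_temps_of_le (h : i ≤ j) : (pathState run σ L cs ps B T i).temps j = 0 := by
  induction i with
  | zero => rfl
  | succ i ih => rw [pathState_temps_of_ne (by omega), ih (by omega)]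

theorem pathState_temps_of_lt (h : j < i) : (pathState run σ L cs ps B T i).temps j =
    (pathState run σ L cs ps B T (j + 1)).temps j := by
  induction i, h using Nat.le_induction with
  | base => rfl
  | succ i h ih => rw [pathState_temps_of_ne (by omega), ih]

theorem readable_iff : readable L T i j = true ↔
    j < i ∧ j ∈ T ∧ ∃ s, L.body[j]? = some s ∧ s.op.writes = false := by
  unfold readable
  cases L.body[j]? <;> simp [and_assoc]

/-- A temporary that is not readable is still at its initial `0`: its statement comes later, is not
executed, or writes the array and leaves the scalars alone. This justifies the default `0` in
`symOperand` and `operandVal`. -/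
theorem pathState_temps : (pathState run σ L cs ps B T i).temps j =
    if readable L T i j = true then (pathState run σ L cs ps B T (j + 1)).temps j else 0 := by
  rcases Nat.lt_or_ge j i with h | h
  · rw [pathState_temps_of_lt h]
    split_ifs with hr
    · rfl
    · rw [readable_iff] at hr
      rw [← pathState_temps_of_le (run := run) (σ := σ) (L := L) (cs := cs) (ps := ps) (B := B)
        (T := T) (le_refl j)]
      by_cases hj : j ∈ T
      · rcases hs : L.body[j]? with _ | s
        · rw [pathState_succ_of_none hs]
        · rw [pathState_succ hs hj, execOp_temps_of_writes]
          by_contra hw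
          exact hr ⟨h, hj, s, hs, by simpa using hw⟩
      · rw [pathState_succ_of_notMem hj]
  · rw [pathState_temps_of_le h, if_neg]
    rw [readable_iff]
    omega

/-- A quantity that changes only with the output array is determined by the version of it that
statement `i` sees. -/
theorem reach_cases {α : Sort*} (f : ℕ → α)
    (hf : ∀ i, (∀ s, L.body[i]? = some s → i ∈ T → s.op.writes = false) → f (i + 1) = f i)
    (i : ℕ) : (reach L T i = .phi ∧ f i = f 0) ∨ ∃ j < i, j ∈ T ∧ ∃ s, L.body[j]? = some s ∧
      s.op.writes = true ∧ reach L T i = .stmt j ∧ f i = f (j + 1) := by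
  induction i with
  | zero => exact Or.inl ⟨rfl, rfl⟩
  | succ i ih =>
    by_cases h : ∃ s, L.body[i]? = some s ∧ i ∈ T ∧ s.op.writes = true
    · obtain ⟨s, hs, hi, hw⟩ := h
      exact Or.inr ⟨i, by omega, hi, s, hs, hw, by rw [reach, hs]; exact if_pos ⟨hi, hw⟩, rfl⟩
    · have h1 : reach L T (i + 1) = reach L T i := by
        rw [reach]
        rcases hs : L.body[i]? with _ | s
        · rfl
        · exact if_neg fun h' => h ⟨s, hs, h'⟩
      have h2 : f (i + 1) = f i := hf i fun s hs hi => by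
        by_contra hw
        exact h ⟨s, hs, hi, by simpa using hw⟩
      rw [h1, h2]
      rcases ih with ih | ⟨j, hj, ih⟩
      · exact Or.inl ih
      · exact Or.inr ⟨j, by omega, ih⟩

theorem pathState_arr_succ (h : ∀ s, L.body[i]? = some s → i ∈ T → s.op.writes = false) :
    (pathState run σ L cs ps B T (i + 1)).arr = (pathState run σ L cs ps B T i).arr := by
  by_cases hi : i ∈ T
  · rcases hs : L.body[i]? with _ | s
    · rw [pathState_succ_of_none hs]
    · rw [pathState_succ hs hi, execOp_arr (h s hs hi)]
  · rw [pathState_succ_of_notMem hi]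

end Path

/-! ### Meaning of vertex summaries -/

/-- The branches describe the scalar `r`. -/
def NumIs (η : Env sg) (bs : Branches sg) (r : ℝ) : Prop :=
  ∀ x r', bs.Has (η.setPos x) r' ↔ r' = r

/-- The branches describe the array `a`, which is updated exactly at the positions in `d`. -/
def ArrIs (η : Env sg) (bs : Branches sg) (a : Arr sg) (d : Set (Fin sg.dim → ℤ)) : Prop :=
  ∀ x, (∀ r, bs.Has (η.setPos x) r ↔ x ∈ d ∧ r = a x) ∧ (x ∉ d → a x = η.out x)

theorem Branches.Exclusive.arrIs {bs : Branches sg} (h : bs.Exclusive) (η : Env sg) :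
    ArrIs η bs (fun y => bs.elem (η.setPos y)) {y | bs.Cov (η.setPos y)} :=
  fun _ => ⟨fun _ => h.has_iff, fun hx => elem_of_not_cov hx⟩

theorem ArrIs.cov_iff {η : Env sg} {bs : Branches sg} {a : Arr sg} {d : Set (Fin sg.dim → ℤ)}
    (h : ArrIs η bs a d) : bs.Cov η ↔ η.pos ∈ d := by
  rw [Branches.cov_iff_has]
  exact ⟨fun ⟨r, hr⟩ => (((h η.pos).1 r).mp hr).1, fun hd => ⟨_, ((h η.pos).1 _).mpr ⟨hd, rfl⟩⟩⟩

theorem ArrIs.elem_eq {η : Env sg} {bs : Branches sg} {a : Arr sg} {d : Set (Fin sg.dim → ℤ)}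
    (h : ArrIs η bs a d) (he : bs.Exclusive) : bs.elem η = a η.pos := by
  by_cases hd : η.pos ∈ d
  · exact Branches.elem_of_has he (((h η.pos).1 _).mpr ⟨hd, rfl⟩)
  · rw [Branches.elem_of_not_cov (mt h.cov_iff.mp hd)]
    exact ((h η.pos).2 hd).symm

theorem numIs_lit (η : Env sg) (r : ℝ) : NumIs η (pureNum (.lit r)) r := fun x r' => by
  rw [Branches.has_pureNum]
  exact eq_comm

theorem NumIs.map1 {η : Env sg} {bs : Branches sg} {r : ℝ} (h : NumIs η bs r) (o : UnOp) :
    NumIs η (bs.map1 (.un o)) (o.eval r) := fun x r' => by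
  simp [Branches.has_map1, h x]

theorem NumIs.map2 {η : Env sg} {bs cs : Branches sg} {r s : ℝ} (h : NumIs η bs r)
    (h' : NumIs η cs s) (o : BinOp) : NumIs η (bs.map2 (.bin o) cs) (o.eval r s) :=
  fun x r' => by simp [Branches.has_map2, h x, h' x]

/-- On updated positions a branch of `bs` answers. On the others only the `otherwise` branch does;
it reads the initial array, which is right because an array in `ArrIs` has its initial values
outside `d`. -/
theorem ArrIs.has_get {η : Env sg} {bs : Branches sg} {a : Arr sg} {d : Set (Fin sg.dim → ℤ)}
    (h : ArrIs η bs a d) (i : Fin sg.dim → SymIdx sg) (x : Fin sg.dim → ℤ) (r : ℝ) :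
    (bs.get i).Has (η.setPos x) r ↔ r = a fun j => (i j).eval (η.setPos x).idx := by
  set y : Fin sg.dim → ℤ := fun j => (i j).eval (η.setPos x).idx
  have h1 : ∀ r, (bs.substPos i).Has (η.setPos x) r ↔ y ∈ d ∧ r = a y := fun r =>
    Branches.has_substPos.trans ((h y).1 r)
  have h2 : (bs.substPos i).Cov (η.setPos x) ↔ y ∈ d := by
    rw [Branches.cov_iff_has]
    simp [h1]
  have h3 : Branches.Has [((bs.substPos i).otherwise, .getOut i)] (η.setPos x) r ↔
      y ∉ d ∧ r = η.out y := by
    simp only [Branches.Has, List.mem_singleton, exists_eq_left, Branches.eval_otherwise, h2]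
    exact and_congr_right' eq_comm
  rw [Branches.get, Branches.has_append, h1, h3]
  by_cases hy : y ∈ d
  · simp [hy]
  · simp [hy, (h y).2 hy]

/-- By `hi` the index does not depend on the position symbols; otherwise `atPos` would not single
out one position. -/
theorem ArrIs.set {η : Env sg} {bs cs : Branches sg} {a : Arr sg} {d : Set (Fin sg.dim → ℤ)}
    {r : ℝ} (h : ArrIs η bs a d) (hc : NumIs η cs r) {i : Fin sg.dim → SymIdx sg}
    {y : Fin sg.dim → ℤ} (hi : ∀ x j, (i j).eval (η.setPos x).idx = y j)
    [DecidableEq (Fin sg.dim → ℤ)] :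
    ArrIs η (bs.set i cs) (Function.update a y r) (insert y d) := fun x => by
  have hx : (Branches.atPos i).eval (η.setPos x).data.cond (η.setPos x).idx = true ↔ x = y := by
    rw [Branches.eval_atPos]
    simp only [hi]
    rfl
  have hx' : (CondExpr.not (Branches.atPos i)).eval (η.setPos x).data.cond (η.setPos x).idx =
      true ↔ x ≠ y := by
    rw [CondExpr.eval, Bool.not_eq_true', ← Bool.not_eq_true, hx]
  simp only [Branches.set, Branches.has_append, Branches.has_restrict, hx, hx', hc x, (h x).1]
  by_cases hxy : x = y
  · simp [hxy]
  · simpa [hxy] using (h x).2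

/-! ### Soundness of the summary rules -/

/-- The input vertices of a loop. -/
def Node.IsInput : Node sg → Prop
  | .bound => False
  | .stmt _ => False
  | .phi => False
  | _ => True

/-- The input vertices carry their symbols. -/
def InputsOk (S : Node sg → Summary sg) : Prop := ∀ v, v.IsInput → S v = inputSummary v

/-- The value of the loop counter in iteration `η.t`. -/
def LoopOver.symCounter {C : Type} (L : LoopOver sg C) (η : Env sg) : ℤ :=
  L.start.eval (srcEnv η.data η.outer) + L.step * (η.t - 1)

theorem LoopOver.symCounter_eq {C : Type} (L : LoopOver sg C) {η : Env sg} {n : ℕ}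
    (h : η.t = n) : L.symCounter η = L.counter η.data η.outer n := by
  rw [symCounter, counter, h]

/-- The summary `s` of the vertex `bound` is the loop counter. -/
def BoundIs {C : Type} (L : LoopOver sg C) (η : Env sg) (s : Summary sg) : Prop :=
  ∀ x, s.toIndex.eval (η.setPos x).idx = L.symCounter η

section Rules

variable {S : Node sg → Summary sg} {η : Env sg} {C : Type} {L : LoopOver sg C}

/-- The summary of `bound` is only required to be right if the loop's own counter occurs in `z`,
since only then is `bound` a predecessor of the vertex that uses `z`. -/
theorem eval_symIndex (hin : InputsOk S) {z : IndexExpr (SrcVar sg)}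
    (hb : SrcVar.counter 0 ∈ z.vars → BoundIs L η (S .bound)) (x : Fin sg.dim → ℤ) :
    (z.subst (symIndex S)).eval (η.setPos x).idx =
      z.eval (srcEnv η.data (L.symCounter η :: η.outer)) := by
  rw [IndexExpr.eval_subst]
  refine IndexExpr.eval_congr _ fun y hy => ?_
  rcases y with (_ | j) | p
  · exact hb hy x
  · rw [symIndex, hin (.outer j) trivial]
    rfl
  · rw [symIndex, hin (.indexIn p) trivial]
    rfl

theorem eval_symGuard (hin : InputsOk S) (hb : BoundIs L η (S .bound))
    (c : CondExpr sg.conds (SrcVar sg)) (x : Fin sg.dim → ℤ) :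
    (symGuard S c).eval η.data.cond (η.setPos x).idx =
      c.eval η.data.cond (srcEnv η.data (L.symCounter η :: η.outer)) := by
  rw [symGuard, CondExpr.eval_subst]
  congr 1
  · funext b
    rw [hin (.condIn b) trivial]
    rfl
  · funext y
    rcases y with (_ | j) | p
    · exact hb x
    · rw [symIndex, hin (.outer j) trivial]
      rfl
    · rw [symIndex, hin (.indexIn p) trivial]
      rfl

/-- The environment of a called loop. -/
def dualEnv (S : Node sg → Summary sg) (ps : List ℝ) (a : Arr sg) (η : Env sg) : Env sg :=
  ⟨η.data, (S .bound).toIndex.eval η.idx :: η.outer, ps, a, 0, η.pos⟩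

theorem dualEnv_idx (hin : InputsOk S) (ps : List ℝ) (a : Arr sg) :
    (dualEnv S ps a η).idx = fun y => (dualIndex S y).eval η.idx := by
  funext y
  rcases y with _ | (_ | j) | d | p
  · rfl
  · rfl
  · rw [dualIndex, hin (.outer j) trivial]
    rfl
  · rfl
  · rw [dualIndex, hin (.indexIn p) trivial]
    rfl

theorem eval_dualCond (hin : InputsOk S) (ps : List ℝ) (a : Arr sg) (c : SymCond sg) :
    (c.subst (fun b => (S (.condIn b)).toCond) (dualIndex S)).eval η.data.cond η.idx =
      c.eval (dualEnv S ps a η).data.cond (dualEnv S ps a η).idx := by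
  rw [CondExpr.eval_subst, dualEnv_idx hin]
  congr 1
  funext b
  rw [hin (.condIn b) trivial]
  rfl

variable {arg : ℕ → Branches sg} {A post : Branches sg} {ps : List ℝ} {a : Arr sg}
  {d : Set (Fin sg.dim → ℤ)}

theorem has_dualNum (hin : InputsOk S) (harg : ∀ s, NumIs η (arg s) (ps.getD s 0))
    (hA : ArrIs η A a d) (x : Fin sg.dim → ℤ) (e : NumExpr sg) (r : ℝ) :
    (dualNum S arg A e).Has (η.setPos x) r ↔ r = e.eval (dualEnv S ps a (η.setPos x)) := by
  induction e generalizing r with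
  | lit r' => exact Branches.has_pureNum.trans eq_comm
  | param s => exact harg s x r
  | un o e ih => simp [dualNum, Branches.has_map1, ih, NumExpr.eval]
  | bin o e f ihe ihf => simp [dualNum, Branches.has_map2, ihe, ihf, NumExpr.eval]
  | getIn b i =>
    rw [dualNum, hin (.arrayIn b) trivial, Branches.has_pureNum, eq_comm]
    simp only [inputSummary, Summary.read, NumExpr.eval, List.map_map, Function.comp_def,
      IndexExpr.eval_subst, dualEnv_idx hin]
    rfl
  | getOut i =>
    rw [dualNum, hA.has_get]
    simp only [IndexExpr.eval_subst, NumExpr.eval, dualEnv_idx hin]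
    rfl

/-- The initial array of the called loop is the array at the call. So a position that the
postcondition leaves alone keeps the branch it has in `A`. -/
theorem has_callSummary (hin : InputsOk S) (harg : ∀ s, NumIs η (arg s) (ps.getD s 0))
    (hA : ArrIs η A a d) (x : Fin sg.dim → ℤ) (r : ℝ) :
    (callSummary S arg A post).Has (η.setPos x) r ↔
      post.Has (dualEnv S ps a (η.setPos x)) r ∨
        ¬ post.Cov (dualEnv S ps a (η.setPos x)) ∧ A.Has (η.setPos x) r := by
  have h1 : ∀ c : SymCond sg, CondExpr.eval (η.setPos x).data.cond (η.setPos x).idx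
      (c.subst (fun b => (S (.condIn b)).toCond) (dualIndex S)) = true ↔
      c.eval (dualEnv S ps a (η.setPos x)).data.cond (dualEnv S ps a (η.setPos x)).idx = true :=
    fun c => by rw [eval_dualCond hin ps a c]
  simp only [callSummary, Branches.has_append, Branches.has_flatMap, Branches.has_restrict, h1,
    has_dualNum hin harg hA]
  refine or_congr ?_ (and_congr_left' ?_)
  · exact exists_congr fun b => and_congr_right' (and_congr_right' eq_comm)
  · rw [CondExpr.eval, Bool.not_eq_true', ← Bool.not_eq_true, CondExpr.eval_any]
    simp only [List.mem_map, exists_exists_and_eq_and, h1]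
    rfl

end Rules

theorem CondExpr.eval_and {nc : ℕ} {X : Type} (κ : Fin nc → Bool) (ρ : X → ℤ)
    (a b : CondExpr nc X) : (a.and b).eval κ ρ = (a.eval κ ρ && b.eval κ ρ) := rfl

theorem CondExpr.eval_not {nc : ℕ} {X : Type} (κ : Fin nc → Bool) (ρ : X → ℤ)
    (a : CondExpr nc X) : a.not.eval κ ρ = !a.eval κ ρ := rfl

/-! ### Exclusive conditions of vertex summaries -/

/-- The conditions in a vertex summary are mutually exclusive. -/
def Summary.Excl (s : Summary sg) : Prop := s.toNum.Exclusive ∧ s.toArray.Exclusive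

theorem excl_num {bs : Branches sg} (h : bs.Exclusive) : (Summary.num bs).Excl :=
  ⟨h, Branches.exclusive_nil⟩

theorem excl_array {bs : Branches sg} (h : bs.Exclusive) : (Summary.array bs).Excl :=
  ⟨Branches.exclusive_pureNum _, h⟩

theorem excl_inputSummary (v : Node sg) : (inputSummary v).Excl := by
  cases v <;> exact ⟨Branches.exclusive_pureNum _, Branches.exclusive_nil⟩

section

variable {S : Node sg → Summary sg} {C : Type} {L : LoopOver sg C}

theorem exclusive_dualNum {arg : ℕ → Branches sg} {A : Branches sg}
    (harg : ∀ s, (arg s).Exclusive) (hA : A.Exclusive) (e : NumExpr sg) :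
    (dualNum S arg A e).Exclusive := by
  induction e with
  | lit | getIn => exact Branches.exclusive_pureNum _
  | param s => exact harg s
  | un o e ih => exact ih.map1 _
  | bin o e f ihe ihf => exact ihe.map2 ihf _
  | getOut i => exact hA.get _

theorem exclusive_callSummary (hin : InputsOk S) {arg : ℕ → Branches sg}
    {A post : Branches sg} (harg : ∀ s, (arg s).Exclusive) (hA : A.Exclusive)
    (hpost : post.Exclusive) : (callSummary S arg A post).Exclusive := by
  refine Branches.Exclusive.append (Branches.exclusive_flatMap
    (fun b _ => (exclusive_dualNum harg hA _).restrict _) fun η => ?_) (hA.restrict _) ?_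
  -- Conditions read neither scalars nor arrays, so both may be replaced by dummies.
  · refine (hpost (dualEnv S [] (fun _ => 0) η)).imp fun hbc h => hbc ?_
    simp only [Branches.cov_restrict, eval_dualCond hin [] fun _ => 0] at h
    exact ⟨h.1.1, h.2.1⟩
  · rintro η ⟨h1, h2⟩
    obtain ⟨b, hb, h1⟩ := (Branches.cov_flatMap _ _).mp h1
    rw [Branches.cov_restrict] at h1 h2
    have h3 := h2.1
    rw [CondExpr.eval, Bool.not_eq_true', ← Bool.not_eq_true, CondExpr.eval_any] at h3
    exact h3 ⟨_, List.mem_map.mpr ⟨b, hb, rfl⟩, h1.1⟩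

theorem exclusive_symOperand (hS : ∀ v, (S v).Excl) (T : Finset ℕ) (i : ℕ) (x : Operand) :
    (symOperand L S T i x).Exclusive := by
  cases x with
  | lit => exact Branches.exclusive_pureNum _
  | param s => exact (hS _).1
  | temp j =>
    rw [symOperand]
    split_ifs
    · exact (hS _).1
    · exact Branches.exclusive_pureNum _

theorem excl_stmtRule (hin : InputsOk S) (hS : ∀ v, (S v).Excl) {post : ℕ → Branches sg}
    (hpost : ∀ i, (post i).Exclusive) (T : Finset ℕ) (i : ℕ) :
    (stmtRule L post T S i).Excl := by
  unfold stmtRule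
  rcases L.body[i]? with _ | ⟨g, op⟩
  · exact excl_inputSummary .phi
  · cases op with
    | assign x => exact excl_num (exclusive_symOperand hS T i x)
    | un o x => exact excl_num ((exclusive_symOperand hS T i x).map1 _)
    | bin o x y =>
      exact excl_num ((exclusive_symOperand hS T i x).map2 (exclusive_symOperand hS T i y) _)
    | getIn a ix => exact excl_num (Branches.exclusive_pureNum _)
    | getOut ix => exact excl_num ((hS _).2.get _)
    | set ix x => exact excl_array ((hS _).2.set (exclusive_symOperand hS T i x) _)
    | call c args =>
      refine excl_array (exclusive_callSummary hin (fun s => ?_) (hS _).2 (hpost i))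
      cases args[s]? with
      | none => exact Branches.exclusive_pureNum _
      | some x => exact exclusive_symOperand hS T i x

theorem inputsOk_pathSummary (hin : InputsOk S) (post : ℕ → Branches sg) (T : Finset ℕ) (i : ℕ) :
    InputsOk (pathSummary L post T S i) := by
  classical
  induction i with
  | zero => exact hin
  | succ i ih =>
    rw [pathSummary]
    split_ifs
    · intro v hv
      rw [Function.update_of_ne]
      · exact ih v hv
      · rintro rfl
        exact hv
    · exact ih

theorem excl_pathSummary (hin : InputsOk S) (hS : ∀ v, (S v).Excl) {post : ℕ → Branches sg}
    (hpost : ∀ i, (post i).Exclusive) (T : Finset ℕ) (i : ℕ) (v : Node sg) :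
    (pathSummary L post T S i v).Excl := by
  classical
  induction i generalizing v with
  | zero => exact hS v
  | succ i ih =>
    rw [pathSummary]
    split_ifs
    · rw [Function.update_apply]
      split_ifs
      · exact excl_stmtRule (inputsOk_pathSummary hin post T i) ih hpost T i
      · exact ih v
    · exact ih v

theorem eval_pathCond {P : Finset ℕ} {η : Env sg} :
    (pathCond L S P).eval η.data.cond η.idx = true ↔ ∀ i s, L.body[i]? = some s →
      (i ∈ P ↔ (symGuard S s.guard).eval η.data.cond η.idx = true) := by
  rw [pathCond, CondExpr.eval_all]
  simp only [List.forall_mem_map, Prod.forall, List.mk_mem_zipIdx_iff_getElem?]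
  rw [forall_comm]
  refine forall_congr' fun i => forall_congr' fun s => forall_congr' fun _ => ?_
  by_cases hi : i ∈ P <;> simp [hi, CondExpr.eval]

theorem mem_paths {n : ℕ} {P : Finset ℕ} :
    P ∈ (List.range n).sublists.map List.toFinset ↔ P ⊆ Finset.range n := by
  constructor
  · intro h
    obtain ⟨l, hl, rfl⟩ := List.mem_map.mp h
    intro i hi
    exact Finset.mem_range.mpr (List.mem_range.mp
      ((List.mem_sublists.mp hl).subset (List.mem_toFinset.mp hi)))
  · intro h
    refine List.mem_map.mpr ⟨(List.range n).filter (· ∈ P),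
      List.mem_sublists.mpr List.filter_sublist, ?_⟩
    ext i
    simpa using fun hi => Finset.mem_range.mp (h hi)

theorem nodup_paths (n : ℕ) : ((List.range n).sublists.map List.toFinset).Nodup := by
  refine (List.nodup_map_iff_inj_on (List.nodup_sublists.mpr List.nodup_range)).mpr ?_
  intro l hl l' hl' h
  have h1 := List.mem_sublists.mp hl
  have h2 := List.mem_sublists.mp hl'
  refine List.Perm.eq_of_pairwise (le := (· < ·)) (fun a b _ _ h h' => absurd h h'.asymm)
    (List.pairwise_lt_range.sublist h1) (List.pairwise_lt_range.sublist h2) ?_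
  exact List.perm_of_nodup_nodup_toFinset_eq (List.nodup_range.sublist h1)
    (List.nodup_range.sublist h2) h

/-- Two path conditions that hold together force their sets to agree on all statements of the body.
Both sets contain only numbers of such statements, so they are equal, and `nodup_paths` lists each
set once. The entry branch is separated from all paths by `t ≥ 1`. -/
theorem exclusive_phiRule (hin : InputsOk S) (hS : ∀ v, (S v).Excl) {post : ℕ → Branches sg}
    (hpost : ∀ i, (post i).Exclusive) (T : Finset ℕ) : (phiRule L post T S).Exclusive := by
  refine Branches.Exclusive.append ((hS _).2.restrict _)
    (Branches.exclusive_flatMap (fun P _ => Branches.Exclusive.restrict ?_ _) fun η => ?_) ?_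
  · split_ifs
    · exact (hS _).2
    · exact (excl_pathSummary hin hS hpost P _ _).2
  · refine (nodup_paths _).imp_of_mem fun {P P'} hP hP' hne h => hne ?_
    simp only [Branches.cov_restrict, CondExpr.eval, Bool.and_eq_true] at h
    have h1 := eval_pathCond.mp h.1.1.2
    have h2 := eval_pathCond.mp h.2.1.2
    have key : ∀ i, i < L.body.length → (i ∈ P ↔ i ∈ P') := fun i hi =>
      (h1 i _ (List.getElem?_eq_getElem hi)).trans (h2 i _ (List.getElem?_eq_getElem hi)).symm
    ext i
    by_cases hi : i < L.body.length
    · exact key i hi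
    · exact ⟨fun h => absurd (Finset.mem_range.mp (mem_paths.mp hP h)) hi,
        fun h => absurd (Finset.mem_range.mp (mem_paths.mp hP' h)) hi⟩
  · rintro η ⟨h1, h2⟩
    obtain ⟨P, -, h2⟩ := (Branches.cov_flatMap _ _).mp h2
    have h1 := (Branches.cov_restrict.mp h1).1
    have h2 := (Branches.cov_restrict.mp h2).1
    simp only [CondExpr.eval, Bool.and_eq_true] at h1 h2
    rw [h2.1] at h1
    exact Bool.noConfusion h1

theorem excl_rule (hin : InputsOk S) (hS : ∀ v, (S v).Excl) {post : ℕ → Branches sg}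
    (hpost : ∀ i, (post i).Exclusive) (T : Finset ℕ) (v : Node sg) : (rule L post T v S).Excl := by
  cases v with
  | stmt i => exact excl_stmtRule hin hS hpost T i
  | phi => exact excl_array (exclusive_phiRule hin hS hpost T)
  | bound => exact ⟨Branches.exclusive_pureNum _, Branches.exclusive_nil⟩
  | arrayIn a => exact excl_inputSummary (.arrayIn a)
  | indexIn p => exact excl_inputSummary (.indexIn p)
  | condIn b => exact excl_inputSummary (.condIn b)
  | param s => exact excl_inputSummary (.param s)
  | outer j => exact excl_inputSummary (.outer j)
  | outIn => exact excl_inputSummary .outIn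

end

/-! ### Soundness of the rules of the vertices of a loop -/

/-- The positions written by the first `i` statements if those in `T` are executed. -/
def written {C : Type} (L : LoopOver sg C) (post : ℕ → Branches sg) (σ : Data sg) (cs : List ℤ)
    (T : Finset ℕ) : ℕ → Set (Fin sg.dim → ℤ)
  | 0 => ∅
  | i + 1 =>
    match L.body[i]? with
    | none => written L post σ cs T i
    | some s =>
      if i ∈ T then
        match s.op with
        | .set ix _ => insert (fun d => (ix d).eval (srcEnv σ cs)) (written L post σ cs T i)
        -- Coverage reads only data, counters, position and `t`. The value `t = 0` agrees with
        -- `dualIndex`; the scalars and the array are dummies.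
        | .call _ _ => written L post σ cs T i ∪ {x | (post i).Cov ⟨σ, cs, [], fun _ => 0, 0, x⟩}
        | _ => written L post σ cs T i
      else written L post σ cs T i

theorem written_succ_of_not_writes {C : Type} {L : LoopOver sg C} {post : ℕ → Branches sg}
    {σ : Data sg} {cs : List ℤ} {T : Finset ℕ} {i : ℕ}
    (h : ∀ s, L.body[i]? = some s → i ∈ T → s.op.writes = false) :
    written L post σ cs T (i + 1) = written L post σ cs T i := by
  rw [written]
  rcases hs : L.body[i]? with _ | ⟨g, op⟩
  · rfl
  · by_cases hi : i ∈ T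
    · have := h _ hs hi
      cases op <;> first | exact if_pos hi | exact Bool.noConfusion this
    · exact if_neg hi

/-- Inside an iteration data flow forward in program order. This drives the evaluation along a path
and rules out cycles that avoid `φ`. -/
theorem stmt_mem_nodePreds {C : Type} {L : LoopOver sg C} {e np i j : ℕ} {T : Finset ℕ}
    (h : Node.stmt j ∈ nodePreds L e np T (.stmt i)) : j ∈ T ∧ j < i := by
  have hr : Node.stmt j = reach L T i → j ∈ T ∧ j < i := fun h => by
    rcases reach_cases (L := L) (T := T) (fun _ => ()) (fun _ _ => rfl) i with
      ⟨h1, -⟩ | ⟨j', h1, h2, -, -, -, h3, -⟩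
    · rw [h1] at h
      cases h
    · rw [h3, Node.stmt.injEq] at h
      exact h ▸ ⟨h2, h1⟩
  have hsrc : ∀ x : SrcVar sg, Node.stmt j ∉ srcNodes e x := by
    rintro ((_ | j) | p) h
    · cases h
    · cases h.2
    · cases h
  have hix : ∀ z : IndexExpr (SrcVar sg), Node.stmt j ∉ indexNodes e z := fun z h => by
    obtain ⟨x, -, h⟩ := Set.mem_iUnion₂.mp h
    exact hsrc x h
  have hop : ∀ x : Operand, Node.stmt j ∈ operandNodes L np T i x → j ∈ T ∧ j < i := by
    rintro (r | s | j') h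
    · exact h.elim
    · cases h.2
    · obtain ⟨h1, h2⟩ := h
      rw [Node.stmt.injEq] at h2
      exact ⟨h2 ▸ (readable_iff.mp h1).2.1, h2 ▸ (readable_iff.mp h1).1⟩
  simp only [nodePreds] at h
  rcases hs : L.body[i]? with _ | ⟨g, op⟩
  · simp [hs] at h
  · simp only [hs] at h
    cases op with
    | assign x | un o x => exact hop x h
    | bin o x y => exact h.elim (hop x) (hop y)
    | getIn a ix =>
      rcases h with h | h
      · cases h
      · obtain ⟨z, -, h⟩ := Set.mem_iUnion₂.mp h
        exact absurd h (hix z)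
    | getOut ix =>
      rcases h with h | h
      · exact hr h
      · obtain ⟨d, h⟩ := Set.mem_iUnion.mp h
        exact absurd h (hix _)
    | set ix x =>
      rcases h with (h | h) | h
      · exact hr h
      · obtain ⟨d, h⟩ := Set.mem_iUnion.mp h
        exact absurd h (hix _)
      · exact hop x h
    | call c args =>
      rcases h with ((h | h) | h) | (⟨_, h⟩ | ⟨_, h⟩ | ⟨_, h⟩ | ⟨_, _, h⟩)
      · exact hr h
      · cases h
      · obtain ⟨x, -, h⟩ := Set.mem_iUnion₂.mp h
        exact hop x h
      all_goals cases h

section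

variable {k : ℕ} (L : LoopOver sg (Nest sg k))

/-- `post` describes the effect of the loop called by statement `i`. -/
def PostOk (post : Branches sg) (i : ℕ) : Prop :=
  ∀ g c args, L.body[i]? = some ⟨g, .call c args⟩ → ∀ η : Env sg,
    post.elem η = exec η.data k c η.outer η.params η.out η.pos

/-- The summary `s` of the vertex `v` describes its value in iteration `η.t`, if exactly the
statements in `T` are executed; `B` is the array left by the iteration before, which is updated at
the positions in `D`. -/
def IsVal (post : ℕ → Branches sg) (η : Env sg) (B : Arr sg) (D : Set (Fin sg.dim → ℤ))
    (T : Finset ℕ) (v : Node sg) (s : Summary sg) : Prop :=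
  let cs := L.symCounter η :: η.outer
  let state := pathState (exec η.data k) η.data L cs η.params B T
  match v with
  | .bound => BoundIs L η s
  | .phi => ArrIs η s.toArray B D
  | .stmt i => ∀ st, L.body[i]? = some st →
      if st.op.writes = true then
        ArrIs η s.toArray (state (i + 1)).arr (D ∪ written L post η.data cs T (i + 1))
      else NumIs η s.toNum ((state (i + 1)).temps i)
  | _ => True

variable {L} {post : ℕ → Branches sg} {η : Env sg} {B : Arr sg} {D : Set (Fin sg.dim → ℤ)}
  {T : Finset ℕ} {S : Node sg → Summary sg} {e np i : ℕ}

/-- The array and the set of written positions change at executed writers only, so `reach_cases` can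
follow both at once back to the version that is seen. -/
theorem arrIs_reach (h : IsVal L post η B D T (reach L T i) (S (reach L T i))) :
    ArrIs η (S (reach L T i)).toArray (pathState (exec η.data k) η.data L
      (L.symCounter η :: η.outer) η.params B T i).arr
      (D ∪ written L post η.data (L.symCounter η :: η.outer) T i) := by
  rcases reach_cases (L := L) (T := T) (fun i => ((pathState (exec η.data k) η.data L
    (L.symCounter η :: η.outer) η.params B T i).arr,
    written L post η.data (L.symCounter η :: η.outer) T i))
    (fun i hi => Prod.ext (pathState_arr_succ hi) (written_succ_of_not_writes hi)) i with
    ⟨h1, h2⟩ | ⟨j, -, -, s, hs, hw, h1, h2⟩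
  · rw [Prod.mk.injEq] at h2
    rw [h2.1, h2.2]
    rw [h1] at h ⊢
    change ArrIs η _ B (D ∪ ∅)
    rw [Set.union_empty]
    exact h
  · rw [Prod.mk.injEq] at h2
    rw [h2.1, h2.2]
    rw [h1] at h ⊢
    have := h s hs
    rwa [if_pos hw] at this

theorem numIs_symOperand (hin : InputsOk S) {x : Operand}
    (h : ∀ u ∈ operandNodes L np T i x, IsVal L post η B D T u (S u)) :
    NumIs η (symOperand L S T i x) (x.eval η.params (pathState (exec η.data k) η.data L
      (L.symCounter η :: η.outer) η.params B T i).temps) := by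
  cases x with
  | lit r => exact numIs_lit η r
  | param s =>
    rw [symOperand, hin (.param s) trivial]
    exact fun x r => Branches.has_pureNum.trans eq_comm
  | temp j =>
    rw [symOperand, Operand.eval, pathState_temps]
    by_cases hr : readable L T i j = true
    · rw [if_pos hr, if_pos hr]
      obtain ⟨-, -, s, hs, hw⟩ := readable_iff.mp hr
      have := h (.stmt j) ⟨hr, rfl⟩ s hs
      rwa [if_neg (by simp [hw])] at this
    · rw [if_neg hr, if_neg hr]
      exact numIs_lit η 0

theorem getD_map_operand (args : List Operand) (ps : List ℝ) (temps : ℕ → ℝ) (s : ℕ) :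
    (args.map fun x => x.eval ps temps).getD s 0 =
      ((args[s]?).map fun x => x.eval ps temps).getD 0 := by
  rw [List.getD_eq_getElem?_getD, List.getElem?_map]

theorem bound_mem_indexNodes {z : IndexExpr (SrcVar sg)} (h : SrcVar.counter 0 ∈ z.vars) :
    Node.bound ∈ indexNodes e z :=
  Set.mem_iUnion₂.mpr ⟨_, h, rfl⟩

/-- Each rule mirrors `execOp` symbolically, for an arbitrary array `B` before the iteration. This
generality is what lets the same rules serve in every round, also when the start summary is still
wrong. -/
theorem isVal_stmtRule (hin : InputsOk S) (hi : i ∈ T) (hpost : (post i).Exclusive)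
    (hok : PostOk L (post i) i)
    (h : ∀ u ∈ nodePreds L e np T (.stmt i), IsVal L post η B D T u (S u)) :
    IsVal L post η B D T (.stmt i) (stmtRule L post T S i) := by
  classical
  intro st hs
  obtain ⟨g, op⟩ := st
  have hb : ∀ z : IndexExpr (SrcVar sg), indexNodes e z ⊆ nodePreds L e np T (.stmt i) →
      SrcVar.counter 0 ∈ z.vars → BoundIs L η (S .bound) := fun z hz h0 =>
    h .bound (hz (bound_mem_indexNodes h0))
  rw [pathState_succ hs hi]
  simp only [stmtRule, hs]
  simp only [nodePreds, hs] at h hb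
  cases op with
  | assign x =>
    simp only [Op.writes, execOp, Function.update_self, Bool.false_eq_true, if_false]
    exact numIs_symOperand hin h
  | un o x =>
    simp only [Op.writes, execOp, Function.update_self, Bool.false_eq_true, if_false]
    exact (numIs_symOperand hin h).map1 o
  | bin o x y =>
    simp only [Op.writes, execOp, Function.update_self, Bool.false_eq_true, if_false]
    exact (numIs_symOperand hin fun u hu => h u (Or.inl hu)).map2
      (numIs_symOperand hin fun u hu => h u (Or.inr hu)) o
  | getIn a ix =>
    simp only [Op.writes, execOp, Function.update_self, Bool.false_eq_true, if_false]
    intro x r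
    rw [Summary.toNum, hin (.arrayIn a) trivial, Branches.has_pureNum, eq_comm]
    simp only [inputSummary, Summary.read, NumExpr.eval, List.map_map, Function.comp_def]
    rw [List.map_congr_left fun z hz => eval_symIndex hin (hb z fun u hu =>
      Or.inr (Set.mem_iUnion₂.mpr ⟨z, hz, hu⟩)) x]
    rfl
  | getOut ix =>
    simp only [Op.writes, execOp, Function.update_self, Bool.false_eq_true, if_false]
    intro x r
    refine ((arrIs_reach (h _ (Or.inl rfl))).has_get _ x r).trans ?_
    simp only [eval_symIndex hin (hb _ fun u hu => Or.inr (Set.mem_iUnion.mpr ⟨_, hu⟩))]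
  | set ix x =>
    simp only [Op.writes, execOp, if_true, written, hs, hi, Set.union_insert]
    refine (arrIs_reach (h _ (Or.inl (Or.inl rfl)))).set
      (numIs_symOperand hin fun u hu => h u (Or.inr hu)) fun x j => ?_
    exact eval_symIndex hin (hb _ fun u hu => Or.inl (Or.inr (Set.mem_iUnion.mpr ⟨_, hu⟩))) x
  | call c args =>
    simp only [Op.writes, execOp, if_true, written, hs, hi]
    have hA := arrIs_reach (h _ (Or.inl (Or.inl (Or.inl rfl))))
    have hbd : BoundIs L η (S .bound) := h .bound (Or.inl (Or.inl (Or.inr rfl)))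
    set st := pathState (exec η.data k) η.data L (L.symCounter η :: η.outer) η.params B T i
    have harg : ∀ s, NumIs η (((args[s]?).map (symOperand L S T i)).getD (pureNum (.lit 0)))
        ((args.map fun x => x.eval η.params st.temps).getD s 0) := by
      intro s
      rw [getD_map_operand]
      rcases hx : args[s]? with _ | x
      · exact numIs_lit η 0
      · exact numIs_symOperand hin fun u hu => h u (Or.inl (Or.inr
          (Set.mem_iUnion₂.mpr ⟨x, List.mem_of_getElem? hx, hu⟩)))
    intro x
    have henv : ∀ (ps : List ℝ) (a : Arr sg), dualEnv S ps a (η.setPos x) =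
        ⟨η.data, L.symCounter η :: η.outer, ps, a, 0, x⟩ := fun ps a => by
      rw [dualEnv, hbd x]
      rfl
    -- The positions covered by the callee do not depend on the actual scalars and array, so they
    -- are those recorded in `written`.
    have hcov : (post i).Cov (dualEnv S (args.map fun x => x.eval η.params st.temps) st.arr
        (η.setPos x)) ↔ (post i).Cov ⟨η.data, L.symCounter η :: η.outer, [], fun _ => 0, 0, x⟩ := by
      rw [henv]
      exact Branches.cov_congr rfl (by funext y; cases y <;> rfl)
    have hexec := hok g c args hs (dualEnv S (args.map fun x => x.eval η.params st.temps) st.arr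
        (η.setPos x))
    simp only [henv] at hexec
    change (∀ r, (callSummary _ _ _ _).Has _ r ↔ _) ∧ _
    simp only [has_callSummary hin harg hA, hpost.has_iff, hcov, (hA x).1]
    rw [henv, hexec]
    by_cases hc : (post i).Cov ⟨η.data, L.symCounter η :: η.outer, [], fun _ => 0, 0, x⟩
    · simp [hc]
    -- Where the postcondition has no branch, its `elem` is the array at the call, so the callee
    -- leaves this position unchanged.
    · have hc' := mt hcov.mp hc
      rw [henv] at hc'
      rw [Branches.elem_of_not_cov hc'] at hexec
      simp only [hc, false_and, false_or, not_false_iff, true_and, Set.mem_union,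
        Set.mem_ofPred_eq, or_false, ← hexec]
      simpa using (hA x).2

/-- A deviating path needs only `φ`, `bound` and the inputs from the graph; its statements are all
recomputed. Summaries left over from the typical path are wrong for `P`, but the condition on `v`
admits only statements of `P` already recomputed, and by `stmt_mem_nodePreds` no others are read. -/
theorem isVal_pathSummary (hin : InputsOk S) (hpost : ∀ i, (post i).Exclusive)
    (hok : ∀ i, PostOk L (post i) i) (hb : BoundIs L η (S .bound))
    (hphi : ArrIs η (S .phi).toArray B D) (P : Finset ℕ) (i : ℕ) :
    ∀ v, (∀ j, v = .stmt j → j ∈ P ∧ j < i) →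
      IsVal L post η B D P v (pathSummary L post P S i v) := by
  classical
  induction i with
  | zero =>
    intro v hv
    cases v with
    | stmt j => exact absurd (hv j rfl).2 (by omega)
    | phi => exact hphi
    | bound => exact hb
    | _ => trivial
  | succ i ih =>
    intro v hv
    rw [pathSummary]
    by_cases hi : i ∈ P
    · rw [if_pos hi, Function.update_apply]
      split_ifs with h
      · subst h
        -- The numbers `e` and `np` only decide which input vertices are predecessors. `IsVal` asks
        -- nothing of these, as `InputsOk` covers them, so any values do.
        refine isVal_stmtRule (e := 0) (np := 0) (inputsOk_pathSummary hin post P i) hi (hpost i)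
          (hok i) fun u hu => ih u ?_
        rintro j rfl
        exact stmt_mem_nodePreds hu
      · exact ih v fun j hj => ⟨(hv j hj).1, lt_of_le_of_ne (Nat.lt_succ_iff.mp (hv j hj).2)
          (by rintro rfl; exact h hj)⟩
    · rw [if_neg hi]
      exact ih v fun j hj => ⟨(hv j hj).1, lt_of_le_of_ne (Nat.lt_succ_iff.mp (hv j hj).2)
          (by rintro rfl; exact hi (hv _ hj).1)⟩

theorem isVal_rule (hin : InputsOk S) {v : Node sg} (hv : v ≠ .phi)
    (hstmt : ∀ i, v = .stmt i → i ∈ T ∧ (post i).Exclusive ∧ PostOk L (post i) i)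
    (h : ∀ u ∈ nodePreds L e np T v, IsVal L post η B D T u (S u)) :
    IsVal L post η B D T v (rule L post T v S) := by
  cases v with
  | phi => exact absurd rfl hv
  | stmt i =>
    obtain ⟨hi, h1, h2⟩ := hstmt i rfl
    exact isVal_stmtRule hin hi h1 h2 h
  | bound =>
    intro x
    simp only [rule, Summary.toIndex, IndexExpr.eval, IndexExpr.eval_subst, LoopOver.symCounter]
    congr 1
    congr 1
    funext y
    cases y with
    | counter j =>
      simp only [hin (.outer j) trivial]
      rfl
    | input p =>
      simp only [hin (.indexIn p) trivial]
      rfl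
  | _ => trivial

theorem eval_pathCond_iff (hin : InputsOk S) (hb : BoundIs L η (S .bound)) {P : Finset ℕ}
    (hP : P ⊆ Finset.range L.body.length) (x : Fin sg.dim → ℤ) :
    (pathCond L S P).eval η.data.cond (η.setPos x).idx = true ↔
      P = L.executed η.data (L.symCounter η :: η.outer) := by
  have h := eval_pathCond (L := L) (S := S) (P := P) (η := η.setPos x)
  simp only [show (η.setPos x).data = η.data from rfl, eval_symGuard hin hb] at h
  rw [h, Finset.ext_iff]
  refine forall_congr' fun i => ?_
  rw [LoopOver.mem_executed]
  rcases hs : L.body[i]? with _ | s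
  · have : i ∉ P := fun hi => by
      have := List.getElem?_eq_none_iff.mp hs
      have := Finset.mem_range.mp (hP hi)
      omega
    simp [this]
  · simp

theorem executed_subset {C : Type} (L : LoopOver sg C) (σ : Data sg) (cs : List ℤ) :
    L.executed σ cs ⊆ Finset.range L.body.length := Finset.filter_subset _ _

/-- After the entry exactly one path condition holds, that of the executed set. -/
theorem has_phiRule (hin : InputsOk S) (hb : BoundIs L η (S .bound)) (ht : 1 ≤ η.t)
    (x : Fin sg.dim → ℤ) (r : ℝ) :
    (phiRule L post T S).Has (η.setPos x) r ↔ Branches.Has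
      (if L.executed η.data (L.symCounter η :: η.outer) = T then
        (S (reach L T L.body.length)).toArray
      else (pathSummary L post (L.executed η.data (L.symCounter η :: η.outer)) S L.body.length
        (reach L (L.executed η.data (L.symCounter η :: η.outer)) L.body.length)).toArray)
      (η.setPos x) r := by
  have hst : (CondExpr.cmp .ge (.var .t) (.lit 1) : SymCond sg).eval (η.setPos x).data.cond
      (η.setPos x).idx = true := by
    simp only [CondExpr.eval, Cmp.eval, IndexExpr.eval, Env.idx]
    exact decide_eq_true ht
  simp only [phiRule, Branches.has_append, Branches.has_restrict, Branches.has_flatMap,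
    CondExpr.eval_and, CondExpr.eval_not, hst, Bool.not_true, Bool.false_eq_true, false_and,
    false_or, Bool.true_and]
  constructor
  · rintro ⟨P, hP, h1, h2⟩
    have := (eval_pathCond_iff hin hb (mem_paths.mp hP) x).mp h1
    subst this
    exact h2
  · intro h
    exact ⟨_, mem_paths.mpr (executed_subset _ _ _),
      (eval_pathCond_iff hin hb (executed_subset _ _ _) x).mpr rfl, h⟩

theorem stmt_eq_reach {C : Type} {L : LoopOver sg C} {i j : ℕ} (h : reach L T i = .stmt j) :
    j ∈ T ∧ j < i := by
  rcases reach_cases (L := L) (T := T) (fun _ => ()) (fun _ _ => rfl) i with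
    ⟨h1, -⟩ | ⟨j', h1, h2, -, -, -, h3, -⟩
  · rw [h1] at h
    cases h
  · rw [h3, Node.stmt.injEq] at h
    exact h ▸ ⟨h2, h1⟩

/-- On the typical path the last version is read off the graph, on any other path off `pathSummary`.
Both describe the array after the body, started from `B`. -/
theorem arrIs_phiRule (hin : InputsOk S) (hpost : ∀ i, (post i).Exclusive)
    (hok : ∀ i, PostOk L (post i) i) (hb : BoundIs L η (S .bound))
    (hphi : ArrIs η (S .phi).toArray B D)
    (hr : IsVal L post η B D T (reach L T L.body.length) (S (reach L T L.body.length)))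
    (ht : 1 ≤ η.t) :
    ArrIs η (phiRule L post T S) (bodyState (exec η.data k) η.data L (L.symCounter η :: η.outer)
      η.params B L.body.length).arr (D ∪ written L post η.data (L.symCounter η :: η.outer)
        (L.executed η.data (L.symCounter η :: η.outer)) L.body.length) := by
  rw [bodyState_eq_pathState]
  intro x
  simp only [has_phiRule hin hb ht]
  split_ifs with h
  · rw [h]
    exact arrIs_reach hr x
  · exact arrIs_reach (isVal_pathSummary hin hpost hok hb hphi _ _ _ fun j hj =>
      stmt_eq_reach hj) x

theorem not_cov_phiRule (hin : InputsOk S) (ht : η.t = 0) : ¬ (phiRule L post T S).Cov η := by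
  have hst : (CondExpr.cmp .ge (.var .t) (.lit 1) : SymCond sg).eval η.data.cond
      η.idx = false := by
    simp [CondExpr.eval, Cmp.eval, IndexExpr.eval, Env.idx, ht]
  simp only [phiRule, Branches.cov_append, Branches.cov_restrict, Branches.cov_flatMap,
    CondExpr.eval_and, CondExpr.eval_not, hst, Bool.not_false, Bool.false_and, Bool.false_eq_true,
    false_and, and_false, exists_false, or_false, true_and, hin .outIn trivial]
  exact Branches.not_cov_nil

end

/-! ### Sweeps over a strongly connected component -/

section Sweep

variable {k : ℕ} {L : LoopOver sg (Nest sg k)} {post : ℕ → Branches sg} {T : Finset ℕ}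
  {S : Node sg → Summary sg} {e np : ℕ}

theorem sweep_cons (R : Node sg → (Node sg → Summary sg) → Summary sg) (v : Node sg)
    (l : List (Node sg)) (S : Node sg → Summary sg) :
    sweep R (v :: l) S = sweep R l (sweep R [v] S) := rfl

theorem sweep_append (R : Node sg → (Node sg → Summary sg) → Summary sg) (l l' : List (Node sg))
    (S : Node sg → Summary sg) : sweep R (l ++ l') S = sweep R l' (sweep R l S) :=
  List.foldl_append

theorem sweep_singleton_self (R : Node sg → (Node sg → Summary sg) → Summary sg) (v : Node sg)
    (S : Node sg → Summary sg) : sweep R [v] S v = R v S := by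
  classical
  exact Function.update_self v (R v S) S

theorem sweep_singleton_of_ne (R : Node sg → (Node sg → Summary sg) → Summary sg) {u v : Node sg}
    (h : u ≠ v) (S : Node sg → Summary sg) : sweep R [v] S u = S u := by
  classical
  exact Function.update_of_ne h (R v S) S

theorem sweep_of_notMem (R : Node sg → (Node sg → Summary sg) → Summary sg) {u : Node sg}
    {l : List (Node sg)} (h : u ∉ l) (S : Node sg → Summary sg) : sweep R l S u = S u := by
  induction l generalizing S with
  | nil => rfl
  | cons v l ih =>
    rw [List.mem_cons, not_or] at h
    rw [sweep_cons, ih h.2, sweep_singleton_of_ne R h.1]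

theorem rule_of_isInput {v : Node sg} (h : v.IsInput) : rule L post T v S = inputSummary v := by
  cases v <;> first | rfl | exact h.elim

theorem inputsOk_sweep (hin : InputsOk S) (l : List (Node sg)) :
    InputsOk (sweep (rule L post T) l S) := by
  induction l generalizing S with
  | nil => exact hin
  | cons v l ih =>
    refine ih fun u hu => ?_
    by_cases h : u = v
    · subst h
      exact (sweep_singleton_self _ _ _).trans (rule_of_isInput hu)
    · exact (sweep_singleton_of_ne _ h _).trans (hin u hu)

theorem excl_sweep (hin : InputsOk S) (hS : ∀ v, (S v).Excl) (hpost : ∀ i, (post i).Exclusive)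
    (l : List (Node sg)) (v : Node sg) : (sweep (rule L post T) l S v).Excl := by
  induction l generalizing S with
  | nil => exact hS v
  | cons w l ih =>
    refine ih (S := sweep _ [w] S) (inputsOk_sweep hin [w]) fun u => ?_
    by_cases h : u = w
    · subst h
      rw [sweep_singleton_self]
      exact excl_rule hin hS hpost T u
    · rw [sweep_singleton_of_ne _ h]
      exact hS u

theorem isVal_sweep {η : Env sg} {B : Arr sg} {D : Set (Fin sg.dim → ℤ)} (hin : InputsOk S)
    (hpost : ∀ i, (post i).Exclusive) (hok : ∀ i, PostOk L (post i) i) {l : List (Node sg)}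
    {g : Set (Node sg)} (hg : ∀ u ∈ g, IsVal L post η B D T u (S u))
    (hl : ∀ l₁ v l₂, l = l₁ ++ v :: l₂ → v ≠ .phi ∧ (∀ i, v = .stmt i → i ∈ T) ∧
      ∀ u ∈ nodePreds L e np T v, u ∈ g ∨ u ∈ l₁) (u : Node sg) (hu : u ∈ g ∨ u ∈ l) :
    IsVal L post η B D T u (sweep (rule L post T) l S u) := by
  induction l generalizing S g with
  | nil => exact hg u (hu.resolve_right (List.not_mem_nil))
  | cons v l ih =>
    obtain ⟨h1, h2, h3⟩ := hl [] v l rfl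
    -- The set `g` of known vertices absorbs each vertex once it has been processed.
    refine ih (S := sweep _ [v] S) (g := insert v g) (inputsOk_sweep hin [v]) (fun w hw => ?_) (fun l₁ w l₂ h => ?_) ?_
    · by_cases h : w = v
      · subst h
        rw [sweep_singleton_self]
        exact isVal_rule hin h1 (fun i hi => ⟨h2 i hi, hpost i, hok i⟩) fun x hx =>
          hg x ((h3 x hx).resolve_right List.not_mem_nil)
      · rw [sweep_singleton_of_ne _ h]
        exact hg w (hw.resolve_left h)
    · obtain ⟨h1, h2, h3⟩ := hl (v :: l₁) w l₂ (by rw [h]; rfl)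
      refine ⟨h1, h2, fun x hx => ?_⟩
      rcases h3 x hx with h | h
      · exact Or.inl (Or.inr h)
      · rcases List.mem_cons.mp h with rfl | h
        · exact Or.inl (Or.inl rfl)
        · exact Or.inr h
    · rcases hu with hu | hu
      · exact Or.inl (Or.inr hu)
      · rcases List.mem_cons.mp hu with rfl | h
        · exact Or.inl (Or.inl rfl)
        · exact Or.inr h

/-- The summaries `S` are known and right for the vertices in `g`, independently of the array. -/
structure Ready (L : LoopOver sg (Nest sg k)) (post : ℕ → Branches sg) (T : Finset ℕ)
    (g : Set (Node sg)) (S : Node sg → Summary sg) : Prop where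
  inputs : InputsOk S
  excl : ∀ v, (S v).Excl
  isVal : ∀ u ∈ g, ∀ η B D, IsVal L post η B D T u (S u)

/-- The iteration `η.t` writes at the position `η.pos`. -/
def Writes (L : LoopOver sg (Nest sg k)) (post : ℕ → Branches sg) (η : Env sg) : Prop :=
  η.pos ∈ written L post η.data (L.symCounter η :: η.outer)
    (L.executed η.data (L.symCounter η :: η.outer)) L.body.length

/-- The arrays after the iterations of a loop. -/
noncomputable def arraySeq (L : LoopOver sg (Nest sg k)) (σ : Data sg) (cs : List ℤ)
    (ps : List ℝ) (B : Arr sg) (n : ℕ) : Arr sg := loopState (exec σ k) σ L cs ps B n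

open Classical in
-- An exclusive `A` always describes some array, namely its own `elem`, updated where `A` covers.
-- The sweep is right relative to that array. The claim on coverage follows with no assumption on
-- it; the claim on values follows once it is the array after `n - 1` iterations. The vertices in
-- `g` are untouched, hence `Ready` survives.
theorem isUpdate_sweep (hpost : ∀ i, (post i).Exclusive) (hok : ∀ i, PostOk L (post i) i)
    {g : Set (Node sg)} (hS : Ready L post T g S) (hgphi : Node.phi ∉ g) {r : List (Node sg)}
    (hdisj : ∀ u ∈ g, u ∉ r) (hbound : Node.bound ∈ g)
    (hreach : reach L T L.body.length = .phi ∨ reach L T L.body.length ∈ g ∨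
      reach L T L.body.length ∈ r)
    (hr : ∀ l₁ v l₂, r = l₁ ++ v :: l₂ → v ≠ .phi ∧ (∀ i, v = .stmt i → i ∈ T) ∧
      ∀ u ∈ nodePreds L e np T v, u = .phi ∨ u ∈ g ∨ u ∈ l₁) {A : Branches sg}
    (hA : A.Exclusive) :
    Ready L post T g (sweep (rule L post T) (r ++ [.phi]) (Function.update S .phi (.array A))) ∧
    IsUpdate (arraySeq L) (Writes L post) A
      (sweep (rule L post T) (r ++ [.phi]) (Function.update S .phi (.array A)) .phi).toArray := by
  set S₁ := Function.update S Node.phi (.array A) with hS₁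
  have hin₁ : InputsOk S₁ := fun v hv => by
    rw [hS₁, Function.update_of_ne]
    · exact hS.inputs v hv
    · rintro rfl
      exact hv
  have hex₁ : ∀ v, (S₁ v).Excl := fun v => by
    rw [hS₁, Function.update_apply]
    split_ifs
    · exact excl_array hA
    · exact hS.excl v
  have hval₁ : ∀ η : Env sg, ∀ u ∈ insert Node.phi g, IsVal L post η
      (fun y => A.elem (η.setPos y)) {y | A.Cov (η.setPos y)} T u (S₁ u) := by
    rintro η u (rfl | hu)
    · rw [hS₁, Function.update_self]
      exact hA.arrIs η
    · rw [hS₁, Function.update_of_ne (by rintro rfl; exact hgphi hu)]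
      exact hS.isVal u hu _ _ _
  refine ⟨⟨inputsOk_sweep hin₁ _, excl_sweep hin₁ hex₁ hpost _, fun u hu η B D => ?_⟩, ?_⟩
  · have hup : u ≠ .phi := by
      rintro rfl
      exact hgphi hu
    rw [sweep_of_notMem, hS₁, Function.update_of_ne hup]
    · exact hS.isVal u hu _ _ _
    · simp [hdisj u hu, hup]
  · rw [sweep_append, sweep_singleton_self]
    set S₂ := sweep (rule L post T) r S₁ with hS₂
    have hin₂ : InputsOk S₂ := inputsOk_sweep hin₁ _
    have hex₂ : ∀ v, (S₂ v).Excl := excl_sweep hin₁ hex₁ hpost _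
    change IsUpdate _ _ _ (phiRule L post T S₂)
    have hval₂ : ∀ (η : Env sg) u, u ∈ insert Node.phi g ∨ u ∈ r → IsVal L post η
        (fun y => A.elem (η.setPos y)) {y | A.Cov (η.setPos y)} T u (S₂ u) := fun η u hu => by
      refine isVal_sweep (e := e) (np := np) hin₁ hpost hok (hval₁ η) (fun l₁ v l₂ h => ?_) u hu
      obtain ⟨h1, h2, h3⟩ := hr l₁ v l₂ h
      exact ⟨h1, h2, fun u hu => or_assoc.mpr (h3 u hu)⟩
    have harr : ∀ (η : Env sg) (n : ℕ), 1 ≤ n → η.t = n → ArrIs η (phiRule L post T S₂) _ _ :=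
      fun η n h1 ht => arrIs_phiRule hin₂ hpost hok (hval₂ η .bound (Or.inl (Or.inr hbound)))
        (hval₂ η .phi (Or.inl (Or.inl rfl))) (hval₂ η _ (or_assoc.mpr hreach)) (by omega)
    have hexc := exclusive_phiRule (L := L) hin₂ hex₂ hpost T
    refine ⟨hexc, fun η ht => not_cov_phiRule hin₂ ht, fun η n h1 ht => ?_,
      fun η n h1 ht hseq => ?_⟩
    · exact (harr η n h1 ht).cov_iff
    · rw [(harr η n h1 ht).elem_eq hexc]
      obtain ⟨m, rfl⟩ : ∃ m, n = m + 1 := ⟨n - 1, by omega⟩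
      simp only [hseq, L.symCounter_eq ht]
      rfl

end Sweep

/-! ### Processing orders -/

section Schedule

variable {k : ℕ} {L : LoopOver sg (Nest sg k)} {T : Finset ℕ} {e np : ℕ}

theorem reach_mem_iterNodes {C : Type} (L : LoopOver sg C) (T : Finset ℕ) (e np i : ℕ) :
    reach L T i ∈ iterNodes e np T := by
  rcases reach_cases (L := L) (T := T) (fun _ => ()) (fun _ _ => rfl) i with
    ⟨h1, -⟩ | ⟨j, -, h2, -, -, -, h3, -⟩
  · rw [h1]
    exact Or.inl (Or.inr (Or.inr rfl))
  · rw [h3]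
    exact Or.inr ⟨j, h2, rfl⟩

theorem inputNodes_subset (e np : ℕ) (T : Finset ℕ) :
    inputNodes (sg := sg) e np ⊆ iterNodes e np T := fun _ h => Or.inl (Or.inl h)

theorem srcNodes_subset (e np : ℕ) (T : Finset ℕ) (x : SrcVar sg) :
    srcNodes e x ⊆ iterNodes e np T := by
  rcases x with (_ | j) | p
  · rintro v rfl
    exact Or.inl (Or.inr (Or.inl rfl))
  · rintro v ⟨h, rfl⟩
    exact inputNodes_subset _ _ _ (Or.inr (Or.inr (Or.inr (Or.inr (Or.inl ⟨j, h, rfl⟩)))))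
  · rintro v rfl
    exact inputNodes_subset _ _ _ (Or.inr (Or.inl ⟨p, rfl⟩))

theorem indexNodes_subset (e np : ℕ) (T : Finset ℕ) (z : IndexExpr (SrcVar sg)) :
    indexNodes e z ⊆ iterNodes e np T :=
  Set.iUnion₂_subset fun x _ => srcNodes_subset e np T x

theorem condNodes_subset (e np : ℕ) (T : Finset ℕ) (c : CondExpr sg.conds (SrcVar sg)) :
    condNodes e c ⊆ iterNodes e np T := by
  refine Set.union_subset (Set.iUnion₂_subset fun x _ => srcNodes_subset e np T x) ?_
  rintro v ⟨b, -, rfl⟩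
  exact inputNodes_subset _ _ _ (Or.inr (Or.inr (Or.inl ⟨b, rfl⟩)))

theorem operandNodes_subset {C : Type} (L : LoopOver sg C) (e np : ℕ) (T : Finset ℕ) (i : ℕ)
    (x : Operand) : operandNodes L np T i x ⊆ iterNodes e np T := by
  rcases x with r | s | j
  · exact Set.empty_subset _
  · rintro v ⟨h, rfl⟩
    exact inputNodes_subset _ _ _ (Or.inr (Or.inr (Or.inr (Or.inl ⟨s, h, rfl⟩))))
  · rintro v ⟨h, rfl⟩
    exact Or.inr ⟨j, (readable_iff.mp h).2.1, rfl⟩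

theorem nodePreds_subset {C : Type} (L : LoopOver sg C) (e np : ℕ) (T : Finset ℕ) (v : Node sg) :
    nodePreds L e np T v ⊆ iterNodes e np T := by
  have hin := inputNodes_subset (sg := sg) e np T
  have hr : ∀ i, {reach L T i} ⊆ iterNodes e np T := fun i =>
    Set.singleton_subset_iff.mpr (reach_mem_iterNodes L T e np i)
  have hop := operandNodes_subset L e np T
  have hix := indexNodes_subset (sg := sg) e np T
  have hb : (Node.bound : Node sg) ∈ iterNodes e np T := Or.inl (Or.inr (Or.inl rfl))
  cases v with
  | bound =>
    rintro v (⟨j, -, h, rfl⟩ | ⟨p, -, rfl⟩)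
    · exact hin (Or.inr (Or.inr (Or.inr (Or.inr (Or.inl ⟨j, h, rfl⟩)))))
    · exact hin (Or.inr (Or.inl ⟨p, rfl⟩))
  | phi =>
    refine Set.union_subset (Set.insert_subset (hin ?_) (hr _))
      (Set.iUnion₂_subset fun s _ => condNodes_subset e np T _)
    exact Or.inr (Or.inr (Or.inr (Or.inr (Or.inr rfl))))
  | stmt i =>
    simp only [nodePreds]
    rcases hs : L.body[i]? with _ | ⟨g, op⟩
    · exact Set.empty_subset _
    · cases op with
      | assign x | un o x => exact hop i x
      | bin o x y => exact Set.union_subset (hop i x) (hop i y)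
      | getIn a ix =>
        exact Set.union_subset (Set.singleton_subset_iff.mpr (hin (Or.inl ⟨a, rfl⟩)))
          (Set.iUnion₂_subset fun z _ => hix z)
      | getOut ix => exact Set.union_subset (hr i) (Set.iUnion_subset fun d => hix _)
      | set ix x =>
        exact Set.union_subset (Set.union_subset (hr i) (Set.iUnion_subset fun d => hix _))
          (hop i x)
      | call c args =>
        refine Set.union_subset (Set.union_subset (Set.insert_subset
          (hr i rfl) (Set.singleton_subset_iff.mpr hb)) (Set.iUnion₂_subset fun x _ => hop i x)) ?_
        rintro v (h | h | h | h)
        · exact hin (Or.inl h)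
        · exact hin (Or.inr (Or.inl h))
        · exact hin (Or.inr (Or.inr (Or.inl h)))
        · exact hin (Or.inr (Or.inr (Or.inr (Or.inr (Or.inl h)))))
  | _ => exact Set.empty_subset _

/-- This forces every admissible start vertex to be `φ`. -/
theorem nodeKind_eq_phi {C : Type} {L : LoopOver sg C} {v : Node sg} :
    nodeKind L v = .phi ↔ v = .phi := by
  refine ⟨fun h => ?_, fun h => h ▸ rfl⟩
  cases v with
  | phi => rfl
  | stmt i =>
    simp only [nodeKind] at h
    rcases hs : L.body[i]? with _ | ⟨g, op⟩ <;> rw [hs] at h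
    · cases h
    · cases op <;> cases h
  | _ => cases h

theorem invSubgraph_edge {u v : Node sg} (hv : v ∈ iterNodes e np T)
    (h : u ∈ nodePreds L e np T v) : (invSubgraph L e np T).E u v :=
  ⟨nodePreds_subset L e np T v h, hv, Or.inl h⟩

theorem phi_mem_iterNodes (e np : ℕ) (T : Finset ℕ) : (Node.phi : Node sg) ∈ iterNodes e np T :=
  Or.inl (Or.inr (Or.inr rfl))

theorem invSubgraph_edge_phi : (invSubgraph L e np T).E .phi .phi :=
  ⟨phi_mem_iterNodes _ _ _, phi_mem_iterNodes _ _ _, Or.inr ⟨rfl, Or.inl rfl⟩⟩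

/-- A version of the output array is on a cycle through the `φ` vertex. -/
theorem writer_cycle {i : ℕ} {s : Stmt sg (Nest sg k)} (hi : i ∈ T) (hs : L.body[i]? = some s)
    (hw : s.op.writes = true) :
    Relation.ReflTransGen (invSubgraph L e np T).E .phi (.stmt i) ∧
    Relation.ReflTransGen (invSubgraph L e np T).E (.stmt i) .phi := by
  have hpred : ∀ i s, i ∈ T → L.body[i]? = some s → s.op.writes = true →
      (invSubgraph L e np T).E (reach L T i) (.stmt i) := by
    intro i s hi hs hw
    refine invSubgraph_edge (Or.inr ⟨i, hi, rfl⟩) ?_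
    simp only [nodePreds, hs]
    obtain ⟨g, op⟩ := s
    cases op with
    | set ix x => exact Or.inl (Or.inl rfl)
    | call c args => exact Or.inl (Or.inl (Or.inl rfl))
    | _ => exact Bool.noConfusion hw
  constructor
  · induction i using Nat.strong_induction_on generalizing s with
    | _ i ih =>
      refine Relation.ReflTransGen.tail ?_ (hpred i s hi hs hw)
      rcases reach_cases (L := L) (T := T) (fun _ => ()) (fun _ _ => rfl) i with
        ⟨h1, -⟩ | ⟨j, hj, h2, s', hs', hw', h3, -⟩
      · rw [h1]
      · rw [h3]
        exact ih j hj h2 hs' hw'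
  · have hlen : i + 1 ≤ L.body.length := (List.getElem?_eq_some_iff.mp hs).1
    have key : ∀ m, i + 1 ≤ m →
        Relation.ReflTransGen (invSubgraph L e np T).E (.stmt i) (reach L T m) := by
      intro m hm
      induction m, hm using Nat.le_induction with
      | base =>
        have h : reach L T (i + 1) = .stmt i := by
          rw [reach, hs]
          exact if_pos ⟨hi, hw⟩
        rw [h]
      | succ m hm ih =>
        rw [reach]
        rcases hs' : L.body[m]? with _ | s'
        · exact ih
        · by_cases h : m ∈ T ∧ s'.op.writes = true
          · simp only [h, and_self, if_true]
            exact ih.tail (hpred m s' h.1 hs' h.2)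
          · simpa only [h, if_false] using ih
    exact (key _ hlen).tail (invSubgraph_edge (phi_mem_iterNodes _ _ _) (Or.inl (Or.inr rfl)))

theorem reach_input_eq {u v : Node sg} (hv : v.IsInput)
    (h : Relation.ReflTransGen (invSubgraph L e np T).E u v) : u = v := by
  rcases Relation.ReflTransGen.cases_tail h with h | ⟨w, -, -, -, h | ⟨rfl, -⟩⟩
  · exact h.symm
  · cases v <;> first | exact hv.elim | exact h.elim
  · exact hv.elim

theorem isInput_of_edge_bound {u : Node sg} (h : (invSubgraph L e np T).E u .bound) :
    u.IsInput := by
  obtain ⟨-, -, (⟨j, -, -, rfl⟩ | ⟨p, -, rfl⟩) | ⟨h, -⟩⟩ := h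
  · trivial
  · trivial
  · cases h

/-- `bound` depends on inputs only and these have no predecessors. So `bound` precedes the component
of `φ`, and the summary of the counter is fixed before the rounds. -/
theorem not_reach_bound (h : Relation.ReflTransGen (invSubgraph L e np T).E .phi .bound) :
    False := by
  rcases Relation.ReflTransGen.cases_tail h with h | ⟨w, h, hw⟩
  · cases h
  · have := isInput_of_edge_bound hw
    rw [← reach_input_eq this h] at this
    exact this

end Schedule

/-! ### Recursive lifting of one loop, given the postconditions of its callees. -/

section Lift

variable {k : ℕ}

/-- Lifting the loop called by statement `i`, where `f` lifts the callable loops. -/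
noncomputable def lowerCall (L : LoopOver sg (Nest sg k))
    (f : Nest sg k → ℕ → ℕ → Option (Branches sg)) (post : ℕ → Branches sg) (i : ℕ) :
    Option (ℕ → Branches sg) :=
  match L.body[i]? with
  | some ⟨_, .call c args⟩ => (f c args.length i).map fun b => Function.update post i b
  | _ => some post

/-- Processing one strongly connected component. -/
noncomputable def processScc (gen : Branches sg → Branches sg) (L : LoopOver sg (Nest sg k))
    (H : InvSubgraph sg) (T : Finset ℕ) (f : Nest sg k → ℕ → ℕ → Option (Branches sg)) (fuel : ℕ)
    (Sp : (Node sg → Summary sg) × (ℕ → Branches sg)) (c : List (Node sg)) :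
    Option ((Node sg → Summary sg) × (ℕ → Branches sg)) :=
  ((c.flatMap (callees L T)).foldlM (lowerCall L f) Sp.2).bind fun post =>
    (extract gen L.iters H (rule L post T) fuel Sp.1 c).map fun S => (S, post)

theorem lift_succ (st : Strategy sg) (T : List ℕ → Finset ℕ) (fuel : ℕ)
    (L : LoopOver sg (Nest sg k)) (np : ℕ) (p : List ℕ) :
    lift st T fuel (k + 1) L np p = ((st.order p).foldlM (processScc (st.gen L.iters) L
      (invSubgraph L p.length np (T p)) (T p) (fun c n i => lift st T fuel k c n (p ++ [i])) fuel)
      (inputSummary, fun _ => [])).map fun Sp => (Sp.1 .phi).toArray.substT (.lit L.iters) := rfl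

variable {L : LoopOver sg (Nest sg k)} {T : Finset ℕ} {e np : ℕ}

/-- The postconditions of the called loops, for the statements that call a loop. -/
structure Posts (L : LoopOver sg (Nest sg k)) (P : ℕ → Branches sg) (n₀ : ℕ)
    (f : ℕ → Nest sg k → ℕ → ℕ → Option (Branches sg)) : Prop where
  exclusive : ∀ i, (P i).Exclusive
  ok : ∀ i, PostOk L (P i) i
  nil : ∀ i, (∀ g c args, L.body[i]? ≠ some ⟨g, .call c args⟩) → P i = []
  lift : ∀ fuel, n₀ ≤ fuel → ∀ i g c args, L.body[i]? = some ⟨g, .call c args⟩ →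
    f fuel c args.length i = some (P i)

/-- The postconditions that are known so far. -/
def Partly (P post : ℕ → Branches sg) : Prop := ∀ i, post i = P i ∨ post i = []

variable {P post : ℕ → Branches sg} {n₀ : ℕ}
  {f : ℕ → Nest sg k → ℕ → ℕ → Option (Branches sg)} {S : Node sg → Summary sg}
  {gen : Branches sg → Branches sg}

theorem Partly.exclusive (hP : Posts L P n₀ f) (h : Partly P post) (i : ℕ) :
    (post i).Exclusive := by
  rcases h i with h | h <;> rw [h]
  · exact hP.exclusive i
  · exact Branches.exclusive_nil

/-- Lifting never destroys a known postcondition, and the outcome is the same for all sufficient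
fuels. For a statement that calls no loop, the default `[]` is already the value `P i`. -/
theorem Posts.lower (hP : Posts L P n₀ f) (l : List ℕ) (h : Partly P post) :
    ∃ post', (∀ fuel, n₀ ≤ fuel → l.foldlM (lowerCall L (f fuel)) post = some post') ∧
      Partly P post' ∧ (∀ i ∈ l, post' i = P i) ∧ ∀ i, post i = P i → post' i = P i := by
  induction l generalizing post with
  | nil => exact ⟨post, fun _ _ => rfl, h, fun _ h => absurd h List.not_mem_nil, fun _ h => h⟩
  | cons i l ih =>
    have step : ∃ post₁, (∀ fuel, n₀ ≤ fuel → lowerCall L (f fuel) post i = some post₁) ∧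
        Partly P post₁ ∧ post₁ i = P i ∧ ∀ j, post j = P j → post₁ j = P j := by
      by_cases hc : ∃ g c args, L.body[i]? = some ⟨g, .call c args⟩
      · obtain ⟨g, c, args, hs⟩ := hc
        refine ⟨Function.update post i (P i), fun fuel hf => ?_, fun j => ?_,
          Function.update_self .., fun j hj => ?_⟩
        · simp only [lowerCall, hs, hP.lift fuel hf i g c args hs, Option.map_some]
        · by_cases hj : j = i
          · subst hj
            exact Or.inl (Function.update_self ..)
          · rw [Function.update_of_ne hj]
            exact h j
        · by_cases hji : j = i
          · subst hji
            exact Function.update_self ..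
          · rwa [Function.update_of_ne hji]
      · push Not at hc
        refine ⟨post, fun fuel _ => ?_, h, ?_, fun _ h => h⟩
        · rw [lowerCall]
          split
          · rename_i g c args hs
            exact absurd hs (hc g c args)
          · rfl
        · rcases h i with h | h
          · exact h
          · rw [h, hP.nil i hc]
    obtain ⟨post₁, h1, h2, h3, h4⟩ := step
    obtain ⟨post', h1', h2', h3', h4'⟩ := ih h2
    refine ⟨post', fun fuel hf => ?_, h2', fun j hj => ?_, fun j hj => h4' j (h4 j hj)⟩
    · rw [List.foldlM_cons, h1 fuel hf]
      exact h1' fuel hf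
    · rcases List.mem_cons.mp hj with rfl | hj
      · exact h4' _ h3
      · exact h3' j hj

theorem Posts.processScc_trivial (hP : Posts L P n₀ f) (H : InvSubgraph sg) {v : Node sg}
    (hv : ¬ Nontrivial H [v]) (h : Partly P post) (S : Node sg → Summary sg) :
    ∃ post', Partly P post' ∧ (∀ i ∈ callees L T v, post' i = P i) ∧ ∀ fuel, n₀ ≤ fuel →
      processScc gen L H T (f fuel) fuel (S, post) [v] =
        some (sweep (rule L post' T) [v] S, post') := by
  obtain ⟨post', h1, h2, h3, -⟩ := hP.lower (callees L T v) h
  refine ⟨post', h2, h3, fun fuel hf => ?_⟩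
  rw [processScc, List.flatMap_singleton, h1 fuel hf, Option.bind_some, extract, if_neg hv]
  rfl

/-- Apart from `φ`, a vertex uses at most its own postcondition, so its summary is final even if
other callees have not been lifted yet. -/
theorem rule_congr_post {post' : ℕ → Branches sg} {v : Node sg} (hv : v ≠ .phi)
    (h : ∀ i, v = .stmt i → post i = post' i) : rule L post T v S = rule L post' T v S := by
  cases v with
  | phi => exact absurd rfl hv
  | stmt i => simp only [rule, stmtRule, h i rfl]
  | _ => rfl

/-- The components before the one of the `φ` vertex. -/
theorem Posts.process_before (hP : Posts L P n₀ f) {H : InvSubgraph sg}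
    {Ω : List (List (Node sg))} {g : Set (Node sg)} (hS : Ready L P T g S) (h : Partly P post)
    (hΩ : ∀ Ω₁ c Ω₂, Ω = Ω₁ ++ c :: Ω₂ → ∃ v, c = [v] ∧ v ≠ .phi ∧ ¬ Nontrivial H [v] ∧
      (∀ i, v = .stmt i → i ∈ T) ∧ ∀ u ∈ nodePreds L e np T v, u ∈ g ∨ u ∈ Ω₁.flatten) :
    ∃ Sp, (∀ fuel, n₀ ≤ fuel →
        Ω.foldlM (processScc gen L H T (f fuel) fuel) (S, post) = some Sp) ∧
      Ready L P T {u | u ∈ g ∨ u ∈ Ω.flatten} Sp.1 ∧ Partly P Sp.2 := by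
  induction Ω generalizing S post g with
  | nil =>
    refine ⟨(S, post), fun _ _ => rfl, ?_, h⟩
    convert hS using 1
    simp
  | cons c Ω ih =>
    obtain ⟨v, rfl, hv, hn, hT, hpre⟩ := hΩ [] c Ω rfl
    obtain ⟨post', h1, h2, h3⟩ := hP.processScc_trivial (gen := gen) (T := T) H hn h S
    have hS' : Ready L P T (insert v g) (sweep (rule L post' T) [v] S) := by
      refine ⟨inputsOk_sweep hS.inputs _, excl_sweep hS.inputs hS.excl (h1.exclusive hP) _,
        fun u hu η B D => ?_⟩
      by_cases huv : u = v
      · subst huv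
        rw [sweep_singleton_self, rule_congr_post hv fun i hi => h2 i (by subst hi; simp [callees])]
        exact isVal_rule hS.inputs hv (fun i hi => ⟨hT i hi, hP.exclusive i, hP.ok i⟩)
          fun x hx => hS.isVal x ((hpre x hx).resolve_right (by simp)) _ _ _
      · rw [sweep_singleton_of_ne _ huv]
        exact hS.isVal u (hu.resolve_left huv) _ _ _
    obtain ⟨Sp, h4, h5, h6⟩ := ih hS' h1 fun Ω₁ c Ω₂ h => by
      obtain ⟨w, hw, hw1, hw2, hw3, hw4⟩ := hΩ ([v] :: Ω₁) c Ω₂ (by rw [h]; rfl)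
      refine ⟨w, hw, hw1, hw2, hw3, fun u hu => ?_⟩
      rcases hw4 u hu with h | h
      · exact Or.inl (Or.inr h)
      · rw [List.flatten_cons, List.singleton_append, List.mem_cons] at h
        exact h.elim (fun h => Or.inl (Or.inl h)) Or.inr
    refine ⟨Sp, fun fuel hf => ?_, ?_, h6⟩
    · rw [List.foldlM_cons, h3 fuel hf]
      exact h4 fuel hf
    · convert h5 using 1
      ext u
      simp [or_left_comm, or_assoc]

/-- The components after the one of the `φ` vertex. -/
theorem Posts.process_after (hP : Posts L P n₀ f) {H : InvSubgraph sg}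
    {Ω : List (List (Node sg))} (h : Partly P post)
    (hΩ : ∀ c ∈ Ω, ∃ v, c = [v] ∧ v ≠ .phi ∧ ¬ Nontrivial H [v]) :
    ∃ Sp, (∀ fuel, n₀ ≤ fuel →
        Ω.foldlM (processScc gen L H T (f fuel) fuel) (S, post) = some Sp) ∧
      Sp.1 .phi = S .phi := by
  induction Ω generalizing S post with
  | nil => exact ⟨(S, post), fun _ _ => rfl, rfl⟩
  | cons c Ω ih =>
    obtain ⟨v, rfl, hv, hn⟩ := hΩ c List.mem_cons_self
    obtain ⟨post', h1, -, h3⟩ := hP.processScc_trivial (gen := gen) (T := T) H hn h S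
    obtain ⟨Sp, h4, h5⟩ := ih (S := sweep (rule L post' T) [v] S) h1 fun c hc =>
      hΩ c (List.mem_cons_of_mem _ hc)
    refine ⟨Sp, fun fuel hf => ?_, h5.trans (sweep_singleton_of_ne _ hv.symm _)⟩
    rw [List.foldlM_cons, h3 fuel hf]
    exact h4 fuel hf

theorem IsSchedule.pred_mem {H : InvSubgraph sg} {Ω : List (List (Node sg))} (h : IsSchedule H Ω)
    {Ω₁ Ω₂ : List (List (Node sg))} {c : List (Node sg)} (hΩ : Ω = Ω₁ ++ c :: Ω₂) {u v : Node sg}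
    (hv : v ∈ c) (hu : u ∈ H.V) (he : H.E u v) : u ∈ Ω₁.flatten ∨ u ∈ c := by
  have hu' := (h.cover u).mpr hu
  have htop := h.topological
  rw [hΩ, List.pairwise_append, List.pairwise_cons] at htop
  rw [hΩ, List.flatten_append, List.flatten_cons, List.mem_append, List.mem_append] at hu'
  rcases hu' with hu' | hu' | hu'
  · exact Or.inl hu'
  · exact Or.inr hu'
  · obtain ⟨d, hd, hud⟩ := List.mem_flatten.mp hu'
    exact absurd he (htop.2.1.1 d hd v hv u hud)

/-- A nontrivial component must start with a `φ` vertex, and there is only one. So every other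
component is a single vertex on no cycle. -/
theorem IsSchedule.singleton_of_phi_notMem {Ω : List (List (Node sg))}
    (h : IsSchedule (invSubgraph L e np T) Ω) {c : List (Node sg)} (hc : c ∈ Ω)
    (hphi : Node.phi ∉ c) :
    ∃ v, c = [v] ∧ v ≠ .phi ∧ ¬ Nontrivial (invSubgraph L e np T) [v] := by
  rcases c with _ | ⟨v, r⟩
  · exact absurd rfl (h.nonempty _ hc)
  · have hn : ¬ Nontrivial (invSubgraph L e np T) (v :: r) := fun hn => by
      have := nodeKind_eq_phi.mp (h.sweep v r hc hn).1
      exact hphi (this ▸ List.mem_cons_self)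
    have hr : r = [] := by
      rcases r with _ | ⟨w, r⟩
      · rfl
      · have hnd := (List.nodup_flatten.mp h.nodup).1 _ hc
        refine absurd ⟨v, List.mem_cons_self, Or.inl ⟨w, by simp, ?_⟩⟩ hn
        rintro rfl
        simp at hnd
    subst hr
    exact ⟨v, rfl, fun hv => hphi (by simp [hv]), hn⟩

theorem stmt_mem_iterNodes {i : ℕ} : (Node.stmt i : Node sg) ∈ iterNodes e np T ↔ i ∈ T := by
  constructor
  · rintro ((h | h | h) | ⟨j, hj, h⟩)
    · rcases h with ⟨_, h⟩ | ⟨_, h⟩ | ⟨_, h⟩ | ⟨_, _, h⟩ | ⟨_, _, h⟩ | h <;> cases h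
    · cases h
    · cases h
    · cases h
      exact hj
  · exact fun h => Or.inr ⟨i, h, rfl⟩

/-- The loop at `φ` makes its component nontrivial and splits the order into `Ω₁`, this component,
and `Ω₂`. `Ω₁` produces the summaries that do not depend on the array, the rounds do the work, and
`Ω₂` does not touch `φ`. -/
theorem Posts.process (hP : Posts L P n₀ f) (hgen : ∀ S, IsGeneralization L.iters S (gen S))
    {Ω : List (List (Node sg))} (hΩ : IsSchedule (invSubgraph L e np T) Ω) :
    ∃ n Sp, (∀ fuel, n ≤ fuel → Ω.foldlM
        (processScc gen L (invSubgraph L e np T) T (f fuel) fuel)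
        (inputSummary, fun _ => []) = some Sp) ∧
      IsApprox L.iters (arraySeq L) (Writes L P) L.iters (Sp.1 .phi).toArray := by
  classical
  set H := invSubgraph L e np T with hH
  have hV : ∀ {v}, v ∈ H.V ↔ v ∈ iterNodes e np T := Iff.rfl
  obtain ⟨c, hc, hphic⟩ := List.mem_flatten.mp ((hΩ.cover .phi).mpr (phi_mem_iterNodes e np T))
  have hnon : Nontrivial H c := ⟨.phi, hphic, Or.inr invSubgraph_edge_phi⟩
  obtain ⟨Ω₁, Ω₂, hsplit⟩ := List.mem_iff_append.mp hc
  obtain ⟨v, r, rfl⟩ : ∃ v r, c = v :: r := List.exists_cons_of_ne_nil (hΩ.nonempty c hc)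
  obtain ⟨hkind, ⟨-, -, -⟩, hr1, hr2⟩ := hΩ.sweep v r hc hnon
  obtain rfl : v = .phi := nodeKind_eq_phi.mp hkind
  have hnodup := hΩ.nodup
  rw [hsplit, List.flatten_append, List.flatten_cons, List.nodup_append, List.nodup_append] at hnodup
  obtain ⟨-, ⟨hndc, -, hd2⟩, hd1⟩ := hnodup
  have hmem : ∀ c ∈ Ω, ∀ v ∈ c, v ∈ iterNodes e np T := fun c hc v hv =>
    (hΩ.cover v).mp (List.mem_flatten.mpr ⟨c, hc, hv⟩)
  have hphi1 : ∀ d ∈ Ω₁, Node.phi ∉ d := fun d hd h =>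
    hd1 _ (List.mem_flatten.mpr ⟨d, hd, h⟩) _ (List.mem_append_left _ List.mem_cons_self) rfl
  have hphi2 : ∀ d ∈ Ω₂, Node.phi ∉ d := fun d hd h =>
    hd2 _ List.mem_cons_self _ (List.mem_flatten.mpr ⟨d, hd, h⟩) rfl
  obtain ⟨⟨S₁, post₁⟩, hf1, hS1, hp1⟩ := hP.process_before (e := e) (np := np) (gen := gen) (H := H)
    (T := T) (Ω := Ω₁) (g := ∅) (S := inputSummary) (post := fun _ => [])
    ⟨fun _ _ => rfl, excl_inputSummary, fun _ h => h.elim⟩ (fun _ => Or.inr rfl)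
    fun pre d suf hd => by
      have hdm : d ∈ Ω₁ := by simp [hd]
      have hdΩ : d ∈ Ω := by simp [hsplit, hdm]
      obtain ⟨v, rfl, hv, hn⟩ := hΩ.singleton_of_phi_notMem hdΩ (hphi1 d hdm)
      have hvV := hmem _ hdΩ v (by simp)
      refine ⟨v, rfl, hv, hn, fun i hi => stmt_mem_iterNodes.mp (hi ▸ hvV), fun u hu => Or.inr ?_⟩
      have hE : H.E u v := invSubgraph_edge hvV hu
      refine (hΩ.pred_mem (Ω₁ := pre) (c := [v]) (Ω₂ := suf ++ (.phi :: r) :: Ω₂)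
        (by rw [hsplit, hd]; simp) (by simp) hE.1 hE).resolve_right fun h => hn ?_
      obtain rfl := List.mem_singleton.mp h
      exact ⟨u, by simp, Or.inr hE⟩
  obtain ⟨post₂, hf2, hp2, hl2, hk2⟩ :=
    hP.lower ((Node.phi :: r).flatMap (callees L T)) (post := post₁) hp1
  -- All callees have been lifted by now: a call in `T` writes the array and so lies on a cycle
  -- through `φ`, and a call outside `T` belongs to the `callees` of `φ`.
  have hpost : post₂ = P := by
    funext i
    by_cases hcall : ∃ g c args, L.body[i]? = some ⟨g, .call c args⟩
    · obtain ⟨g, c, args, hs⟩ := hcall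
      apply hl2
      rw [List.mem_flatMap]
      by_cases hi : i ∈ T
      · have hcyc := writer_cycle (L := L) (e := e) (np := np) hi hs rfl
        exact ⟨.stmt i, (hΩ.scc _ hc .phi List.mem_cons_self (.stmt i)
          (stmt_mem_iterNodes.mpr hi)).mpr hcyc, by simp [callees]⟩
      · refine ⟨.phi, List.mem_cons_self, ?_⟩
        have := (List.getElem?_eq_some_iff.mp hs).1
        simp [callees, hi, this]
    · push Not at hcall
      rcases hp2 i with h | h
      · exact h
      · rw [h, hP.nil i hcall]
  subst hpost
  have hrdisj : Node.phi ∉ r := (List.nodup_cons.mp hndc).1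
  have hsweep := fun (S : Node sg → Summary sg) (A : Branches sg)
      (hS : Ready L post₂ T {u | u ∈ (∅ : Set (Node sg)) ∨ u ∈ Ω₁.flatten} S)
      (hA : A.Exclusive) => isUpdate_sweep (e := e) (np := np) hP.exclusive hP.ok hS
    (by
      rintro (h | h)
      · exact h.elim
      · obtain ⟨d, hd, h⟩ := List.mem_flatten.mp h
        exact hphi1 d hd h)
    (r := r)
    (by
      rintro u (h | h) hu
      · exact h.elim
      · exact hd1 u h u (List.mem_append_left _ (List.mem_cons_of_mem _ hu)) rfl)
    (by
      have hE : H.E .bound .phi := ⟨Or.inl (Or.inr (Or.inl rfl)), phi_mem_iterNodes _ _ _,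
        Or.inr ⟨rfl, Or.inr (Or.inl rfl)⟩⟩
      refine Or.inr ((hΩ.pred_mem hsplit List.mem_cons_self hE.1 hE).resolve_right fun h => ?_)
      have hreach := ((hΩ.scc _ hc .phi List.mem_cons_self .bound hE.1).mp h).1
      exact not_reach_bound hreach)
    (by
      have hE : H.E (reach L T L.body.length) .phi :=
        invSubgraph_edge (phi_mem_iterNodes _ _ _) (Or.inl (Or.inr rfl))
      rcases hΩ.pred_mem hsplit List.mem_cons_self hE.1 hE with h | h
      · exact Or.inr (Or.inl (Or.inr h))
      · rcases List.mem_cons.mp h with h | h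
        · exact Or.inl h
        · exact Or.inr (Or.inr h))
    (fun l₁ v l₂ hl => by
      have hvr : v ∈ r := by simp [hl]
      have hvV := hmem _ hc v (List.mem_cons_of_mem _ hvr)
      refine ⟨by rintro rfl; exact hrdisj hvr, fun i hi => stmt_mem_iterNodes.mp (hi ▸ hvV),
        fun u hu => ?_⟩
      have hE : H.E u v := invSubgraph_edge hvV hu
      rcases hΩ.pred_mem hsplit (List.mem_cons_of_mem _ hvr) hE.1 hE with h | h
      · exact Or.inr (Or.inl (Or.inr h))
      · rcases List.mem_cons.mp h with h | h
        · exact Or.inl h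
        · rw [hl, List.pairwise_append, List.pairwise_cons] at hr1
          rw [hl, List.mem_append, List.mem_cons] at h
          rcases h with h | rfl | h
          · exact Or.inr (Or.inr h)
          · exact absurd hE (hr2 u hvr)
          · exact absurd hE (hr1.2.1.1 u h)) hA
  have h0 : ∀ σ cs ps B, arraySeq L σ cs ps B 0 = B := fun _ _ _ _ => rfl
  obtain ⟨hr0, hu0⟩ := hsweep S₁ [] hS1 Branches.exclusive_nil
  obtain ⟨n, S₂, hrounds, -, happ⟩ := rounds_terminates (N := L.iters) (gen := gen) h0 hgen
    (R := rule L post₂ T) (v := .phi) (r := r) hsweep L.iters 1 _ (by omega) le_rfl hr0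
    (isApprox_one h0 hu0)
  obtain ⟨Sp, hf3, hSp⟩ := hP.process_after (gen := gen) (T := T) (H := H) (Ω := Ω₂) (S := S₂) hp2
    fun d hd => hΩ.singleton_of_phi_notMem (by simp [hsplit, hd]) (hphi2 d hd)
  -- The fuel must suffice both for the callees and for the rounds of this loop.
  refine ⟨max n₀ n, Sp, fun fuel hfuel => ?_, by rw [hSp]; exact happ⟩
  have hfn : n₀ ≤ fuel := (le_max_left _ _).trans hfuel
  rw [hsplit, List.foldlM_append, hf1 fuel hfn]
  have hstep : processScc gen L H T (f fuel) fuel (S₁, post₁) (.phi :: r) = some (S₂, post₂) := by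
    -- `extract` starts from the summary of `outIn`, which is the empty list used in `isApprox_one`.
    have hout : S₁ .outIn = .array [] := hS1.inputs .outIn trivial
    have hro := hrounds fuel ((le_max_right _ _).trans hfuel)
    rw [← hout] at hro
    simp only [processScc]
    rw [hf2 fuel hfn, Option.bind_some, extract, if_pos hnon]
    rw [hro]
    rfl
  change (processScc gen L H T (f fuel) fuel (S₁, post₁) (.phi :: r)).bind _ = _
  rw [hstep]
  exact hf3 fuel hfn

end Lift

/-! ### Soundness of the lifting algorithm -/

/-- Induction on the depth. The conclusion holds for all environments, so a callee is described for
arbitrary counters, scalars and initial arrays, which is what `PostOk` asks at a call. The schedule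
is required at all positions below `p` so that it passes to `p ++ [i]`. -/
theorem lift_sound (st : Strategy sg) (T : List ℕ → Finset ℕ)
    (hgen : ∀ N S, IsGeneralization N S (st.gen N S)) :
    ∀ (k : ℕ) (L : Nest sg k) (np : ℕ) (p : List ℕ),
      (∀ q Q, loopAt k L np q = some Q → IsSchedule
        (invSubgraph Q.loop (p ++ q).length Q.np (T (p ++ q))) (st.order (p ++ q))) →
      ∃ n P, (∀ fuel, n ≤ fuel → lift st T fuel k L np p = some P) ∧ P.Exclusive ∧
        ∀ η : Env sg, P.elem η = exec η.data k L η.outer η.params η.out η.pos := by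
  intro k
  induction k with
  | zero => exact fun L => Empty.elim L
  | succ k ih =>
    intro L' np p hsch
    let L : LoopOver sg (Nest sg k) := L'
    have hcallee : ∀ i, ∃ n P, P.Exclusive ∧ PostOk L P i ∧
        ((∀ g c args, L.body[i]? ≠ some ⟨g, .call c args⟩) → P = []) ∧
        ∀ fuel, n ≤ fuel → ∀ g c args, L.body[i]? = some ⟨g, .call c args⟩ →
          lift st T fuel k c args.length (p ++ [i]) = some P := by
      intro i
      by_cases hc : ∃ g c args, L.body[i]? = some ⟨g, .call c args⟩
      · obtain ⟨g, c, args, hs⟩ := hc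
        obtain ⟨n, P, h1, h2, h3⟩ := ih c args.length (p ++ [i]) fun q Q hq => by
          rw [List.append_assoc]
          refine hsch (i :: q) Q ?_
          simp only [loopAt]
          rw [show (LoopOver.body L')[i]? = _ from hs]
          exact hq
        refine ⟨n, P, h2, fun g' c' args' hs' η => ?_, fun h => absurd hs (h _ _ _),
          fun fuel hf g' c' args' hs' => ?_⟩
        all_goals
          rw [hs] at hs'
          cases hs'
        · exact h3 η
        · exact h1 fuel hf
      · push Not at hc
        exact ⟨0, [], Branches.exclusive_nil, fun g c args hs => absurd hs (hc g c args),
          fun _ => rfl, fun _ _ g c args hs => absurd hs (hc g c args)⟩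
    choose n P h1 h2 h3 h4 using hcallee
    -- The body is finite, so one bound serves all callees.
    have hP : Posts L P ((Finset.range L.body.length).sup n)
        (fun fuel c m i => lift st T fuel k c m (p ++ [i])) := by
      refine ⟨h1, h2, h3, fun fuel hf i g c args hs => h4 i fuel ?_ g c args hs⟩
      refine le_trans (Finset.le_sup (f := n) (Finset.mem_range.mpr ?_)) hf
      exact (List.getElem?_eq_some_iff.mp hs).1
    have hΩ := hsch [] ⟨k, L, np⟩ rfl
    rw [List.append_nil] at hΩ
    obtain ⟨m, Sp, h5, h6⟩ := hP.process (hgen L.iters) hΩ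
    refine ⟨m, _, fun fuel hf => ?_, h6.exclusive.substT (.lit L.iters), fun η => ?_⟩
    · rw [show lift st T fuel (k + 1) L' np p = _ from lift_succ st T fuel L np p]
      simp only at h5
      rw [h5 fuel hf]
      rfl
    · rw [Branches.elem_substT h6.exclusive]
      change Branches.elem _ (η.setT (L.iters : ℤ)) =
        arraySeq L η.data η.outer η.params η.out L.iters η.pos
      -- `IsApprox` says nothing about values at iteration `0`. Without iterations the postcondition
      -- is taken at `t = 0`, where no branch applies, so the array is the initial one.
      rcases Nat.eq_zero_or_pos L.iters with h | h
      · rw [Branches.elem_of_not_cov (h6.zero _ (by rw [h]; rfl)), h]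
        rfl
      · exact h6.elem (η.setT (L.iters : ℤ)) L.iters h le_rfl le_rfl rfl

theorem liftKernel_sound {K : ℕ} (L : Nest sg K) (T : List ℕ → Finset ℕ) (st : Strategy sg)
    (hst : st.IsValid L T) :
    ∃ S, (∃ n, ∀ fuel, n ≤ fuel → liftKernel L st T fuel = some S) ∧ IsSoundSummary L S := by
  obtain ⟨n, P, h1, h2, h3⟩ := lift_sound st T hst.1 K L sg.nums [] fun q Q hq => by
    have hq' : loopOf L q = some Q := hq
    have := hst.2 q (by rw [hq']; rfl)
    simp only [invGraph, invSub, hq'] at this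
    exact this
  exact ⟨P, ⟨n, h1⟩, h2, fun inp t x => h3 _⟩

/-! ### Existence of admissible choices -/

theorem finite_inputNodes (e np : ℕ) : (inputNodes e np : Set (Node sg)).Finite := by
  have h : (inputNodes e np : Set (Node sg)) = Set.range .arrayIn ∪ (Set.range .indexIn ∪
      (Set.range .condIn ∪ (.param '' Set.Iio np ∪ (.outer '' Set.Iio e ∪ {.outIn})))) := by
    ext v
    simp only [inputNodes, Set.mem_ofPred_eq, Set.mem_union, Set.mem_range, Set.mem_image,
      Set.mem_Iio, Set.mem_singleton_iff, eq_comm]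
  rw [h]
  refine (Set.finite_range _).union ((Set.finite_range _).union ((Set.finite_range _).union
    (((Set.finite_Iio _).image _).union (((Set.finite_Iio _).image _).union
      (Set.finite_singleton _)))))

theorem finite_iterNodes (e np : ℕ) (T : Finset ℕ) :
    (iterNodes e np T : Set (Node sg)).Finite := by
  refine ((finite_inputNodes e np).union ((Set.finite_singleton _).insert _)).union ?_
  refine (T.finite_toSet.image Node.stmt).subset ?_
  rintro v ⟨i, hi, rfl⟩
  exact ⟨i, hi, rfl⟩

section Order

variable {k : ℕ} {L : LoopOver sg (Nest sg k)} {T : Finset ℕ} {e np : ℕ}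

theorem isInput_of_mem {v : Node sg} (h : v ∈ inputNodes e np) : v.IsInput := by
  rcases h with ⟨_, rfl⟩ | ⟨_, rfl⟩ | ⟨_, rfl⟩ | ⟨_, _, rfl⟩ | ⟨_, _, rfl⟩ | rfl <;> trivial

theorem not_edge_input {u v : Node sg} (hv : v.IsInput) : ¬ (invSubgraph L e np T).E u v := by
  rintro ⟨-, -, h | ⟨rfl, -⟩⟩
  · cases v <;> first | exact hv.elim | exact h.elim
  · exact hv.elim

/-- A numbering of the vertices that increases along all edges outside the `φ` vertex. -/
def Node.rank : Node sg → ℕ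
  | .bound => 1
  | .stmt i => i + 2
  | _ => 0

theorem rank_lt {u v : Node sg} (h : (invSubgraph L e np T).E u v) (hu : u ≠ .phi)
    (hv : v ≠ .phi) : u.rank < v.rank := by
  cases v with
  | phi => exact absurd rfl hv
  | bound =>
    have := isInput_of_edge_bound h
    cases u <;> first | exact this.elim | exact Nat.one_pos
  | stmt i =>
    cases u with
    | stmt j =>
      obtain ⟨-, -, h | ⟨h, -⟩⟩ := h
      · have := (stmt_mem_nodePreds h).2
        simp only [Node.rank]
        omega
      · cases h
    | _ => simp [Node.rank]
  | _ => exact absurd h (not_edge_input trivial)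

/-- A walk passes through `φ` or increases the rank at each step. Hence two different vertices can
reach each other only through `φ`, which is `eq_of_mutual`. -/
theorem reach_rank {u v : Node sg}
    (h : Relation.ReflTransGen (invSubgraph L e np T).E u v) :
    (Relation.ReflTransGen (invSubgraph L e np T).E u .phi ∧
      Relation.ReflTransGen (invSubgraph L e np T).E .phi v) ∨ u.rank < v.rank ∨ u = v := by
  induction h with
  | refl => exact Or.inr (Or.inr rfl)
  | @tail w v h hE ih =>
    by_cases hw : w = .phi
    · subst hw
      exact Or.inl ⟨h, .single hE⟩
    by_cases hv : v = .phi
    · subst hv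
      exact Or.inl ⟨h.tail hE, .refl⟩
    have hlt := rank_lt hE hw hv
    rcases ih with ih | ih | rfl
    · exact Or.inl ⟨ih.1, ih.2.tail hE⟩
    · exact Or.inr (Or.inl (ih.trans hlt))
    · exact Or.inr (Or.inl hlt)

/-- The vertex is strongly connected to the `φ` vertex. -/
def OnPhi (L : LoopOver sg (Nest sg k)) (e np : ℕ) (T : Finset ℕ) (u : Node sg) : Prop :=
  Relation.ReflTransGen (invSubgraph L e np T).E .phi u ∧
    Relation.ReflTransGen (invSubgraph L e np T).E u .phi

theorem eq_of_mutual {u v : Node sg} (hu : ¬ OnPhi L e np T u)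
    (h : Relation.ReflTransGen (invSubgraph L e np T).E u v)
    (h' : Relation.ReflTransGen (invSubgraph L e np T).E v u) : v = u := by
  rcases reach_rank h with h1 | h1 | h1
  · exact absurd ⟨h1.2.trans h', h1.1⟩ hu
  · rcases reach_rank h' with h2 | h2 | h2
    · exact absurd ⟨h2.2, h.trans h2.1⟩ hu
    · omega
    · exact h2
  · exact h1.symm

theorem not_onPhi_input {u : Node sg} (hu : u.IsInput) : ¬ OnPhi L e np T u := fun h => by
  have := reach_input_eq hu h.1
  subst this
  exact hu

theorem not_onPhi_bound : ¬ OnPhi L e np T .bound := fun h => not_reach_bound h.1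

open Classical in
/-- The statements in `T` with a property, in their order. -/
noncomputable def stmtsWith (T : Finset ℕ) (p : Node sg → Prop) : List (Node sg) :=
  ((List.range (T.sup id + 1)).filter fun i => i ∈ T ∧ p (.stmt i)).map .stmt

theorem mem_stmtsWith {p : Node sg → Prop} {u : Node sg} :
    u ∈ stmtsWith T p ↔ (∃ i ∈ T, u = .stmt i) ∧ p u := by
  simp only [stmtsWith, List.mem_map, List.mem_filter, List.mem_range, decide_eq_true_eq]
  constructor
  · rintro ⟨i, ⟨-, hi, hp⟩, rfl⟩
    exact ⟨⟨i, hi, rfl⟩, hp⟩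
  · rintro ⟨⟨i, hi, rfl⟩, hp⟩
    exact ⟨i, ⟨Nat.lt_succ_iff.mpr (Finset.le_sup (f := id) hi), hi, hp⟩, rfl⟩

theorem pairwise_stmtsWith (p : Node sg → Prop) :
    (stmtsWith T p).Pairwise fun u v => u ≠ v ∧ ¬ (invSubgraph L e np T).E v u := by
  refine List.pairwise_map.mpr ((List.pairwise_lt_range.filter _).imp ?_)
  intro i j hij
  refine ⟨fun h => ?_, fun h => ?_⟩
  · cases h
    exact lt_irrefl _ hij
  · have := rank_lt h (by simp) (by simp)
    simp only [Node.rank] at this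
    omega

/-- The order is: inputs, counter, statements that `φ` does not reach, the component of `φ`,
statements that `φ` reaches but that do not lead back. Within each group of statements program order
is enough, since edges between statements go to higher numbers. -/
theorem exists_isSchedule (L : LoopOver sg (Nest sg k)) (e np : ℕ) (T : Finset ℕ) :
    ∃ Ω, IsSchedule (invSubgraph L e np T) Ω := by
  set E := (invSubgraph L e np T).E
  let I : List (Node sg) := (finite_inputNodes e np).toFinset.toList
  let A : List (Node sg) := stmtsWith T fun u => ¬ Relation.ReflTransGen E .phi u
  let M : List (Node sg) := stmtsWith T (OnPhi L e np T)
  let C : List (Node sg) := stmtsWith T fun u =>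
    Relation.ReflTransGen E .phi u ∧ ¬ Relation.ReflTransGen E u .phi
  have hI : ∀ {u}, u ∈ I ↔ u ∈ inputNodes e np := by simp [I]
  have hA : ∀ {u}, u ∈ A ↔ (∃ i ∈ T, u = .stmt i) ∧ ¬ Relation.ReflTransGen E .phi u :=
    mem_stmtsWith
  have hM : ∀ {u}, u ∈ M ↔ (∃ i ∈ T, u = .stmt i) ∧ OnPhi L e np T u := mem_stmtsWith
  have hC : ∀ {u}, u ∈ C ↔ (∃ i ∈ T, u = .stmt i) ∧ Relation.ReflTransGen E .phi u ∧
    ¬ Relation.ReflTransGen E u .phi := mem_stmtsWith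
  have hphiM : ∀ {u}, u ∈ Node.phi :: M ↔ u ∈ iterNodes e np T ∧ OnPhi L e np T u := by
    intro u
    rw [List.mem_cons, hM]
    constructor
    · rintro (rfl | ⟨⟨i, hi, rfl⟩, h⟩)
      · exact ⟨phi_mem_iterNodes _ _ _, .refl, .refl⟩
      · exact ⟨stmt_mem_iterNodes.mpr hi, h⟩
    · rintro ⟨(h | rfl | rfl) | h, h'⟩
      · exact absurd h' (not_onPhi_input (isInput_of_mem h))
      · exact absurd h' not_onPhi_bound
      · exact Or.inl rfl
      · exact Or.inr ⟨h, h'⟩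
  -- The vertices before the component of the `φ` vertex.
  let X : List (Node sg) := I ++ .bound :: A
  have hXmem : ∀ {u}, u ∈ X ↔ u ∈ inputNodes e np ∨ u = .bound ∨ u ∈ A := by
    intro u
    rw [List.mem_append, List.mem_cons, hI]
  have hXphi : ∀ u ∈ X, ¬ Relation.ReflTransGen E .phi u := by
    intro u hu h
    rcases hXmem.mp hu with hu | rfl | hu
    · have := reach_input_eq (isInput_of_mem hu) h
      subst this
      exact isInput_of_mem hu
    · exact not_reach_bound h
    · exact (hA.mp hu).2 h
  have hXpair : X.Pairwise fun u v => u ≠ v ∧ ¬ E v u := by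
    refine List.pairwise_append.mpr ⟨?_, List.pairwise_cons.mpr ⟨fun v hv => ?_,
      pairwise_stmtsWith _⟩, fun u hu v hv => ?_⟩
    · exact (Finset.nodup_toList _).imp_of_mem fun hu _ hne =>
        ⟨hne, not_edge_input (isInput_of_mem (hI.mp hu))⟩
    · obtain ⟨⟨i, -, rfl⟩, -⟩ := hA.mp hv
      exact ⟨by simp, fun h => isInput_of_edge_bound h⟩
    · refine ⟨?_, not_edge_input (isInput_of_mem (hI.mp hu))⟩
      rintro rfl
      rcases List.mem_cons.mp hv with rfl | hv
      · exact isInput_of_mem (hI.mp hu)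
      · obtain ⟨⟨i, -, rfl⟩, -⟩ := hA.mp hv
        exact isInput_of_mem (hI.mp hu)
  have hXC : ∀ u, u ∈ X ∨ u ∈ C → u ≠ .phi ∧ ¬ OnPhi L e np T u := by
    rintro u (h | h)
    · exact ⟨by rintro rfl; exact hXphi _ h .refl, fun h' => hXphi u h h'.1⟩
    · obtain ⟨⟨i, -, rfl⟩, -, h2⟩ := hC.mp h
      exact ⟨by simp, fun h' => h2 h'.2⟩
  let Ω : List (List (Node sg)) := X.map (fun u => [u]) ++ (.phi :: M) :: C.map fun u => [u]
  have hΩ : ∀ {c}, c ∈ Ω ↔ (∃ u, (u ∈ X ∨ u ∈ C) ∧ c = [u]) ∨ c = .phi :: M := by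
    intro c
    simp only [Ω, List.mem_append, List.mem_map, List.mem_cons]
    constructor
    · rintro (⟨u, hu, rfl⟩ | rfl | ⟨u, hu, rfl⟩)
      · exact Or.inl ⟨u, Or.inl hu, rfl⟩
      · exact Or.inr rfl
      · exact Or.inl ⟨u, Or.inr hu, rfl⟩
    · rintro (⟨u, hu | hu, rfl⟩ | rfl)
      · exact Or.inl ⟨u, hu, rfl⟩
      · exact Or.inr (Or.inr ⟨u, hu, rfl⟩)
      · exact Or.inr (Or.inl rfl)
  have hflat : Ω.flatten = X ++ (.phi :: M ++ C) := by
    simp [Ω, ← List.flatMap_def]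
  have hself : ∀ u, u ≠ .phi → ¬ E u u := fun u hu h => lt_irrefl _ (rank_lt h hu hu)
  refine ⟨Ω, ?_, ?_, fun v => ?_, fun c hc u hu v hv => ?_, ?_, fun v r hc hn => ?_⟩
  · rw [hflat]
    refine List.nodup_append.mpr ⟨hXpair.imp And.left, List.nodup_append.mpr
      ⟨List.nodup_cons.mpr ⟨fun h => ?_, (pairwise_stmtsWith (L := L) (e := e) (np := np)
        _).imp And.left⟩, (pairwise_stmtsWith (L := L) (e := e) (np := np) _).imp And.left, ?_⟩, ?_⟩
    · obtain ⟨⟨i, -, h⟩, -⟩ := hM.mp h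
      cases h
    · rintro u hu v hv rfl
      exact (hXC u (Or.inr hv)).2 (hphiM.mp hu).2
    · rintro u hu v hv rfl
      rcases List.mem_append.mp hv with hv | hv
      · exact (hXC u (Or.inl hu)).2 (hphiM.mp hv).2
      · exact hXphi u hu (hC.mp hv).2.1
  · intro c hc
    rcases hΩ.mp hc with ⟨u, -, rfl⟩ | rfl <;> exact List.cons_ne_nil _ _
  · rw [hflat, show v ∈ X ++ (.phi :: M ++ C) ↔ v ∈ X ∨ v ∈ Node.phi :: M ∨ v ∈ C from
      List.mem_append.trans (or_congr_right List.mem_append), hXmem, hphiM, hA, hC]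
    constructor
    · rintro ((h | rfl | ⟨h, -⟩) | ⟨h, -⟩ | ⟨h, -⟩)
      · exact Or.inl (Or.inl h)
      · exact Or.inl (Or.inr (Or.inl rfl))
      · exact Or.inr h
      · exact h
      · exact Or.inr h
    · intro h
      by_cases hon : OnPhi L e np T v
      · exact Or.inr (Or.inl ⟨h, hon⟩)
      · rcases h with (h | rfl | rfl) | h
        · exact Or.inl (Or.inl h)
        · exact Or.inl (Or.inr (Or.inl rfl))
        · exact absurd ⟨.refl, .refl⟩ hon
        · by_cases hp : Relation.ReflTransGen E .phi v
          · exact Or.inr (Or.inr ⟨h, hp, fun h' => hon ⟨hp, h'⟩⟩)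
          · exact Or.inl (Or.inr (Or.inr ⟨h, hp⟩))
  · rcases hΩ.mp hc with ⟨w, hw, rfl⟩ | rfl
    · obtain rfl := List.mem_singleton.mp hu
      rw [List.mem_singleton]
      refine ⟨?_, fun h => eq_of_mutual (hXC _ hw).2 h.1 h.2⟩
      rintro rfl
      exact ⟨.refl, .refl⟩
    · have hu' := (hphiM.mp hu).2
      rw [hphiM]
      exact ⟨fun h => ⟨hu'.2.trans h.2.1, h.2.2.trans hu'.1⟩,
        fun h => ⟨hv, hu'.1.trans h.1, h.2.trans hu'.2⟩⟩
  · refine List.pairwise_append.mpr ⟨List.pairwise_map.mpr (hXpair.imp ?_),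
      List.pairwise_cons.mpr ⟨fun d hd => ?_, List.pairwise_map.mpr
        ((pairwise_stmtsWith (L := L) (e := e) (np := np) _).imp ?_)⟩, fun c hc d hd => ?_⟩
    · rintro u v h u' hu' v' hv'
      obtain rfl := List.mem_singleton.mp hu'
      obtain rfl := List.mem_singleton.mp hv'
      exact h.2
    · obtain ⟨w, hw, rfl⟩ := List.mem_map.mp hd
      intro u hu v hv h
      obtain rfl := List.mem_singleton.mp hv
      -- An edge from this later statement into the component would give it a walk back to `φ`.
      exact (hC.mp hw).2.2 (.head h (hphiM.mp hu).2.2)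
    · rintro u v h u' hu' v' hv'
      obtain rfl := List.mem_singleton.mp hu'
      obtain rfl := List.mem_singleton.mp hv'
      exact h.2
    · obtain ⟨w, hw, rfl⟩ := List.mem_map.mp hc
      intro u hu v hv h
      obtain rfl := List.mem_singleton.mp hu
      -- An edge from the component or from a later statement would make `u` reachable from `φ`.
      refine hXphi u hw (.tail ?_ h)
      rcases List.mem_cons.mp hd with rfl | hd
      · exact (hphiM.mp hv).2.1
      · obtain ⟨w, hw, rfl⟩ := List.mem_map.mp hd
        obtain rfl := List.mem_singleton.mp hv
        exact (hC.mp hw).2.1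
  · rcases hΩ.mp hc with ⟨w, hw, hvr⟩ | hvr
    · rw [List.cons.injEq] at hvr
      obtain ⟨rfl, rfl⟩ := hvr
      exfalso
      obtain ⟨x, hx, ⟨y, hy, hxy⟩ | h⟩ := hn
      · exact hxy ((List.mem_singleton.mp hy).trans (List.mem_singleton.mp hx).symm)
      · obtain rfl := List.mem_singleton.mp hx
        exact hself _ (hXC _ hw).1 h
    · rw [List.cons.injEq] at hvr
      obtain ⟨rfl, rfl⟩ := hvr
      have hout : (Node.outIn : Node sg) ∈ inputNodes e np :=
        Or.inr (Or.inr (Or.inr (Or.inr (Or.inr rfl))))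
      refine ⟨rfl, ⟨.outIn, fun h => not_onPhi_input (u := .outIn) trivial (hphiM.mp h).2,
        inputNodes_subset _ _ _ hout, phi_mem_iterNodes _ _ _,
        Or.inr ⟨rfl, Or.inr (Or.inr hout)⟩⟩, (pairwise_stmtsWith _).imp And.right, fun a ha => ?_⟩
      obtain ⟨⟨i, -, rfl⟩, -⟩ := hM.mp ha
      exact hself _ (by simp)

end Order

theorem exists_isValid {K : ℕ} (L : Nest sg K) (T : List ℕ → Finset ℕ) :
    ∃ st : Strategy sg, st.IsValid L T := by
  obtain ⟨gen, hgen⟩ := exists_isGeneralization (sg := sg)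
  have h : ∀ p, ∃ Ω, (loopOf L p).isSome = true → IsSchedule ((invGraph L T).sub p) Ω := by
    intro p
    rcases hp : loopOf L p with _ | Q
    · exact ⟨[], fun h => Bool.noConfusion h⟩
    · obtain ⟨Ω, hΩ⟩ := exists_isSchedule Q.loop p.length Q.np (T p)
      refine ⟨Ω, fun _ => ?_⟩
      simp only [invGraph, invSub, hp]
      exact hΩ
  choose order horder using h
  exact ⟨⟨gen, order⟩, hgen, horder⟩

/-! ### Frames -/

theorem frameAt_spec {σ : Data sg} : ∀ {k : ℕ} {L : Nest sg k} {cs : List ℤ} {ps : List ℝ}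
    {B : Arr sg} {loc : List (ℕ × ℕ)} {F : Frame sg}, frameAt σ k L cs ps B loc = some F →
    loc.length < k ∧ F.cs.length = cs.length + loc.length ∧
      loopAt k L ps.length (loc.map Prod.snd) = some ⟨F.k, F.loop, F.ps.length⟩ := by
  intro k
  induction k with
  | zero => exact fun {L} => Empty.elim L
  | succ k ih =>
    intro L cs ps B loc F h
    rcases loc with _ | ⟨⟨n, i⟩, loc⟩
    · simp only [frameAt, Option.some.injEq] at h
      subst h
      exact ⟨Nat.succ_pos _, rfl, rfl⟩
    · simp only [frameAt] at h
      simp only [List.map_cons, loopAt]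
      split at h
      · split_ifs at h
        obtain ⟨h1, h2, h3⟩ := ih h
        rw [List.length_map] at h3
        refine ⟨Nat.succ_lt_succ h1, h2.trans ?_, h3⟩
        simp only [List.length_cons]
        omega
      · exact absurd h (by simp)

/-- It expresses the counters, scalars and array of an invocation through the state of the calling
iteration, which is what the edges from actual arguments to formal inputs have to respect. -/
theorem frameAt_append {σ : Data sg} (n i : ℕ) : ∀ {k : ℕ} {L : Nest sg k} {cs : List ℤ}
    {ps : List ℝ} {B : Arr sg} {loc : List (ℕ × ℕ)} {F F' : Frame sg},
    frameAt σ k L cs ps B loc = some F → frameAt σ k L cs ps B (loc ++ [(n, i)]) = some F' →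
    ∃ g c args, F.loop.body[i]? = some ⟨g, .call c args⟩ ∧ 1 ≤ n ∧
      F'.cs = F.loop.counter σ F.cs n :: F.cs ∧
      F'.ps = args.map (fun x => x.eval F.ps (bodyState (exec σ F.k) σ F.loop
        (F.loop.counter σ F.cs n :: F.cs) F.ps
        (loopState (exec σ F.k) σ F.loop F.cs F.ps F.arr (n - 1)) i).temps) ∧
      F'.arr = (bodyState (exec σ F.k) σ F.loop (F.loop.counter σ F.cs n :: F.cs) F.ps
        (loopState (exec σ F.k) σ F.loop F.cs F.ps F.arr (n - 1)) i).arr := by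
  intro k
  induction k with
  | zero => exact fun {L} => Empty.elim L
  | succ k ih =>
    intro L cs ps B loc F F' h h'
    rcases loc with _ | ⟨⟨m, j⟩, loc⟩
    · simp only [frameAt, Option.some.injEq] at h
      subst h
      simp only [List.nil_append, frameAt] at h'
      split at h'
      · rename_i g c args hs
        split_ifs at h' with hc
        rcases k with _ | k
        · exact Empty.elim c
        · simp only [frameAt, Option.some.injEq] at h'
          subst h'
          exact ⟨g, c, args, hs, hc.1, rfl, rfl, rfl⟩
      · exact absurd h' (by simp)
    · simp only [List.cons_append, frameAt] at h h'
      split at h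
      · rename_i g c args hs
        rw [hs] at h'
        simp only at h'
        split_ifs at h with hc
        rw [if_pos hc] at h'
        exact ih h h'
      · exact absurd h (by simp)

/-- A location has length below `k`, and each of its entries chooses one of finitely many iterations
and statements. -/
theorem finite_frameAt (σ : Data sg) : ∀ (k : ℕ) (L : Nest sg k) (cs : List ℤ) (ps : List ℝ)
    (B : Arr sg), {loc | (frameAt σ k L cs ps B loc).isSome = true}.Finite := by
  intro k
  induction k with
  | zero => exact fun L => Empty.elim L
  | succ k ih =>
    intro L cs ps B
    have hfin : ∀ n i, {loc | (frameAt σ (k + 1) L cs ps B ((n, i) :: loc)).isSome = true}.Finite := by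
      intro n i
      simp only [frameAt]
      split
      · split_ifs
        · exact ih _ _ _ _
        · simp
      · simp
    refine ((Set.finite_singleton []).union ((Set.finite_Iic (LoopOver.iters L)).biUnion fun n _ =>
      (Set.finite_Iio (LoopOver.body L).length).biUnion fun i _ =>
        (hfin n i).image (List.cons (n, i)))).subset ?_
    intro loc h
    rcases loc with _ | ⟨⟨n, i⟩, loc⟩
    · exact Or.inl rfl
    · refine Or.inr ?_
      have h' := h
      simp only [Set.mem_ofPred_eq, frameAt] at h'
      split at h'
      · rename_i hs
        split_ifs at h' with hc
        · exact Set.mem_biUnion (x := n) hc.2.1 (Set.mem_biUnion (x := i)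
            (List.getElem?_eq_some_iff.mp hs).1 ⟨loc, h, rfl⟩)
        · exact absurd h' (by simp)
      · exact absurd h' (by simp)

section Kernel

variable {K : ℕ} {L : Nest sg K} {inp : Input sg} {loc : List (ℕ × ℕ)} {F : Frame sg}

theorem frame_spec (h : frame L inp loc = some F) : loc.length < K ∧ F.cs.length = loc.length ∧
    loopOf L (loc.map Prod.snd) = some ⟨F.k, F.loop, F.ps.length⟩ := by
  obtain ⟨h1, h2, h3⟩ := frameAt_spec h
  refine ⟨h1, by simpa using h2, ?_⟩
  rw [loopOf, ← h3, Input.nums, List.length_ofFn]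

theorem executedAt_eq (h : frame L inp loc = some F) (n : ℕ) : executedAt L inp loc n =
    F.loop.executed inp.data (F.loop.counter inp.data F.cs n :: F.cs) := by
  simp only [executedAt, h]

theorem finite_invocations (L : Nest sg K) (inp : Input sg) (p : List ℕ) :
    (invocations L inp p).Finite :=
  (finite_frameAt inp.data K L [] inp.nums inp.out).subset fun _ h => h.2

end Kernel

/-! ### Values of variable instances -/

/-- The value of the vertex `v` in iteration `n` of an invocation. -/
noncomputable def frameVal (σ : Data sg) (F : Frame sg) (n : ℕ) (v : Node sg) : Value sg :=
  match v with
  | .arrayIn a => .inArr (σ.arr a)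
  | .indexIn p => .idx (σ.idx p)
  | .condIn b => .bool (σ.cond b)
  | .param s => .num (F.ps.getD s 0)
  | .outer j => .idx (F.cs.getD j 0)
  | .outIn => .arr F.arr
  | .bound => .idx (F.loop.counter σ F.cs n)
  | .stmt i =>
    let st := bodyState (exec σ F.k) σ F.loop (F.loop.counter σ F.cs n :: F.cs) F.ps
      (loopState (exec σ F.k) σ F.loop F.cs F.ps F.arr (n - 1)) (i + 1)
    match F.loop.body[i]? with
    | some s => if s.op.writes = true then .arr st.arr else .num (st.temps i)
    | none => .num 0
  | .phi => .arr (loopState (exec σ F.k) σ F.loop F.cs F.ps F.arr n)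

theorem vertexData_eq {K : ℕ} {L : Nest sg K} {inp : Input sg} {v : Vertex sg} {F : Frame sg}
    (h : frame L inp v.loc = some F) : vertexData L inp v = frameVal inp.data F v.iter v.node := by
  simp only [vertexData, h]
  rfl

theorem sliceVals_vertexData {K : ℕ} {L : Nest sg K} {inp : Input sg} {loc : List (ℕ × ℕ)}
    {F : Frame sg} (h : frame L inp loc = some F) (n : ℕ) :
    sliceVals (vertexData L inp) loc n = fun u => frameVal inp.data F (srcIter u n) u := by
  funext u
  exact vertexData_eq (v := ⟨loc, srcIter u n, u⟩) h

section Values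

variable (σ : Data sg) (F : Frame sg) (n : ℕ)

/-- The values seen in an iteration. -/
noncomputable def frameSlice (u : Node sg) : Value sg := frameVal σ F (srcIter u n) u

theorem dataOf_frameSlice : dataOf (frameSlice σ F n) = σ := rfl

theorem ofFn_getD {α : Type*} (l : List α) (a : α) :
    List.ofFn (fun j : Fin l.length => l.getD j a) = l := by
  refine List.ext_getElem (by simp) fun i h1 h2 => ?_
  simp

theorem outersOf_frameSlice : outersOf F.cs.length (frameSlice σ F n) = F.cs := ofFn_getD F.cs 0

theorem paramsOf_frameSlice : paramsOf F.ps.length (frameSlice σ F n) = F.ps := ofFn_getD F.ps 0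

variable {σ F n}

theorem frameVal_stmt {i : ℕ} {s : Stmt sg (Nest sg F.k)} (hs : F.loop.body[i]? = some s) :
    frameVal σ F n (.stmt i) =
      let st := bodyState (exec σ F.k) σ F.loop (F.loop.counter σ F.cs n :: F.cs) F.ps
        (loopState (exec σ F.k) σ F.loop F.cs F.ps F.arr (n - 1)) (i + 1)
      if s.op.writes = true then .arr st.arr else .num (st.temps i) := by
  simp only [frameVal, hs]

/-- The array before statement `i` is the one after its last executed writer. If there is none, it
is the array at the start of the iteration, and `srcIter` reads `φ` in iteration `n - 1` for this
purpose. -/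
theorem frameSlice_reach {T : Finset ℕ}
    (hT : F.loop.executed σ (F.loop.counter σ F.cs n :: F.cs) = T) (i : ℕ) :
    frameSlice σ F n (reach F.loop T i) = .arr (bodyState (exec σ F.k) σ F.loop
      (F.loop.counter σ F.cs n :: F.cs) F.ps
      (loopState (exec σ F.k) σ F.loop F.cs F.ps F.arr (n - 1)) i).arr := by
  subst hT
  rw [bodyState_eq_pathState]
  rcases reach_cases (L := F.loop) (T := F.loop.executed σ (F.loop.counter σ F.cs n :: F.cs))
    (fun i => (pathState (exec σ F.k) σ F.loop (F.loop.counter σ F.cs n :: F.cs) F.ps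
      (loopState (exec σ F.k) σ F.loop F.cs F.ps F.arr (n - 1))
      (F.loop.executed σ (F.loop.counter σ F.cs n :: F.cs)) i).arr)
    (fun i hi => pathState_arr_succ hi) i with ⟨h1, h2⟩ | ⟨j, -, -, s, hs, hw, h1, h2⟩
  · rw [h1, h2]
    rfl
  · rw [h1, h2, frameSlice]
    change frameVal σ F n (.stmt j) = _
    rw [frameVal_stmt hs, bodyState_eq_pathState]
    exact if_pos hw

theorem operandVal_frameSlice {T : Finset ℕ}
    (hT : F.loop.executed σ (F.loop.counter σ F.cs n :: F.cs) = T) (i : ℕ) (x : Operand) :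
    operandVal F.loop F.ps.length T i (frameSlice σ F n) x =
      x.eval F.ps (bodyState (exec σ F.k) σ F.loop (F.loop.counter σ F.cs n :: F.cs) F.ps
        (loopState (exec σ F.k) σ F.loop F.cs F.ps F.arr (n - 1)) i).temps := by
  subst hT
  cases x with
  | lit r => rfl
  | param s =>
    rw [operandVal, Operand.eval]
    split_ifs with h
    · rfl
    · rw [List.getD_eq_default _ _ (not_lt.mp h)]
  | temp j =>
    rw [operandVal, Operand.eval, bodyState_eq_pathState, pathState_temps]
    split_ifs with h
    · obtain ⟨-, -, s, hs, hw⟩ := readable_iff.mp h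
      change (frameVal σ F n (.stmt j)).toNum = _
      rw [frameVal_stmt hs, bodyState_eq_pathState]
      simp [hw, Value.toNum]
    · rfl

theorem nodeVal_frameSlice {T : Finset ℕ}
    (hT : F.loop.executed σ (F.loop.counter σ F.cs n :: F.cs) = T) {v : Node sg}
    (hv : ∀ i, v = .stmt i → i ∈ T) :
    nodeVal F.loop F.cs.length F.ps.length T n v (frameSlice σ F n) = frameVal σ F n v := by
  cases v with
  | bound => simp only [nodeVal, dataOf_frameSlice, outersOf_frameSlice, frameVal]
  | phi =>
    simp only [nodeVal]
    split_ifs with h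
    · subst h
      rfl
    · obtain ⟨m, rfl⟩ : ∃ m, n = m + 1 := ⟨n - 1, by omega⟩
      rw [frameSlice_reach hT]
      rfl
  | stmt i =>
    have hi := hv i rfl
    obtain ⟨s, hs, -⟩ := (LoopOver.mem_executed σ).mp (hT ▸ hi)
    have hsucc := pathState_succ (run := exec σ F.k) (σ := σ) (B := loopState (exec σ F.k) σ F.loop
      F.cs F.ps F.arr (n - 1)) (cs := F.loop.counter σ F.cs n :: F.cs) (ps := F.ps) hs hi
    rw [← hT, ← bodyState_eq_pathState, ← bodyState_eq_pathState] at hsucc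
    rw [frameVal_stmt hs]
    simp only [nodeVal, hs, operandVal_frameSlice hT, frameSlice_reach hT, dataOf_frameSlice,
      outersOf_frameSlice, hsucc]
    obtain ⟨g, op⟩ := s
    cases op <;> simp [Op.writes, execOp, Value.toArr, frameSlice, srcIter, frameVal, Value.toInArr,
      Value.toIdx]
  | _ => rfl

/-- In an iteration with executed set `T` this is `frameSlice_reach`; in any other one the function
is by definition the body run from the array before. Nothing is asked of `T`. -/
theorem extPhiVal_frameSlice (T : Finset ℕ) :
    extPhiVal F.loop F.cs.length F.ps.length T n (frameSlice σ F n) = frameVal σ F n .phi := by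
  simp only [extPhiVal, dataOf_frameSlice, outersOf_frameSlice, paramsOf_frameSlice]
  split_ifs with h h'
  · subst h
    rfl
  all_goals obtain ⟨m, rfl⟩ : ∃ m, n = m + 1 := ⟨n - 1, by omega⟩
  · rw [frameSlice_reach (n := m + 1) h']
    rfl
  · rfl

end Values

/-! ### Operations depend on predecessors only -/

section Congr

variable {C : Type} {L : LoopOver sg C} {e np n i : ℕ} {T : Finset ℕ}
  {vals vals' : Node sg → Value sg}

theorem getD_outersOf (e : ℕ) (vals : Node sg → Value sg) (j : ℕ) :
    (outersOf e vals).getD j 0 = if j < e then (vals (.outer j)).toIdx else 0 := by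
  split_ifs with h <;> simp [outersOf, h]

theorem eval_congr_indexNodes {z : IndexExpr (SrcVar sg)}
    (h : ∀ u ∈ indexNodes e z, vals u = vals' u) :
    z.eval (srcEnv (dataOf vals) ((vals .bound).toIdx :: outersOf e vals)) =
      z.eval (srcEnv (dataOf vals') ((vals' .bound).toIdx :: outersOf e vals')) := by
  refine IndexExpr.eval_congr _ fun x hx => ?_
  have hx' : ∀ u ∈ srcNodes e x, vals u = vals' u := fun u hu =>
    h u (Set.mem_iUnion₂.mpr ⟨x, hx, hu⟩)
  rcases x with (_ | j) | p
  · exact congrArg Value.toIdx (hx' .bound rfl)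
  · change (outersOf e vals).getD j 0 = (outersOf e vals').getD j 0
    rw [getD_outersOf, getD_outersOf]
    split_ifs with hj
    · rw [hx' (.outer j) ⟨hj, rfl⟩]
    · rfl
  · exact congrArg Value.toIdx (hx' (.indexIn p) rfl)

theorem operandVal_congr {x : Operand} (h : ∀ u ∈ operandNodes L np T i x, vals u = vals' u) :
    operandVal L np T i vals x = operandVal L np T i vals' x := by
  cases x with
  | lit r => rfl
  | param s =>
    rw [operandVal, operandVal]
    split_ifs with hs
    · rw [h (.param s) ⟨hs, rfl⟩]
    · rfl
  | temp j =>
    rw [operandVal, operandVal]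
    split_ifs with hj
    · rw [h (.stmt j) ⟨hj, rfl⟩]
    · rfl

/-- At the entry `n = 0` the only non-input vertex is `φ`, and it reads only `outIn`. So agreement
there is demanded of `outIn` alone, in accordance with the edges of `intraEdge`. -/
theorem nodeVal_congr {k : ℕ} {L : LoopOver sg (Nest sg k)} {v : Node sg}
    (hk : nodeKind L v ≠ .input) (h0 : n = 0 → v = .phi)
    (h : ∀ u ∈ nodePreds L e np T v, (n = 0 → u = .outIn) → vals u = vals' u) :
    nodeVal L e np T n v vals = nodeVal L e np T n v vals' := by
  cases v with
  | bound =>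
    have hn : ∀ {P : Prop}, n = 0 → P := fun hn => by cases h0 hn
    simp only [nodeVal, LoopOver.counter]
    congr 2
    refine IndexExpr.eval_congr _ fun x hx => ?_
    cases x with
    | counter j =>
      change (outersOf e vals).getD j 0 = (outersOf e vals').getD j 0
      rw [getD_outersOf, getD_outersOf]
      split_ifs with hj
      · rw [h (.outer j) (Or.inl ⟨j, hx, hj, rfl⟩) hn]
      · rfl
    | input p => exact congrArg Value.toIdx (h (.indexIn p) (Or.inr ⟨p, hx, rfl⟩) hn)
  | phi =>
    simp only [nodeVal]
    split_ifs with hn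
    · exact h _ (Or.inl (Or.inl rfl)) fun _ => rfl
    · exact h _ (Or.inl (Or.inr rfl)) fun h => absurd h hn
  | stmt i =>
    have hn : ∀ {P : Prop}, n = 0 → P := fun hn => by cases h0 hn
    simp only [nodePreds] at h
    simp only [nodeVal]
    rcases hs : L.body[i]? with _ | ⟨g, op⟩
    · rfl
    · simp only [hs] at h
      have hop : ∀ x, (∀ u ∈ operandNodes L np T i x, vals u = vals' u) →
          operandVal L np T i vals x = operandVal L np T i vals' x := fun x hx =>
        operandVal_congr hx
      cases op with
      | assign x => simp only [hop x fun u hu => h u hu hn]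
      | un o x => simp only [hop x fun u hu => h u hu hn]
      | bin o x y =>
        simp only [hop x fun u hu => h u (Or.inl hu) hn, hop y fun u hu => h u (Or.inr hu) hn]
      | getIn a ix =>
        simp only [h (.arrayIn a) (Or.inl rfl) hn]
        rw [List.map_congr_left fun z hz => eval_congr_indexNodes fun u hu =>
          h u (Or.inr (Set.mem_iUnion₂.mpr ⟨z, hz, hu⟩)) hn]
      | getOut ix =>
        have hz := fun d => eval_congr_indexNodes (z := ix d) fun u hu =>
          h u (Or.inr (Set.mem_iUnion.mpr ⟨d, hu⟩)) hn
        simp only [h (reach L T i) (Or.inl rfl) hn, hz]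
      | set ix x =>
        have hz := fun d => eval_congr_indexNodes (z := ix d) fun u hu =>
          h u (Or.inl (Or.inr (Set.mem_iUnion.mpr ⟨d, hu⟩))) hn
        simp only [h (reach L T i) (Or.inl (Or.inl rfl)) hn, hz,
          hop x fun u hu => h u (Or.inr hu) hn]
      | call c args =>
        have hr := h (reach L T i) (Or.inl (Or.inl (Or.inl rfl))) hn
        have hb := h .bound (Or.inl (Or.inl (Or.inr rfl))) hn
        have hargs : (args.map fun x => operandVal L np T i vals x) =
            args.map fun x => operandVal L np T i vals' x := List.map_congr_left fun x hx =>
          hop x fun u hu => h u (Or.inl (Or.inr (Set.mem_iUnion₂.mpr ⟨x, hx, hu⟩))) hn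
        have hd : dataOf vals = dataOf vals' := by
          unfold dataOf
          congr 1
          · funext a
            rw [h (.arrayIn a) (Or.inr (Or.inl ⟨a, rfl⟩)) hn]
          · funext p
            rw [h (.indexIn p) (Or.inr (Or.inr (Or.inl ⟨p, rfl⟩))) hn]
          · funext b
            rw [h (.condIn b) (Or.inr (Or.inr (Or.inr (Or.inl ⟨b, rfl⟩)))) hn]
        have ho : outersOf e vals = outersOf e vals' := by
          unfold outersOf
          congr 1
          funext j
          rw [h (.outer j) (Or.inr (Or.inr (Or.inr (Or.inr ⟨j, j.2, rfl⟩)))) hn]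
        simp only [hr, hb, hargs, hd, ho]
  | _ => exact absurd rfl hk

end Congr

section Kernel

variable {K : ℕ} {L : Nest sg K} {inp : Input sg}

/-! ### The multilevel graph -/

theorem mem_vertexSet_stmt {v : Vertex sg}
    (hv : v ∈ vertexSet L inp) {i : ℕ} (hi : v.node = .stmt i) :
    1 ≤ v.iter ∧ i ∈ executedAt L inp v.loc v.iter := by
  obtain ⟨F', hF', ⟨-, h⟩ | ⟨h1, -, h⟩⟩ := hv
  · rw [hi] at h
    rcases h with h | h
    · exact (isInput_of_mem h).elim
    · cases h
  · rw [hi] at h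
    exact ⟨h1, stmt_mem_iterNodes.mp h⟩

theorem finite_vertexSet (L : Nest sg K) (inp : Input sg) : (vertexSet L inp).Finite := by
  refine ((finite_frameAt inp.data K L [] inp.nums inp.out).biUnion
    (t := fun loc => {v ∈ vertexSet L inp | v.loc = loc}) fun loc hloc => ?_).subset
      fun v hv => Set.mem_biUnion (x := v.loc) ?_ ⟨hv, rfl⟩
  · obtain ⟨F, hF⟩ := Option.isSome_iff_exists.mp hloc
    refine ((Set.finite_Iic F.loop.iters).biUnion (t := fun n => Vertex.mk loc n ''
      iterNodes F.cs.length F.ps.length (executedAt L inp loc n)) fun n _ =>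
        (finite_iterNodes _ _ _).image _).subset ?_
    rintro v ⟨⟨F', hF', h⟩, rfl⟩
    obtain rfl : F' = F := Option.some_inj.mp (hF'.symm.trans hF)
    rcases h with ⟨h0, h⟩ | ⟨-, h1, h⟩
    · refine Set.mem_biUnion (x := v.iter) (by simp [h0]) ⟨v.node, ?_, rfl⟩
      rcases h with h | h
      · exact inputNodes_subset _ _ _ h
      · rw [Set.mem_singleton_iff.mp h]
        exact phi_mem_iterNodes _ _ _
    · exact Set.mem_biUnion (x := v.iter) h1 ⟨v.node, h, rfl⟩
  · obtain ⟨F, hF, -⟩ := hv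
    exact Option.isSome_iff_exists.mpr ⟨F, hF⟩

/-- The predecessors of a vertex that are seen in its iteration are vertices. -/
theorem pred_mem_vertexSet {v : Vertex sg} {F : Frame sg} (hF : frame L inp v.loc = some F)
    (hv : v ∈ vertexSet L inp) {u : Node sg}
    (hu : u ∈ iterNodes F.cs.length F.ps.length (executedAt L inp v.loc v.iter))
    (h0 : v.iter = 0 → u = .outIn) :
    (⟨v.loc, srcIter u v.iter, u⟩ : Vertex sg) ∈ vertexSet L inp := by
  obtain ⟨F', hF', h⟩ := hv
  obtain rfl : F' = F := Option.some_inj.mp (hF'.symm.trans hF)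
  refine ⟨F', hF, ?_⟩
  rcases h with ⟨h1, -⟩ | ⟨h1, h2, -⟩
  · obtain rfl := h0 h1
    exact Or.inl ⟨h1, Or.inl (Or.inr (Or.inr (Or.inr (Or.inr (Or.inr rfl)))))⟩
  · by_cases hphi : u = .phi
    · subst hphi
      -- As a predecessor, `φ` lives one iteration earlier; for the first iteration this is the
      -- entry `0`, where `φ` is a vertex too.
      rcases Nat.eq_or_lt_of_le h1 with h3 | h3
      · exact Or.inl ⟨by simp [srcIter, ← h3], Or.inr rfl⟩
      · exact Or.inr ⟨by simp only [srcIter]; omega, by simp only [srcIter]; omega,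
          phi_mem_iterNodes _ _ _⟩
    · have hsrc : srcIter u v.iter = v.iter := by
        cases u <;> first | rfl | exact absurd rfl hphi
      exact Or.inr (by rw [hsrc]; exact ⟨h1, h2, hu⟩)

theorem smg_kind {v : Vertex sg} {F : Frame sg} (hF : frame L inp v.loc = some F) :
    (smg L inp).kind v = nodeKind F.loop v.node := by
  simp only [smg, hF]

theorem smg_op {v : Vertex sg} {F : Frame sg} (hF : frame L inp v.loc = some F)
    (D : Vertex sg → Value sg) : (smg L inp).op v D = nodeVal F.loop F.cs.length F.ps.length
      (executedAt L inp v.loc v.iter) v.iter v.node (sliceVals D v.loc v.iter) := by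
  simp only [smg, hF]

theorem vertexData_eq_nodeVal {v : Vertex sg} {F : Frame sg} (hF : frame L inp v.loc = some F)
    (hv : v ∈ vertexSet L inp) : vertexData L inp v = nodeVal F.loop F.cs.length F.ps.length
      (executedAt L inp v.loc v.iter) v.iter v.node
      (sliceVals (vertexData L inp) v.loc v.iter) := by
  rw [vertexData_eq hF, sliceVals_vertexData hF]
  exact (nodeVal_frameSlice (executedAt_eq hF v.iter).symm fun i hi =>
    (mem_vertexSet_stmt hv hi).2).symm

theorem kind_ne_input_of_stmt {v : Vertex sg} {F : Frame sg} (hF : frame L inp v.loc = some F)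
    (hv : v ∈ vertexSet L inp) {i : ℕ} (hi : v.node = .stmt i) :
    nodeKind F.loop v.node ≠ .input := by
  have h := (mem_vertexSet_stmt hv hi).2
  rw [executedAt_eq hF] at h
  obtain ⟨s, hs, -⟩ := (LoopOver.mem_executed _).mp h
  rw [hi]
  simp only [nodeKind, hs]
  cases s.op <;> exact fun h => by cases h

/-- Both values are read off the state of the calling iteration just before the call:
`frameAt_append` gives it on the side of the callee, `frameSlice_reach` and `operandVal_frameSlice`
on the side of the caller. -/
theorem vertexData_dual {u v : Vertex sg} (hv : v ∈ vertexSet L inp) (h : downEdge L inp u v) :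
    vertexData L inp v = vertexData L inp u := by
  obtain ⟨F, n, i, g, c, args, hF, hloc, hs, hdual, hiter⟩ := h
  obtain ⟨F', hF', -⟩ := hv
  have hF'' := hF'
  rw [hloc] at hF''
  obtain ⟨g', c', args', hs', hn, hcs, hps, harr⟩ := frameAt_append n i hF hF''
  rw [hs] at hs'
  cases hs'
  rw [vertexData_eq hF', vertexData_eq hF, hiter]
  have hT := (executedAt_eq hF n).symm
  generalize v.node = w at hdual ⊢
  change _ = frameSlice inp.data F n u.node
  cases w with
  | arrayIn a | indexIn a | condIn a =>
    rw [show u.node = _ from hdual]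
    rfl
  | param s =>
    obtain ⟨x, hx, hu⟩ := hdual
    have h1 := operandVal_frameSlice hT i x
    have h2 : F'.ps.getD s 0 = x.eval F.ps (bodyState (exec inp.data F.k) inp.data F.loop
        (F.loop.counter inp.data F.cs n :: F.cs) F.ps
        (loopState (exec inp.data F.k) inp.data F.loop F.cs F.ps F.arr (n - 1)) i).temps := by
      rw [hps, getD_map_operand, hx]
      rfl
    rw [frameVal, h2, ← h1]
    cases x with
    | lit r => exact hu.elim
    | param s' =>
      obtain ⟨h3, h4⟩ := hu
      rw [h4, operandVal, if_pos h3]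
      rfl
    | temp j =>
      obtain ⟨h3, h4⟩ := hu
      rw [h4, operandVal, if_pos h3]
      obtain ⟨-, -, s, hs, hw⟩ := readable_iff.mp h3
      change _ = frameVal inp.data F n (.stmt j)
      -- A readable statement does not write the array, so its value is a number and survives
      -- `toNum`.
      change Value.num (frameVal inp.data F n (.stmt j)).toNum = _
      rw [frameVal_stmt hs]
      simp [hw, Value.toNum]
  | outer j =>
    cases j with
    | zero =>
      rw [show u.node = _ from hdual, frameVal, hcs]
      rfl
    | succ j =>
      rw [show u.node = _ from hdual, frameVal, hcs]
      rfl
  | outIn =>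
    rw [show u.node = _ from hdual, frameSlice_reach hT, frameVal, harr]
  | _ => exact hdual.elim

/-- The call index is the rank of an invocation among the finitely many invocations of the same
loop, in the lexicographic order of the iteration numbers. A rank is strictly monotone, so it tells
invocations apart. -/
theorem smg_call_le_iff {u v : Vertex sg} (hu : u.loc ∈ invocations L inp u.path)
    (hp : u.path = v.path) :
    (smg L inp).call u ≤ (smg L inp).call v ↔ u.loc.map Prod.fst ≤ v.loc.map Prod.fst := by
  have hfin := finite_invocations L inp v.path
  simp only [smg, hp]
  constructor
  · intro h
    by_contra hlt
    rw [not_le] at hlt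
    refine absurd h (not_le.mpr (Set.ncard_lt_ncard ?_ (hfin.subset (Set.sep_subset _ _))))
    refine ⟨fun x hx => ⟨hx.1, hx.2.trans hlt.le⟩, fun h => ?_⟩
    exact absurd (h ⟨hp ▸ hu, le_rfl⟩).2 (not_le.mpr hlt)
  · exact fun h => Set.ncard_le_ncard (fun x hx => ⟨hx.1, hx.2.trans h⟩)
      (hfin.subset (Set.sep_subset _ _))

theorem loc_mem_invocations {v : Vertex sg} (hv : v ∈ vertexSet L inp) :
    v.loc ∈ invocations L inp v.path := by
  obtain ⟨F, hF, -⟩ := hv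
  exact ⟨rfl, by rw [hF]; rfl⟩

theorem loc_ext {l l' : List (ℕ × ℕ)} (h1 : l.map Prod.fst = l'.map Prod.fst)
    (h2 : l.map Prod.snd = l'.map Prod.snd) : l = l' := by
  induction l generalizing l' with
  | nil => cases l' with
    | nil => rfl
    | cons b l' => simp at h1
  | cons a l ih => cases l' with
    | nil => simp at h1
    | cons b l' =>
      simp only [List.map_cons, List.cons.injEq] at h1 h2
      rw [Prod.ext h1.1 h2.1, ih h1.2 h2.2]

theorem smg_isValid (L : Nest sg K) (inp : Input sg) : (smg L inp).IsValid K where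
  finite := finite_vertexSet L inp
  edges u v h := ⟨h.1, h.2.1⟩
  op_congr v hv hk D D' h := by
    have hv' : v ∈ vertexSet L inp := hv
    obtain ⟨F, hF, hcase⟩ := hv
    rw [smg_kind hF] at hk
    rw [smg_op hF, smg_op hF]
    refine nodeVal_congr hk (fun h0 => ?_) fun u hu h0 => ?_
    -- Iteration `0` has only input vertices, which are excluded by their kind, and `φ`.
    · rcases hcase with ⟨-, h | h⟩ | ⟨h1, -⟩
      · refine absurd ?_ hk
        have := isInput_of_mem h
        cases hn : v.node <;> rw [hn] at this <;> first | rfl | exact this.elim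
      · exact h
      · omega
    · refine h _ ⟨pred_mem_vertexSet hF hv' (nodePreds_subset _ _ _ _ _ hu) h0, hv',
        Or.inl ⟨F, hF, rfl, hu, h0, rfl⟩⟩
  data_eq v hv hk := by
    have hv' : v ∈ vertexSet L inp := hv
    obtain ⟨F, hF, -⟩ := hv
    rw [smg_op hF]
    exact vertexData_eq_nodeVal hF hv'
  input_eq v hv hk u h := by
    have hv' : v ∈ vertexSet L inp := hv
    obtain ⟨F, hF, -⟩ := hv
    rw [smg_kind hF] at hk
    obtain ⟨-, -, ⟨F', -, -, h, -⟩ | h | ⟨F', i, -, -, h, -⟩⟩ := h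
    · cases hn : v.node with
      | stmt i => exact absurd hk (kind_ne_input_of_stmt hF hv' hn)
      | phi | bound =>
        rw [hn] at hk
        cases hk
      | _ =>
        rw [hn] at h
        exact h.elim
    · exact vertexData_dual hv' h
    -- An edge from a called loop back up ends at the call statement, which is not an input.
    · exact absurd hk (kind_ne_input_of_stmt hF hv' h)
  level_mem v hv := by
    obtain ⟨F, hF, -⟩ := hv
    have := (frame_spec hF).1
    simp only [smg]
    omega
  call_pos v hv := by
    refine Nat.one_le_iff_ne_zero.mpr fun h => ?_
    rw [smg, Set.ncard_eq_zero ((finite_invocations L inp v.path).subset (Set.sep_subset _ _))] at h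
    exact Set.eq_empty_iff_forall_notMem.mp h v.loc ⟨loc_mem_invocations hv, le_rfl⟩
  call_inj u hu v hv hp := by
    have hu' := loc_mem_invocations hu
    have hv' := loc_mem_invocations hv
    constructor
    · intro h
      refine loc_ext (le_antisymm ?_ ?_) hp
      · exact (smg_call_le_iff hu' hp).mp h.le
      · exact (smg_call_le_iff hv' hp.symm).mp h.ge
    · intro h
      simp only [smg, hp, h]

/-! ### The invariant graph -/

theorem frame_of_mem_invocations {p : List ℕ} {Q : LoopInfo sg} (hQ : loopOf L p = some Q)
    {loc : List (ℕ × ℕ)} (h : loc ∈ invocations L inp p) :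
    ∃ F, frame L inp loc = some F ∧ F.cs.length = p.length ∧ Q = ⟨F.k, F.loop, F.ps.length⟩ := by
  obtain ⟨rfl, h⟩ := h
  obtain ⟨F, hF⟩ := Option.isSome_iff_exists.mp h
  obtain ⟨-, h2, h3⟩ := frame_spec hF
  exact ⟨F, hF, by simpa using h2, Option.some_inj.mp (hQ.symm.trans h3)⟩

theorem intraEdge_of_loc_eq {u v : Vertex sg} (h : (smg L inp).E u v) (hloc : u.loc = v.loc) :
    intraEdge L inp u v := by
  obtain ⟨-, -, h | ⟨F, n, i, g, c, args, -, h, -⟩ | ⟨F, i, -, h, -⟩⟩ := h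
  · exact h
  all_goals
    rw [hloc] at h
    have := congrArg List.length h
    simp at this

theorem mem_slice {loc : List (ℕ × ℕ)} {n : ℕ} {v : Vertex sg} {F : Frame sg}
    (hF : frame L inp loc = some F) (h1 : 1 ≤ n) (hn : n ≤ F.loop.iters) :
    v ∈ (smg L inp).slice loc n ↔ v.loc = loc ∧ v.iter = n ∧
      v.node ∈ iterNodes F.cs.length F.ps.length (executedAt L inp loc n) := by
  constructor
  · rintro ⟨⟨F', hF', h⟩, rfl, rfl⟩
    obtain rfl : F' = F := Option.some_inj.mp (hF'.symm.trans hF)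
    rcases h with ⟨h0, -⟩ | ⟨-, -, h⟩
    · have : v.iter = 0 := h0
      change 1 ≤ v.iter at h1
      omega
    · exact ⟨rfl, rfl, h⟩
  · rintro ⟨rfl, rfl, h⟩
    exact ⟨⟨F, hF, Or.inr ⟨h1, hn, h⟩⟩, rfl, rfl⟩

theorem invSub_eq {p : List ℕ} {Q : LoopInfo sg} (hQ : loopOf L p = some Q)
    (T : List ℕ → Finset ℕ) : invSub L T p = invSubgraph Q.loop p.length Q.np (T p) := by
  simp only [invSub, hQ]

/-- An edge inside an invocation is decided by the executed set of the iteration of its target. With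
the set `T` at both ends it is an edge of the invariant subgraph, both within an iteration and
across iterations. -/
theorem invSubgraph_edge_of_smg {F : Frame sg} {loc : List (ℕ × ℕ)} {i j : ℕ} {T : Finset ℕ}
    (hF : frame L inp loc = some F) (hi : 1 ≤ i) (hi' : i ≤ F.loop.iters) (hj : 1 ≤ j)
    (hj' : j ≤ F.loop.iters) (hTi : executedAt L inp loc i = T)
    (hTj : executedAt L inp loc j = T) {u v : Vertex sg} (hu : u ∈ (smg L inp).slice loc i)
    (hv : v ∈ (smg L inp).slice loc j) (h : (smg L inp).E u v) :
    (invSubgraph F.loop F.cs.length F.ps.length T).E u.node v.node := by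
  obtain ⟨hu1, -, hu2⟩ := (mem_slice hF hi hi').mp hu
  obtain ⟨hv1, hv3, hv2⟩ := (mem_slice hF hj hj').mp hv
  obtain ⟨F', hF', -, h, -⟩ := intraEdge_of_loc_eq h (hu1.trans hv1.symm)
  rw [hv1] at hF'
  obtain rfl : F' = F := Option.some_inj.mp (hF'.symm.trans hF)
  rw [hv1, hv3, hTj] at h
  rw [hTi] at hu2
  rw [hTj] at hv2
  exact ⟨hu2, hv2, Or.inl h⟩

theorem isInvSubgraph_invSubgraph {p : List ℕ} {Q : LoopInfo sg} (hQ : loopOf L p = some Q)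
    (T : Finset ℕ) :
    IsInvSubgraph L p Q.loop.iters T (invSubgraph Q.loop p.length Q.np T) where
  bij inp loc hloc n h1 hn hT := by
    obtain ⟨F, hF, hcs, rfl⟩ := frame_of_mem_invocations hQ hloc
    rw [← hcs]
    refine ⟨⟨fun v hv => ?_, fun u hu v hv h => ?_, fun w hw => ?_⟩, fun u hu v hv h => ?_,
      fun v hv => ?_⟩
    · have := ((mem_slice hF h1 hn).mp hv).2.2
      rwa [hT] at this
    · obtain ⟨hu1, hu2, -⟩ := (mem_slice hF h1 hn).mp hu
      obtain ⟨hv1, hv2, -⟩ := (mem_slice hF h1 hn).mp hv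
      cases u
      cases v
      simp_all
    · exact ⟨⟨loc, n, w⟩, (mem_slice hF h1 hn).mpr ⟨rfl, rfl, hT ▸ hw⟩, rfl⟩
    · exact invSubgraph_edge_of_smg hF h1 hn h1 hn hT hT hu hv h
    · obtain ⟨hv1, hv2, hv3⟩ := (mem_slice hF h1 hn).mp hv
      have hF' : frame L inp v.loc = some F := hv1 ▸ hF
      refine ⟨smg_kind hF', fun _ => ?_⟩
      simp only [invSubgraph]
      split_ifs with hphi
      · rw [show (smg L inp).data = vertexData L inp from rfl, vertexData_eq hF',
          sliceVals_vertexData hF, hv2, hphi]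
        exact (extPhiVal_frameSlice T).symm
      · have := vertexData_eq_nodeVal hF' hv.1
        rw [hv1, hv2, hT] at this
        exact this
  cross inp loc hloc i j _ hi hi' hj hj' hTi hTj u hu v hv h := by
    obtain ⟨F, hF, hcs, rfl⟩ := frame_of_mem_invocations hQ hloc
    rw [← hcs]
    exact invSubgraph_edge_of_smg hF hi hi' hj hj' hTi hTj hu hv h
  ext_phi := by
    refine ⟨phi_mem_iterNodes _ _ _, rfl, fun inp loc hloc n hn => ?_⟩
    obtain ⟨F, hF, hcs, rfl⟩ := frame_of_mem_invocations hQ hloc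
    rw [← hcs]
    simp only [invSubgraph, if_true]
    rw [show (smg L inp).data = vertexData L inp from rfl, vertexData_eq hF,
      sliceVals_vertexData hF]
    exact (extPhiVal_frameSlice T).symm

theorem isInvGraph_invGraph (L : Nest sg K) (T : List ℕ → Finset ℕ) :
    IsInvGraph L T (invGraph L T) where
  sub p Q hQ := by
    change IsInvSubgraph L p _ _ (invSub L T p)
    rw [invSub_eq hQ]
    exact isInvSubgraph_invSubgraph hQ (T p)
  vertices p v := by
    refine ⟨fun h => ⟨?_, h⟩, And.right⟩
    rcases hQ : loopOf L p with _ | Q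
    · simp [invGraph, invSub, hQ] at h
    · rfl
  intra p u v := by
    change (_ ∧ _ ∧ _) ↔ _
    simp only [true_and, ne_eq, not_true, false_and, or_false]
    rcases hQ : loopOf L p with _ | Q
    · simp [invGraph, invSub, hQ]
    · simp only [invGraph, invSub_eq hQ]
      exact ⟨fun h => ⟨rfl, h.2.2⟩, fun h => ⟨h.2.1, h.2.2.1, h.2⟩⟩
  inter p q u v hpq := by
    change (_ ∧ _ ∧ _) ↔ _
    simp only [hpq, false_and, ne_eq, not_false_iff, true_and, false_or]
    rfl

end Kernel

end StencilLifting

/-! ### Assembly of the theorem. -/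

theorem mainTheorem5 (sg : StencilLifting.Signature) (K : ℕ) (L : StencilLifting.Nest sg K)
    (hL : StencilLifting.IsNestedLoop sg K L) (c : ℝ) (hc : 1 < c) (s : ℕ)
    (hreg : ∀ p, (StencilLifting.loopOf L p).isSome = true →
      StencilLifting.IsRegular L c s p) :
    (∃ T : List ℕ → Finset ℕ, ∀ p, (StencilLifting.loopOf L p).isSome = true →
      StencilLifting.RegularWith L c s p (T p)) ∧
    ∀ T : List ℕ → Finset ℕ, (∀ p, (StencilLifting.loopOf L p).isSome = true →
        StencilLifting.RegularWith L c s p (T p)) →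
      (∀ inp, (StencilLifting.smg L inp).IsValid K) ∧
      StencilLifting.IsInvGraph L T (StencilLifting.invGraph L T) ∧
      (∃ st : StencilLifting.Strategy sg, st.IsValid L T) ∧
      ∀ st : StencilLifting.Strategy sg, st.IsValid L T →
        ∃ S, (∃ n, ∀ fuel, n ≤ fuel → StencilLifting.liftKernel L st T fuel = some S) ∧
          StencilLifting.IsSoundSummary L S := by
  refine ⟨?_, fun T _ => ⟨StencilLifting.smg_isValid L, StencilLifting.isInvGraph_invGraph L T,
    StencilLifting.exists_isValid L T, StencilLifting.liftKernel_sound L T⟩⟩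
  have h : ∀ p, ∃ T, (StencilLifting.loopOf L p).isSome = true →
      StencilLifting.RegularWith L c s p T := fun p => by
    by_cases hp : (StencilLifting.loopOf L p).isSome = true
    · obtain ⟨T, hT⟩ := hreg p hp
      exact ⟨T, fun _ => hT⟩
    -- Positions at which there is no loop get a dummy set.
    · exact ⟨∅, fun h => absurd h hp⟩
  choose T hT using h
  exact ⟨T, hT⟩
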